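/- Notation. All matrices are real $3\times3$, $[A,B]=AB-BA$, $\|A\|^2=\operatorname{Tr}(A^TA)$. Let $J\in\mathbb R$ be a constant, $\mathcal U$ a smooth function on $(0,\infty)$, and $\mathcal F(Q,\nabla Q)$ a smooth free energy density (for example the Landau–de Gennes polynomial). For a symmetric matrix field $Q$ the molecular field is the symmetric part $$h=\operatorname{sym}\Big(-\frac{\partial\mathcal F}{\partial Q}+\operatorname{div}\frac{\partial\mathcal F}{\partial\nabla Q}\Big),$$ and the pressure is $p=\rho^2\,\mathcal U'(\rho)-\mathcal F(Q,\nabla Q)$. Conformal-rotation ansatz. Let $\mathcal Q_0(\mathbf x_0)$ be a smooth symmetric matrix field (in particular it may be traceless) and $\rho_0(\mathbf x_0)>0$ a smooth density on $\mathbb R^3$. Let $\mathbf X(\cdot,t)$ be a smooth path of diffeomorphisms of $\mathbb R^3$ (jointly smooth in $(\mathbf{x}_0,t)$, together with the inverses), $\mathcal R(\mathbf x_0,t)\in SO(3)$ and $\lambda(\mathbf x_0,t)>0$ smooth, for $t\in\mathbb R$. Define the Eulerian fields $$\rho=\mathbf X_*\rho_0,\quad \boldsymbol u=\dot{\mathbf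 X}\circ\mathbf X^{-1},\quad Q=(\lambda^2\mathcal R\mathcal Q_0\mathcal R^T)\circ\mathbf X^{-1},\quad \widehat\nu=(\partial_t\mathcal R\,\mathcal R^{-1})\circ\mathbf X^{-1},\quad \Lambda=(\lambda^{-1}\partial_t\lambda)\circ\mathbf X^{-1},$$ and $D_t=\partial_t+\boldsymbol u\cdot\nabla$. Fix $t_1<t_2$. Then the following hold. (a) On all of space-time, $D_t\rho=-\rho\operatorname{div}\boldsymbol u$ and $D_tQ=[\widehat\nu,Q]+2\Lambda Q$, and the Qian–Sheng Lagrangian density (without its trace multiplier) equals the modified one: $$\tfrac12\rho\|\boldsymbol u\|^2+\tfrac J2\rho\|D_tQ\|^2-\rho\,\mathcal U(\rho)-\mathcal F=\ell:=\tfrac12\rho\|\boldsymbol u\|^2+\tfrac J2\rho\|[\widehat\nu,Q]\|^2+2\rho J\Lambda^2\|Q\|^2-\rho\,\mathcal U(\rho)-\mathcal F(Q,\nabla Q).$$ (b) For every smooth one-parameter variation of $(\mathbf X,\mathcal R,\lambda)$ through such motions, with $\boldsymbol w=\delta\mathbf X\circ\mathbf X^{-1}$, $\widehat\eta=(\delta\mathcal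 R\,\mathcal R^{-1})\circ\mathbf X^{-1}$, $\Xi=(\lambda^{-1}\delta\lambda)\circ\mathbf X^{-1}$, the Eulerian fields vary by $$\delta\rho=-\operatorname{div}(\rho\boldsymbol w),\qquad \delta\boldsymbol u=\partial_t\boldsymbol w+(\boldsymbol u\cdot\nabla)\boldsymbol w-(\boldsymbol w\cdot\nabla)\boldsymbol u,\qquad \delta Q=[\widehat\eta,Q]+2\Xi Q-(\boldsymbol w\cdot\nabla)Q,$$ $$\delta\widehat\nu=\partial_t\widehat\eta-(\boldsymbol w\cdot\nabla)\widehat\nu+(\boldsymbol u\cdot\nabla)\widehat\eta+[\widehat\eta,\widehat\nu],\qquad \delta\Lambda=\partial_t\Xi-(\boldsymbol w\cdot\nabla)\Lambda+(\boldsymbol u\cdot\nabla)\Xi .\tag{V}$$ (c) The modified action principle $\delta\int_{t_1}^{t_2}\!\int_{\mathbb R^3}\ell\,\mathrm d^3x\,\mathrm dt=0$, under all variations (V) with arbitrary smooth $\boldsymbol w$, $\widehat\eta$ (skew), $\Xi$ that vanish at $t_1$, $t_2$ and outside a compact set of space, holds if and only if, on $[t_1,t_2]\times\mathbb R^3$,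 $$\rho D_t\boldsymbol u=-\nabla p-\partial_l\Big(\frac{\partial\mathcal F}{\partial Q_{ij,l}}\nabla Q_{ij}\Big),\qquad D_t\rho=-\rho\operatorname{div}\boldsymbol u,$$ $$\rho JD_t\big[[\widehat\nu,Q],Q\big]=[h,Q],\qquad D_tQ=[\widehat\nu,Q]+2\Lambda Q,$$ $$2\rho J\|Q\|^2(D_t\Lambda+2\Lambda^2)=\rho J\|[\widehat\nu,Q]\|^2+\operatorname{Tr}(hQ).$$ (The first variation is the derivative at $\varepsilon=0$ of $\int\!\!\int(\ell_\varepsilon-\ell)\,\mathrm d^3x\,\mathrm dt$, where $\ell_\varepsilon$ is $\ell$ at the fields plus $\varepsilon$ times their variations.) (d) At every point of space-time, the equation $\rho JD_t[[\widehat\nu,Q],Q]=[h,Q]$ is equivalent to $[\rho JD_t^2Q-h,Q]=0$, and the scaling equation (the last one in (c)) is equivalent to $\operatorname{Tr}\big((\rho JD_t^2Q-h)Q\big)=0$. (e) Dissipation. Let $r(\boldsymbol u,\rho,Q,D_tQ)$ be any Rayleigh function whose functional derivatives $\frac{\delta r}{\delta\boldsymbol u}$ and $\frac{\delta r}{\delta(D_tQ)}$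 (the latter symmetric) exist along the motion and are continuous. The principle $$\delta\int_{t_1}^{t_2}\!\!\int\ell\,\mathrm d^3x\,\mathrm dt=\int_{t_1}^{t_2}\!\!\int\Big(\frac{\delta r}{\delta\boldsymbol u}\cdot\boldsymbol w+\operatorname{Tr}\Big(\frac{\delta r}{\delta(D_tQ)}\big([\widehat\eta,Q]+2\Xi Q\big)\Big)\Big)\mathrm d^3x\,\mathrm dt,$$ for the same variations as in (c), holds if and only if, on $[t_1,t_2]\times\mathbb R^3$, $$\rho D_t\boldsymbol u=-\nabla p-\partial_l\Big(\frac{\partial\mathcal F}{\partial Q_{ij,l}}\nabla Q_{ij}\Big)-\frac{\delta r}{\delta\boldsymbol u},\qquad \Big[\rho JD_t^2Q-h+\frac{\delta r}{\delta(D_tQ)},Q\Big]=0,$$ $$J\rho\operatorname{Tr}(QD_t^2Q)=\operatorname{Tr}\Big(\Big(h-\frac{\delta r}{\delta(D_tQ)}\Big)Q\Big),\qquad D_t\rho+\rho\operatorname{div}\boldsymbol u=0 .$$ -/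

import Mathlib

open scoped ContDiff Matrix Matrix.Norms.Frobenius

namespace QTensorFlow

noncomputable section

/-- Physical space. -/
abbrev E3 := EuclideanSpace ℝ (Fin 3)

/-- Real 3 by 3 matrices; `‖A‖` is the Frobenius norm, `‖A‖ ^ 2 = Tr (Aᵀ A)`, and
`⁅A, B⁆ = A * B - B * A`. -/
abbrev Mat3 := Matrix (Fin 3) (Fin 3) ℝ

/-- Points `(t, x)` of space-time. -/
abbrev SpaceTime := ℝ × E3

section Calculus

variable {V : Type*} [NormedAddCommGroup V] [NormedSpace ℝ V]

/-- The time derivative `∂ₜ f`. -/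
def dt (f : SpaceTime → V) (p : SpaceTime) : V := fderiv ℝ f p (1, 0)

/-- The spatial derivative `∂ᵢ f`. -/
def dx (i : Fin 3) (f : SpaceTime → V) (p : SpaceTime) : V :=
  fderiv ℝ f p (0, EuclideanSpace.single i 1)

/-- `(w · ∇) f`. -/
def adv (w : SpaceTime → E3) (f : SpaceTime → V) (p : SpaceTime) : V :=
  ∑ i, w p i • dx i f p

/-- The convective derivative `Dₜ f = ∂ₜ f + (u · ∇) f`. -/
def matD (u : SpaceTime → E3) (f : SpaceTime → V) (p : SpaceTime) : V :=
  dt f p + adv u f p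

/-- The spatial divergence. -/
def divg (w : SpaceTime → E3) (p : SpaceTime) : ℝ := ∑ i, dx i (fun q => w q i) p

end Calculus

/-! ### Material description -/

/-- Reference density `ρ₀ > 0` and reference order parameter `Q₀` (a symmetric matrix field),
both functions of the label `x₀`. -/
structure RefData where
  rho0 : E3 → ℝ
  Q0 : E3 → Mat3
  rho0_smooth : ContDiff ℝ ∞ rho0
  Q0_smooth : ContDiff ℝ ∞ Q0
  rho0_pos : ∀ x, 0 < rho0 x
  Q0_symm : ∀ x, (Q0 x)ᵀ = Q0 x

/-- A smooth motion: the fluid path `X (t, x₀)`, with inverse `Y (t, ·) = X (t, ·)⁻¹` at each time,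
together with the rotation `R (t, x₀)` and the dilation `lam (t, x₀) > 0` of each particle. -/
structure Motion where
  X : SpaceTime → E3
  Y : SpaceTime → E3
  R : SpaceTime → Mat3
  lam : SpaceTime → ℝ
  X_smooth : ContDiff ℝ ∞ X
  Y_smooth : ContDiff ℝ ∞ Y
  R_smooth : ContDiff ℝ ∞ R
  lam_smooth : ContDiff ℝ ∞ lam
  Y_X : ∀ t x, Y (t, X (t, x)) = x
  X_Y : ∀ t x, X (t, Y (t, x)) = x
  R_rot : ∀ p, R p ∈ Matrix.specialOrthogonalGroup (Fin 3) ℝ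
  lam_pos : ∀ p, 0 < lam p

/-- The Eulerian fields: density, velocity, angular velocity matrix, dilation rate and order
parameter. -/
structure Fields where
  rho : SpaceTime → ℝ
  u : SpaceTime → E3
  nu : SpaceTime → Mat3
  Lam : SpaceTime → ℝ
  Q : SpaceTime → Mat3

/-- Composition of a material field with the inverse of the fluid path, `f ↦ f ∘ X⁻¹`. -/
def Motion.toEuler {V : Type*} (m : Motion) (f : SpaceTime → V) (p : SpaceTime) : V :=
  f (p.1, m.Y p)

/-- The Eulerian fields of a motion under the conformal-rotation ansatz:
`ρ = X_* ρ₀` (push-forward of the density), `u = ∂ₜX ∘ X⁻¹`, `ν̂ = (∂ₜR R⁻¹) ∘ X⁻¹`,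
`Λ = (λ⁻¹ ∂ₜλ) ∘ X⁻¹`, `Q = (λ² R Q₀ Rᵀ) ∘ X⁻¹`. -/
def Motion.fields (d : RefData) (m : Motion) : Fields where
  rho := fun p => d.rho0 (m.Y p) * |(fderiv ℝ (fun x => m.Y (p.1, x)) p.2).det|
  u := m.toEuler (dt m.X)
  nu := m.toEuler fun q => dt m.R q * (m.R q)⁻¹
  Lam := m.toEuler fun q => (m.lam q)⁻¹ * dt m.lam q
  Q := m.toEuler fun q => m.lam q ^ 2 • (m.R q * d.Q0 q.2 * (m.R q)ᵀ)

/-! ### Free energy and molecular field -/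

/-- `∂F/∂Q`, entry by entry, for a free energy density `F (Q, ∇Q)`; the second argument of `F` is
the triple `(∂₁Q, ∂₂Q, ∂₃Q)`. -/
def dFdQ (F : Mat3 × (Fin 3 → Mat3) → ℝ) (z : Mat3 × (Fin 3 → Mat3)) : Mat3 :=
  Matrix.of fun i j => deriv (fun s : ℝ => F (z.1 + s • Matrix.single i j 1, z.2)) 0

/-- `∂F/∂Q_{,l}`, entry by entry. -/
def dFdGrad (F : Mat3 × (Fin 3 → Mat3) → ℝ) (l : Fin 3) (z : Mat3 × (Fin 3 → Mat3)) : Mat3 :=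
  Matrix.of fun i j =>
    deriv (fun s : ℝ => F (z.1, z.2 + s • (Pi.single l (Matrix.single i j 1) : Fin 3 → Mat3))) 0

/-- The pair `(Q, ∇Q)` at a point. -/
def jet (Q : SpaceTime → Mat3) (p : SpaceTime) : Mat3 × (Fin 3 → Mat3) :=
  (Q p, fun l => dx l Q p)

/-- The molecular field `h = - ∂F/∂Q + div (∂F/∂∇Q)`, symmetrised. -/
def molField (F : Mat3 × (Fin 3 → Mat3) → ℝ) (Q : SpaceTime → Mat3) (p : SpaceTime) : Mat3 :=
  let h0 : Mat3 := - dFdQ F (jet Q p) + ∑ l, dx l (fun q => dFdGrad F l (jet Q q)) p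
  (1 / 2 : ℝ) • (h0 + h0ᵀ)

/-- The pressure `p = ρ² U'(ρ) - F`. -/
def pressure (U : ℝ → ℝ) (F : Mat3 × (Fin 3 → Mat3) → ℝ) (φ : Fields) (p : SpaceTime) : ℝ :=
  φ.rho p ^ 2 * deriv U (φ.rho p) - F (jet φ.Q p)

/-! ### Lagrangians and action principles -/

/-- The Qian-Sheng Lagrangian density, without the multiplier term for the trace. -/
def lagrQS (J : ℝ) (U : ℝ → ℝ) (F : Mat3 × (Fin 3 → Mat3) → ℝ)
    (rho : SpaceTime → ℝ) (u : SpaceTime → E3) (Q : SpaceTime → Mat3) (p : SpaceTime) : ℝ :=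
  1 / 2 * rho p * ‖u p‖ ^ 2 + J / 2 * rho p * ‖matD u Q p‖ ^ 2
    - rho p * U (rho p) - F (jet Q p)

/-- The modified Lagrangian density, in terms of `ρ, u, ν̂, Λ, Q`. -/
def lagr (J : ℝ) (U : ℝ → ℝ) (F : Mat3 × (Fin 3 → Mat3) → ℝ) (φ : Fields) (p : SpaceTime) : ℝ :=
  1 / 2 * φ.rho p * ‖φ.u p‖ ^ 2 + J / 2 * φ.rho p * ‖⁅φ.nu p, φ.Q p⁆‖ ^ 2
    + 2 * φ.rho p * J * φ.Lam p ^ 2 * ‖φ.Q p‖ ^ 2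
    - φ.rho p * U (φ.rho p) - F (jet φ.Q p)

/-- The fields `φ + ε δφ`. -/
def Fields.perturb (φ δφ : Fields) (ε : ℝ) : Fields where
  rho := φ.rho + ε • δφ.rho
  u := φ.u + ε • δφ.u
  nu := φ.nu + ε • δφ.nu
  Lam := φ.Lam + ε • δφ.Lam
  Q := φ.Q + ε • δφ.Q

/-- The space-time region `[t₁, t₂] × ℝ³`. -/
def slab (t₁ t₂ : ℝ) : Set SpaceTime := Set.Icc t₁ t₂ ×ˢ Set.univ

/-- `δ ∫∫ ℓ dx dt = c` in the direction `δφ`, for the modified Lagrangian `ℓ`. The action of `φ`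
itself, which may be infinite over all of space, is subtracted under the integral sign. -/
def HasFirstVariation (J : ℝ) (U : ℝ → ℝ) (F : Mat3 × (Fin 3 → Mat3) → ℝ) (t₁ t₂ : ℝ)
    (φ δφ : Fields) (c : ℝ) : Prop :=
  HasDerivAt
    (fun ε : ℝ => ∫ p in slab t₁ t₂, (lagr J U F (φ.perturb δφ ε) p - lagr J U F φ p)) c 0

/-- Generators of variations: `w` moves the particles, `η̂` rotates and `Ξ` dilates. -/
structure Generator where
  w : SpaceTime → E3
  eta : SpaceTime → Mat3
  Xi : SpaceTime → ℝ

/-- Arbitrary smooth generators, `η̂` skew, vanishing at the times `t₁`, `t₂` and outside of a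
compact set of space. -/
structure Generator.Admissible (t₁ t₂ : ℝ) (v : Generator) : Prop where
  w_smooth : ContDiff ℝ ∞ v.w
  eta_smooth : ContDiff ℝ ∞ v.eta
  Xi_smooth : ContDiff ℝ ∞ v.Xi
  eta_skew : ∀ p, (v.eta p)ᵀ = - v.eta p
  endpoints : ∀ t x, t = t₁ ∨ t = t₂ → v.w (t, x) = 0 ∧ v.eta (t, x) = 0 ∧ v.Xi (t, x) = 0
  support : ∃ K : Set E3, IsCompact K ∧
    ∀ t, ∀ x ∉ K, v.w (t, x) = 0 ∧ v.eta (t, x) = 0 ∧ v.Xi (t, x) = 0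

/-- The Euler-Poincaré variations of the Eulerian fields generated by `w, η̂, Ξ`. -/
def Generator.variation (v : Generator) (φ : Fields) : Fields where
  rho := fun p => - divg (fun q => φ.rho q • v.w q) p
  u := fun p => dt v.w p + adv φ.u v.w p - adv v.w φ.u p
  nu := fun p => dt v.eta p - adv v.w φ.nu p + adv φ.u v.eta p + ⁅v.eta p, φ.nu p⁆
  Lam := fun p => dt v.Xi p - adv v.w φ.Lam p + adv φ.u v.Xi p
  Q := fun p => ⁅v.eta p, φ.Q p⁆ + (2 * v.Xi p) • φ.Q p - adv v.w φ.Q p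

/-- The modified action principle. -/
def HamiltonPrinciple (J : ℝ) (U : ℝ → ℝ) (F : Mat3 × (Fin 3 → Mat3) → ℝ) (t₁ t₂ : ℝ)
    (φ : Fields) : Prop :=
  ∀ v : Generator, v.Admissible t₁ t₂ → HasFirstVariation J U F t₁ t₂ φ (v.variation φ) 0

/-- The modified action principle with dissipative forces `A = δr/δu` and `B = δr/δ(DₜQ)`. The
force `B` is paired with `[η̂, Q] + 2 Ξ Q`, the material variation `δ(Q ∘ X)` in Eulerian form. -/
def DissipativePrinciple (J : ℝ) (U : ℝ → ℝ) (F : Mat3 × (Fin 3 → Mat3) → ℝ) (t₁ t₂ : ℝ)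
    (φ : Fields) (A : SpaceTime → E3) (B : SpaceTime → Mat3) : Prop :=
  ∀ v : Generator, v.Admissible t₁ t₂ →
    HasFirstVariation J U F t₁ t₂ φ (v.variation φ)
      (∫ p in slab t₁ t₂, (inner ℝ (A p) (v.w p)
        + (B p * (⁅v.eta p, φ.Q p⁆ + (2 * v.Xi p) • φ.Q p)).trace))

/-- `g` is the functional derivative at `f` of the functional with density `r`, for the pairing
`pair`, with respect to compactly supported smooth variations of `f` with values in `W`. -/
def HasFunctionalDeriv {V : Type*} [NormedAddCommGroup V] [NormedSpace ℝ V]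
    (r : (E3 → V) → E3 → ℝ) (pair : V → V → ℝ) (W : Set V) (f g : E3 → V) : Prop :=
  ∀ δf : E3 → V, ContDiff ℝ ∞ δf → HasCompactSupport δf → (∀ x, δf x ∈ W) →
    (∀ᶠ ε : ℝ in nhds 0, MeasureTheory.Integrable fun x => r (f + ε • δf) x - r f x) ∧
    HasDerivAt (fun ε : ℝ => ∫ x, (r (f + ε • δf) x - r f x)) (∫ x, pair (g x) (δf x)) 0

/-- `A = δr/δu` and `B = δr/δ(DₜQ)` at all times of `[t₁, t₂]`, for a Rayleigh dissipation function
with density `r (u, ρ, Q, DₜQ)`. The density may be any expression in the four fields at the given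
time; the order parameter and its rate are symmetric matrices. -/
structure RayleighForces (r : (E3 → E3) → (E3 → ℝ) → (E3 → Mat3) → (E3 → Mat3) → E3 → ℝ)
    (t₁ t₂ : ℝ) (φ : Fields) (A : SpaceTime → E3) (B : SpaceTime → Mat3) : Prop where
  A_cont : Continuous A
  B_cont : Continuous B
  B_symm : ∀ p, (B p)ᵀ = B p
  deriv_u : ∀ t ∈ Set.Icc t₁ t₂,
    HasFunctionalDeriv
      (fun v => r v (fun x => φ.rho (t, x)) (fun x => φ.Q (t, x)) (fun x => matD φ.u φ.Q (t, x)))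
      (fun a b => inner ℝ a b) Set.univ (fun x => φ.u (t, x)) (fun x => A (t, x))
  deriv_DtQ : ∀ t ∈ Set.Icc t₁ t₂,
    HasFunctionalDeriv
      (fun P => r (fun x => φ.u (t, x)) (fun x => φ.rho (t, x)) (fun x => φ.Q (t, x)) P)
      (fun a b => (a * b).trace) {S | Sᵀ = S} (fun x => matD φ.u φ.Q (t, x)) (fun x => B (t, x))

/-! ### Equations of motion -/

/-- `ρ Dₜu = - ∇p - ∂ₗ ((∂F/∂Q_{ij,l}) ∇Q_{ij}) - A`, with `A` the dissipative force. -/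
def MomentumEq (U : ℝ → ℝ) (F : Mat3 × (Fin 3 → Mat3) → ℝ) (φ : Fields) (A : SpaceTime → E3)
    (p : SpaceTime) : Prop :=
  ∀ k : Fin 3, φ.rho p * matD φ.u φ.u p k =
    - dx k (pressure U F φ) p
      - ∑ l, dx l (fun q => ∑ i, ∑ j, dFdGrad F l (jet φ.Q q) i j * dx k φ.Q q i j) p
      - A p k

/-- `Dₜρ = - ρ div u`. -/
def ContinuityEq (φ : Fields) (p : SpaceTime) : Prop :=
  matD φ.u φ.rho p = - φ.rho p * divg φ.u p

/-- `DₜQ = [ν̂, Q] + 2 Λ Q`. -/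
def QEvolutionEq (φ : Fields) (p : SpaceTime) : Prop :=
  matD φ.u φ.Q p = ⁅φ.nu p, φ.Q p⁆ + (2 * φ.Lam p) • φ.Q p

/-- `ρ J Dₜ[[ν̂, Q], Q] = [h, Q]`. -/
def VKEq (J : ℝ) (F : Mat3 × (Fin 3 → Mat3) → ℝ) (φ : Fields) (p : SpaceTime) : Prop :=
  (φ.rho p * J) • matD φ.u (fun q => ⁅⁅φ.nu q, φ.Q q⁆, φ.Q q⁆) p = ⁅molField F φ.Q p, φ.Q p⁆

/-- `2 ρ J ‖Q‖² (DₜΛ + 2 Λ²) = ρ J ‖[ν̂, Q]‖² + Tr (h Q)`. -/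
def ScalingEq (J : ℝ) (F : Mat3 × (Fin 3 → Mat3) → ℝ) (φ : Fields) (p : SpaceTime) : Prop :=
  2 * φ.rho p * J * ‖φ.Q p‖ ^ 2 * (matD φ.u φ.Lam p + 2 * φ.Lam p ^ 2) =
    φ.rho p * J * ‖⁅φ.nu p, φ.Q p⁆‖ ^ 2 + (molField F φ.Q p * φ.Q p).trace

/-- The second convective derivative `Dₜ² Q`. -/
def matD2Q (φ : Fields) : SpaceTime → Mat3 := matD φ.u (matD φ.u φ.Q)

/-! ### Variations of motions -/

/-- A smooth one-parameter family of motions (a variation of the motion at parameter `0`). -/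
structure MotionFamily where
  m : ℝ → Motion
  X_smooth : ContDiff ℝ ∞ fun z : ℝ × SpaceTime => (m z.1).X z.2
  Y_smooth : ContDiff ℝ ∞ fun z : ℝ × SpaceTime => (m z.1).Y z.2
  R_smooth : ContDiff ℝ ∞ fun z : ℝ × SpaceTime => (m z.1).R z.2
  lam_smooth : ContDiff ℝ ∞ fun z : ℝ × SpaceTime => (m z.1).lam z.2

/-- The generator of a variation: `w = δX ∘ X⁻¹`, `η̂ = (δR R⁻¹) ∘ X⁻¹`, `Ξ = (λ⁻¹ δλ) ∘ X⁻¹`. -/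
def MotionFamily.generator (γ : MotionFamily) : Generator where
  w := (γ.m 0).toEuler fun q => deriv (fun ε => (γ.m ε).X q) 0
  eta := (γ.m 0).toEuler fun q => deriv (fun ε => (γ.m ε).R q) 0 * ((γ.m 0).R q)⁻¹
  Xi := (γ.m 0).toEuler fun q => ((γ.m 0).lam q)⁻¹ * deriv (fun ε => (γ.m ε).lam q) 0

end

end QTensorFlow

open QTensorFlow

/-!
The Eulerian fields of a motion are material fields transported by the flow, and the proof rests on
two transport rules (`Motion.matD_toEuler`, `MotionFamily.hasDerivAt_toEuler`): the convective
derivative of a transported field is the transport of its time derivative, and the variation at a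
fixed point of space-time is the transport of the material variation minus the advection by `w`.
Applied to `∂ₜX`, `∂ₜR R⁻¹`, `λ⁻¹ ∂ₜλ` and `λ² R Q₀ Rᵀ`, together with the symmetry of second
derivatives, they give the Euler-Poincaré variations of `u`, `ν̂`, `Λ` and `Q`. For the density one
differentiates the Jacobian determinant of the back-to-labels map, which is itself advected
(`MotionFamily.hasDerivAt_rho`). The evolution equations of `ρ` and `Q` are the same formulas for
the family of time translates of the motion (`Motion.translates`), whose generator is `(u, ν̂, Λ)`.

For the action principle, the derivative of the Lagrangian density in the direction of a variation
is written as the pairing of `(w, η̂, Ξ)` with the residuals of the equations of motion, plus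
`ρ Dₜ f`, plus a spatial divergence (`dlagr_variation`). It splits into three parts: `δρ` yields the
pressure; the kinetic energy per unit mass yields the inertial terms, because its variation plus its
advection by `w` is a material variation, on which the Jacobi identity removes the rotation by `η̂`
(`dkin_material`); and the free energy yields `Tr (h δQ)`, where the part `Tr (h (w · ∇) Q)` combines
with the gradient of `F` into the divergence of the Ericksen stress (`fderiv_freeEnergy_jet`). By the
continuity equation `ρ Dₜ f` is a space-time divergence, so both extra terms integrate to zero over
the slab (`integral_dlagr`). Since `U` is smooth on `(0, ∞)` only, differentiation under the integral
uses that the perturbed density stays positive on the compact support of the variation for small `ε`.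
The fundamental lemma of the calculus of variations then isolates the residuals; the residual paired
with `η̂` is skew, so it is determined by its pairing with skew matrices.

The equivalent forms of the equations for the order parameter follow from
`Dₜ [[ν̂, Q], Q] = [Dₜ² Q, Q]` and from differentiating `Tr (Q Dₜ Q) = 2 Λ ‖Q‖²` along the flow.
-/

namespace QTensorFlow

open MeasureTheory

/-! ### First-order operators as directional derivatives -/

section Calculus

variable {V : Type*} [NormedAddCommGroup V] [NormedSpace ℝ V]
variable {P : Type*} [NormedAddCommGroup P] [NormedSpace ℝ P]

theorem sum_smul_single (w : E3) : ∑ i, w i • EuclideanSpace.single i (1 : ℝ) = w := by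
  ext j
  simp [Finset.sum_apply, Pi.single_apply]

theorem adv_eq_fderiv (w : SpaceTime → E3) (f : SpaceTime → V) (p : SpaceTime) :
    adv w f p = fderiv ℝ f p (0, w p) := by
  have h : ((0 : ℝ), w p) =
      ∑ i, w p i • ((0 : ℝ), (EuclideanSpace.single i (1 : ℝ) : E3)) := by
    refine Prod.ext ?_ ?_
    · simp [Prod.fst_sum]
    · simpa [Prod.snd_sum] using (sum_smul_single (w p)).symm
  rw [h, map_sum]
  simp only [map_smul, adv, dx]

theorem matD_eq_fderiv (u : SpaceTime → E3) (f : SpaceTime → V) (p : SpaceTime) :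
    matD u f p = fderiv ℝ f p (1, u p) := by
  rw [matD, dt, adv_eq_fderiv, ← map_add]
  simp

theorem contDiff_fderiv_dir {f : P → V} (hf : ContDiff ℝ ∞ f) {e : P → P}
    (he : ContDiff ℝ ∞ e) : ContDiff ℝ ∞ fun p => fderiv ℝ f p (e p) :=
  (hf.fderiv_right (m := ∞) (by simp)).clm_apply he

theorem contDiff_dt {f : SpaceTime → V} (hf : ContDiff ℝ ∞ f) : ContDiff ℝ ∞ (dt f) :=
  contDiff_fderiv_dir hf contDiff_const

theorem contDiff_dx {f : SpaceTime → V} (hf : ContDiff ℝ ∞ f) (i : Fin 3) :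
    ContDiff ℝ ∞ (dx i f) :=
  contDiff_fderiv_dir hf contDiff_const

theorem contDiff_adv {f : SpaceTime → V} (hf : ContDiff ℝ ∞ f) {w : SpaceTime → E3}
    (hw : ContDiff ℝ ∞ w) : ContDiff ℝ ∞ (adv w f) := by
  have h : QTensorFlow.adv w f = fun p => fderiv ℝ f p (0, w p) :=
    funext fun p => adv_eq_fderiv w f p
  rw [h]
  exact contDiff_fderiv_dir hf (contDiff_const.prodMk hw)

theorem contDiff_matD {f : SpaceTime → V} (hf : ContDiff ℝ ∞ f) {u : SpaceTime → E3}
    (hu : ContDiff ℝ ∞ u) : ContDiff ℝ ∞ (matD u f) :=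
  (contDiff_dt hf).add (contDiff_adv hf hu)

theorem contDiff_space_apply {w : P → E3} (hw : ContDiff ℝ ∞ w) (i : Fin 3) :
    ContDiff ℝ ∞ fun p => w p i := by
  fun_prop

theorem contDiff_divg {w : SpaceTime → E3} (hw : ContDiff ℝ ∞ w) : ContDiff ℝ ∞ (divg w) :=
  ContDiff.sum fun i _ => contDiff_dx (contDiff_space_apply hw i) i

theorem differentiable_of_smooth {f : P → V} (hf : ContDiff ℝ ∞ f) : Differentiable ℝ f :=
  hf.differentiable (by simp)

theorem fderiv_space_apply {w : P → E3} {p : P} (hw : DifferentiableAt ℝ w p) (i : Fin 3) (e : P) :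
    fderiv ℝ (fun q => w q i) p e = fderiv ℝ w p e i := by
  have := ((EuclideanSpace.proj i : E3 →L[ℝ] ℝ).hasFDerivAt (x := w p)).comp p
    hw.hasFDerivAt
  exact congrArg (fun L => L e) this.fderiv

/-- Directional derivatives are derivatives along lines. -/
theorem hasDerivAt_line {f : P → V} {p : P} (hf : DifferentiableAt ℝ f p) (e : P) :
    HasDerivAt (fun s : ℝ => f (p + s • e)) (fderiv ℝ f p e) 0 := by
  have h1 : HasDerivAt (fun s : ℝ => p + s • e) e 0 := by
    simpa using ((hasDerivAt_id (0 : ℝ)).smul_const e).const_add p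
  have h2 : HasFDerivAt f (fderiv ℝ f p) (p + (0 : ℝ) • e) := by simpa using hf.hasFDerivAt
  exact h2.comp_hasDerivAt (0 : ℝ) h1

/-- A directional derivative may be computed along the line. -/
theorem fderiv_eq_of_line {f : P → V} {p : P} (hf : DifferentiableAt ℝ f p) {e : P} {v : V}
    (h : HasDerivAt (fun s : ℝ => f (p + s • e)) v 0) : fderiv ℝ f p e = v :=
  (hasDerivAt_line hf e).unique h

theorem fderiv_add_dir {f g : P → V} {p : P} (hf : DifferentiableAt ℝ f p)
    (hg : DifferentiableAt ℝ g p) (e : P) :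
    fderiv ℝ (fun q => f q + g q) p e = fderiv ℝ f p e + fderiv ℝ g p e := by
  rw [show (fun q => f q + g q) = f + g from rfl, fderiv_add hf hg]; rfl

theorem fderiv_mul_dir {A : Type*} [NormedRing A] [NormedAlgebra ℝ A] {f g : P → A} {p : P}
    (hf : DifferentiableAt ℝ f p) (hg : DifferentiableAt ℝ g p) (e : P) :
    fderiv ℝ (fun q => f q * g q) p e = fderiv ℝ f p e * g p + f p * fderiv ℝ g p e := by
  refine fderiv_eq_of_line (hf.mul hg) ?_
  have h := (hasDerivAt_line hf e).mul (hasDerivAt_line hg e)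
  simp only [zero_smul, add_zero] at h
  exact h

/-- The product rule for real functions, with the multiplication of `ℝ` in place of that of a general
normed algebra, so that it can be used for rewriting. -/
theorem fderiv_realMul_dir {f g : P → ℝ} {p : P} (hf : DifferentiableAt ℝ f p)
    (hg : DifferentiableAt ℝ g p) (e : P) :
    fderiv ℝ (fun q => f q * g q) p e = fderiv ℝ f p e * g p + f p * fderiv ℝ g p e :=
  fderiv_mul_dir hf hg e

theorem fderiv_smul_dir {c : P → ℝ} {f : P → V} {p : P} (hc : DifferentiableAt ℝ c p)
    (hf : DifferentiableAt ℝ f p) (e : P) :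
    fderiv ℝ (fun q => c q • f q) p e = fderiv ℝ c p e • f p + c p • fderiv ℝ f p e := by
  refine fderiv_eq_of_line (hc.smul hf) ?_
  have h := (hasDerivAt_line hc e).smul (hasDerivAt_line hf e)
  simp only [zero_smul, add_zero] at h
  rw [add_comm]
  exact h

theorem fderiv_clm_dir {W : Type*} [NormedAddCommGroup W] [NormedSpace ℝ W] (L : V →L[ℝ] W)
    {f : P → V} {p : P} (hf : DifferentiableAt ℝ f p) (e : P) :
    fderiv ℝ (fun q => L (f q)) p e = L (fderiv ℝ f p e) := by
  have := (L.hasFDerivAt (x := f p)).comp p hf.hasFDerivAt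
  exact congrArg (fun L => L e) this.fderiv

/-- Second derivatives commute. -/
theorem fderiv_comm_dir {f : P → V} (hf : ContDiff ℝ ∞ f) (p a b : P) :
    fderiv ℝ (fun q => fderiv ℝ f q a) p b = fderiv ℝ (fun q => fderiv ℝ f q b) p a := by
  have h1 : DifferentiableAt ℝ (fderiv ℝ f) p :=
    ((hf.fderiv_right (m := ∞) (by simp)).differentiable (by simp)) p
  have hs : IsSymmSndFDerivAt ℝ f p := hf.contDiffAt.isSymmSndFDerivAt (by
    rw [minSmoothness_of_isRCLikeNormedField]; exact WithTop.coe_le_coe.2 le_top)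
  have ha := fderiv_clm_dir (ContinuousLinearMap.apply ℝ V a) h1 b
  have hb := fderiv_clm_dir (ContinuousLinearMap.apply ℝ V b) h1 a
  simp only [ContinuousLinearMap.apply_apply] at ha hb
  rw [ha, hb]
  exact hs.eq b a

end Calculus

/-! ### Traces of commutators -/

section Algebra

variable (A B C : Mat3)

/-- Invariance of the trace form under commutators. -/
theorem trace_lie_mul : (⁅A, B⁆ * C).trace = (A * ⁅B, C⁆).trace := by
  simp only [Ring.lie_def, sub_mul, mul_sub, Matrix.trace_sub]
  rw [mul_assoc A B C, ← mul_assoc A C B, Matrix.trace_mul_cycle B A C]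
  rw [Matrix.trace_mul_cycle C B A, Matrix.trace_mul_cycle A C B]

theorem frobenius_sq : ‖A‖ ^ 2 = (Aᵀ * A).trace := by
  rw [Matrix.frobenius_norm_def, ← Real.sqrt_eq_rpow, Real.sq_sqrt (by positivity)]
  simp only [Matrix.trace, Matrix.diag, Matrix.mul_apply, Matrix.transpose_apply, Real.norm_eq_abs,
    Real.rpow_two, sq_abs]
  rw [Finset.sum_comm]
  simp only [sq]

theorem frobenius_sq_of_symm {A : Mat3} (h : Aᵀ = A) : ‖A‖ ^ 2 = (A * A).trace := by
  rw [frobenius_sq, h]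

variable {A B}

theorem transpose_lie_of_skew_symm (hA : Aᵀ = -A) (hB : Bᵀ = B) : ⁅A, B⁆ᵀ = ⁅A, B⁆ := by
  simp only [Ring.lie_def, Matrix.transpose_sub, Matrix.transpose_mul, hA, hB, mul_neg, neg_mul]
  abel

theorem transpose_lie_of_symm_symm (hA : Aᵀ = A) (hB : Bᵀ = B) : ⁅A, B⁆ᵀ = -⁅A, B⁆ := by
  simp only [Ring.lie_def, Matrix.transpose_sub, Matrix.transpose_mul, hA, hB, neg_sub]

variable (A B)

theorem trace_mul_lie_self : (A * ⁅B, A⁆).trace = 0 := by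
  rw [Ring.lie_def, mul_sub, Matrix.trace_sub, ← mul_assoc, ← mul_assoc,
    Matrix.trace_mul_cycle A B A, Matrix.trace_mul_comm (A * A) B, ← mul_assoc, sub_self]

theorem trace_transpose_mul_sum : (Aᵀ * B).trace = ∑ i, ∑ j, A i j * B i j := by
  simp only [Matrix.trace, Matrix.diag, Matrix.mul_apply, Matrix.transpose_apply]
  rw [Finset.sum_comm]

/-- The trace, as a continuous linear map. -/
noncomputable def traceL : Mat3 →L[ℝ] ℝ :=
  LinearMap.toContinuousLinearMap (Matrix.traceLinearMap (Fin 3) ℝ ℝ)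

/-- The transpose, as a continuous linear map. -/
noncomputable def transposeL : Mat3 →L[ℝ] Mat3 :=
  LinearMap.toContinuousLinearMap (Matrix.transposeLinearEquiv (Fin 3) (Fin 3) ℝ ℝ).toLinearMap

/-- A matrix entry, as a continuous linear map. -/
noncomputable def entryL (i j : Fin 3) : Mat3 →L[ℝ] ℝ :=
  LinearMap.toContinuousLinearMap (Matrix.entryLinearMap ℝ ℝ i j)

end Algebra

section MatrixFields

variable {P : Type*} [NormedAddCommGroup P] [NormedSpace ℝ P] {f g : P → Mat3} {p : P}

theorem contDiff_trace (hf : ContDiff ℝ ∞ f) : ContDiff ℝ ∞ fun q => (f q).trace :=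
  traceL.contDiff.comp hf

theorem contDiff_transpose (hf : ContDiff ℝ ∞ f) : ContDiff ℝ ∞ fun q => (f q)ᵀ :=
  transposeL.contDiff.comp hf

theorem contDiff_entry (hf : ContDiff ℝ ∞ f) (i j : Fin 3) : ContDiff ℝ ∞ fun q => f q i j :=
  (entryL i j).contDiff.comp hf

theorem contDiff_lie (hf : ContDiff ℝ ∞ f) (hg : ContDiff ℝ ∞ g) :
    ContDiff ℝ ∞ fun q => ⁅f q, g q⁆ := by
  simp only [Ring.lie_def]
  exact (hf.mul hg).sub (hg.mul hf)

theorem matrix_eq_sum_single (A : Mat3) :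
    A = ∑ i, ∑ j, A i j • (Matrix.single i j (1 : ℝ) : Mat3) := by
  conv_lhs => rw [Matrix.matrix_eq_sum_single A]
  simp [Matrix.smul_single]

theorem contDiff_of_entries (h : ∀ i j, ContDiff ℝ ∞ fun q => f q i j) : ContDiff ℝ ∞ f := by
  have : f = fun q => ∑ i, ∑ j, f q i j • (Matrix.single i j (1 : ℝ) : Mat3) :=
    funext fun q => matrix_eq_sum_single (f q)
  rw [this]
  exact ContDiff.sum fun i _ => ContDiff.sum fun j _ => (h i j).smul contDiff_const

theorem contDiff_frobenius_sq (hf : ContDiff ℝ ∞ f) : ContDiff ℝ ∞ fun q => ‖f q‖ ^ 2 := by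
  simp only [QTensorFlow.frobenius_sq]
  exact contDiff_trace ((contDiff_transpose hf).mul hf)

/-- `adv_eq_fderiv` with the module structure on matrices that is found directly, for rewriting. -/
theorem adv_eq_fderiv_mat (w : SpaceTime → E3) (f : SpaceTime → Mat3) (p : SpaceTime) :
    adv w f p = fderiv ℝ f p (0, w p) :=
  adv_eq_fderiv w f p

/-- `matD_eq_fderiv` with the module structure on matrices that is found directly, for rewriting. -/
theorem matD_eq_fderiv_mat (u : SpaceTime → E3) (f : SpaceTime → Mat3) (p : SpaceTime) :
    matD u f p = fderiv ℝ f p (1, u p) :=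
  matD_eq_fderiv u f p

/-- The product rule for matrix fields, with the matrix product in place of that of a general normed
algebra, so that it can be used for rewriting. -/
theorem fderiv_matMul_dir (hf : DifferentiableAt ℝ f p) (hg : DifferentiableAt ℝ g p) (e : P) :
    fderiv ℝ (fun q => f q * g q) p e = fderiv ℝ f p e * g p + f p * fderiv ℝ g p e :=
  fderiv_mul_dir hf hg e

theorem hasDerivAt_lie {a b : ℝ → Mat3} {a' b' : Mat3} {s : ℝ} (ha : HasDerivAt a a' s)
    (hb : HasDerivAt b b' s) :
    HasDerivAt (fun s => ⁅a s, b s⁆) (⁅a', b s⁆ + ⁅a s, b'⁆) s := by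
  have h : HasDerivAt (fun s => a s * b s - b s * a s)
      (a' * b s + a s * b' - (b' * a s + b s * a')) s := (ha.mul hb).sub (hb.mul ha)
  have e : ⁅a', b s⁆ + ⁅a s, b'⁆ = a' * b s + a s * b' - (b' * a s + b s * a') := by
    simp only [Ring.lie_def]
    abel
  rw [e]
  exact h

theorem fderiv_lie_dir (hf : DifferentiableAt ℝ f p) (hg : DifferentiableAt ℝ g p) (e : P) :
    fderiv ℝ (fun q => ⁅f q, g q⁆) p e = ⁅fderiv ℝ f p e, g p⁆ + ⁅f p, fderiv ℝ g p e⁆ := by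
  refine fderiv_eq_of_line ((hf.mul hg).sub (hg.mul hf)) ?_
  have h := hasDerivAt_lie (hasDerivAt_line hf e) (hasDerivAt_line hg e)
  simp only [zero_smul, add_zero] at h
  exact h

theorem fderiv_trace_dir (hf : DifferentiableAt ℝ f p) (e : P) :
    fderiv ℝ (fun q => (f q).trace) p e = (fderiv ℝ f p e).trace :=
  fderiv_clm_dir traceL hf e

theorem fderiv_transpose_dir (hf : DifferentiableAt ℝ f p) (e : P) :
    fderiv ℝ (fun q => (f q)ᵀ) p e = (fderiv ℝ f p e)ᵀ :=
  fderiv_clm_dir transposeL hf e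

theorem fderiv_entry_dir (hf : DifferentiableAt ℝ f p) (i j : Fin 3) (e : P) :
    fderiv ℝ (fun q => f q i j) p e = fderiv ℝ f p e i j :=
  fderiv_clm_dir (entryL i j) hf e

/-- Derivatives of a field of symmetric matrices are symmetric. -/
theorem fderiv_symm_dir (hs : ∀ q, (f q)ᵀ = f q) (hf : DifferentiableAt ℝ f p) (e : P) :
    (fderiv ℝ f p e)ᵀ = fderiv ℝ f p e := by
  rw [← fderiv_transpose_dir hf, funext hs]

theorem fderiv_skew_dir (hs : ∀ q, (f q)ᵀ = -f q) (hf : DifferentiableAt ℝ f p) (e : P) :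
    (fderiv ℝ f p e)ᵀ = -fderiv ℝ f p e := by
  rw [← fderiv_transpose_dir hf, funext hs]
  exact congrArg (fun L => L e) hf.hasFDerivAt.neg.fderiv

end MatrixFields

/-! ### Transport along motions -/

section Slices

variable {V : Type*} [NormedAddCommGroup V] [NormedSpace ℝ V]
variable {P : Type*} [NormedAddCommGroup P] [NormedSpace ℝ P] {G : ℝ × P → V}

theorem hasDerivAt_slice_of_differentiableAt {s : ℝ} {p : P} (hG : DifferentiableAt ℝ G (s, p)) :
    HasDerivAt (fun ε => G (ε, p)) (fderiv ℝ G (s, p) (1, 0)) s :=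
  hG.hasFDerivAt.comp_hasDerivAt s ((hasDerivAt_id s).prodMk (hasDerivAt_const s p))

theorem hasDerivAt_slice (hG : Differentiable ℝ G) (s : ℝ) (p : P) :
    HasDerivAt (fun ε => G (ε, p)) (fderiv ℝ G (s, p) (1, 0)) s :=
  hasDerivAt_slice_of_differentiableAt (hG (s, p))

theorem deriv_slice (hG : Differentiable ℝ G) (s : ℝ) (p : P) :
    deriv (fun ε => G (ε, p)) s = fderiv ℝ G (s, p) (1, 0) :=
  (hasDerivAt_slice hG s p).deriv

theorem fderiv_slice (hG : Differentiable ℝ G) (s : ℝ) (p e : P) :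
    fderiv ℝ (fun q => G (s, q)) p e = fderiv ℝ G (s, p) (0, e) := by
  have h := (hG (s, p)).hasFDerivAt.comp p ((hasFDerivAt_const s p).prodMk (hasFDerivAt_id p))
  exact congrArg (fun L => L e) h.fderiv

theorem contDiff_slice (hG : ContDiff ℝ ∞ G) (s : ℝ) : ContDiff ℝ ∞ fun q => G (s, q) :=
  hG.comp (contDiff_const.prodMk contDiff_id)

theorem contDiff_deriv_slice (hG : ContDiff ℝ ∞ G) (s : ℝ) :
    ContDiff ℝ ∞ fun q => deriv (fun ε => G (ε, q)) s := by
  simp only [deriv_slice (differentiable_of_smooth hG)]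
  exact contDiff_slice (contDiff_fderiv_dir hG contDiff_const) s

theorem contDiff_fderiv_slice (hG : ContDiff ℝ ∞ G) (e : P) :
    ContDiff ℝ ∞ fun z : ℝ × P => fderiv ℝ (fun q => G (z.1, q)) z.2 e := by
  simp only [fderiv_slice (differentiable_of_smooth hG)]
  exact contDiff_fderiv_dir hG contDiff_const

/-- The parameter derivative commutes with a directional derivative in the other variables. -/
theorem deriv_fderiv_slice (hG : ContDiff ℝ ∞ G) (s : ℝ) (p e : P) :
    deriv (fun ε => fderiv ℝ (fun q => G (ε, q)) p e) s =
      fderiv ℝ (fun q => deriv (fun ε => G (ε, q)) s) p e := by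
  have hd := differentiable_of_smooth hG
  simp only [fderiv_slice hd, deriv_slice hd]
  have h1 := contDiff_fderiv_dir hG (e := fun _ => ((0 : ℝ), e)) contDiff_const
  have h2 := contDiff_fderiv_dir hG (e := fun _ => ((1 : ℝ), (0 : P))) contDiff_const
  rw [deriv_slice (differentiable_of_smooth h1), fderiv_slice (differentiable_of_smooth h2),
    fderiv_comm_dir hG]

end Slices

variable {V : Type*} [NormedAddCommGroup V] [NormedSpace ℝ V]

theorem Motion.contDiff_toEuler (m : Motion) {f : SpaceTime → V} (hf : ContDiff ℝ ∞ f) :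
    ContDiff ℝ ∞ (m.toEuler f) :=
  hf.comp (contDiff_fst.prodMk m.Y_smooth)

/-- The convective derivative of an Eulerian field is the time derivative of the material field. -/
theorem Motion.matD_toEuler (m : Motion) {f : SpaceTime → V} (hf : ContDiff ℝ ∞ f)
    (p : SpaceTime) : matD (m.toEuler (dt m.X)) (m.toEuler f) p = m.toEuler (dt f) p := by
  have hl (s : ℝ) : ((p.1, m.Y p) : SpaceTime) + s • ((1, 0) : SpaceTime) = (p.1 + s, m.Y p) := by
    simp
  have hX := hasDerivAt_line (differentiable_of_smooth m.X_smooth (p.1, m.Y p)) (1, 0)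
  have hF := hasDerivAt_line (differentiable_of_smooth hf (p.1, m.Y p)) (1, 0)
  simp only [hl] at hX hF
  -- along the particle path through `p`, the Eulerian field is the material field at a fixed label
  have hc := ((hasDerivAt_id (0 : ℝ)).const_add p.1).prodMk hX
  have hp : (p.1 + id (0 : ℝ), m.X (p.1 + (0 : ℝ), m.Y p)) = p := by simp [m.X_Y p.1 p.2]
  have hg := (differentiable_of_smooth (m.contDiff_toEuler hf) p).hasFDerivAt
  rw [← hp] at hg
  have hcomp := hg.comp_hasDerivAt (0 : ℝ) hc
  have he : (m.toEuler f ∘ fun s : ℝ => (p.1 + id s, m.X (p.1 + s, m.Y p))) =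
      fun s => f (p.1 + s, m.Y p) := by
    funext s
    simp [Motion.toEuler, m.Y_X]
  rw [he, hp] at hcomp
  rw [matD_eq_fderiv]
  exact hcomp.unique hF

namespace MotionFamily

variable (γ : MotionFamily)

/-- The first variation of the particle paths, `δX`. -/
noncomputable def deltaX (q : SpaceTime) : E3 := deriv (fun ε => (γ.m ε).X q) 0

theorem contDiff_deltaX : ContDiff ℝ ∞ γ.deltaX := contDiff_deriv_slice γ.X_smooth 0

theorem contDiff_w : ContDiff ℝ ∞ γ.generator.w := (γ.m 0).contDiff_toEuler γ.contDiff_deltaX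

/-- The variation of an Eulerian field at a fixed point of space-time is the variation of the
material field minus the advection by `w`. -/
theorem hasDerivAt_toEuler {f : ℝ × SpaceTime → V} (hf : ContDiff ℝ ∞ f) {f' : SpaceTime → V}
    (hf' : ∀ q, deriv (fun ε => f (ε, q)) 0 = f' q) (p : SpaceTime) :
    HasDerivAt (fun ε => (γ.m ε).toEuler (fun q => f (ε, q)) p)
      ((γ.m 0).toEuler f' p
        - adv γ.generator.w ((γ.m 0).toEuler fun q => f (0, q)) p) 0 := by
  -- the Eulerian field `G` of the family, followed along the moving position `X_ε(t, x₀)`, is the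
  -- material field at the fixed label `x₀`
  set G : ℝ × SpaceTime → V := fun z => f (z.1, (z.2.1, (γ.m z.1).Y z.2)) with hGdef
  have hG : ContDiff ℝ ∞ G :=
    hf.comp (contDiff_fst.prodMk ((contDiff_fst.comp contDiff_snd).prodMk γ.Y_smooth))
  have hGd := differentiable_of_smooth hG
  set x₀ := (γ.m 0).Y p with hx₀
  have hX := hasDerivAt_slice (differentiable_of_smooth γ.X_smooth) 0 (p.1, x₀)
  have hc := (hasDerivAt_id (0 : ℝ)).prodMk ((hasDerivAt_const (0 : ℝ) p.1).prodMk hX)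
  have hp : (id (0 : ℝ), (p.1, (γ.m 0).X (p.1, x₀))) = (0, p) := by
    simp [hx₀, (γ.m 0).X_Y p.1 p.2]
  have hg := (hGd (0, p)).hasFDerivAt
  rw [← hp] at hg
  have hcomp := hg.comp_hasDerivAt (0 : ℝ) hc
  have he : (G ∘ fun ε : ℝ => (id ε, (p.1, (γ.m ε).X (p.1, x₀)))) =
      fun ε => f (ε, (p.1, x₀)) := by
    funext ε
    simp [hGdef, (γ.m ε).Y_X]
  rw [he, hp] at hcomp
  have hw : fderiv ℝ (fun z : ℝ × SpaceTime => (γ.m z.1).X z.2) (0, (p.1, x₀)) (1, 0)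
      = γ.generator.w p := by
    rw [← deriv_slice (differentiable_of_smooth γ.X_smooth)]
    rfl
  rw [hw] at hcomp
  have h1 : fderiv ℝ G (0, p) (1, (0, γ.generator.w p)) =
      fderiv ℝ G (0, p) (1, 0) + fderiv ℝ G (0, p) (0, (0, γ.generator.w p)) := by
    rw [← map_add]
    simp
  rw [h1] at hcomp
  have h2 := (hasDerivAt_slice (differentiable_of_smooth hf) 0 (p.1, x₀)).unique hcomp
  rw [← deriv_slice (differentiable_of_smooth hf), hf'] at h2
  have h3 := hasDerivAt_slice hGd 0 p
  suffices h4 : (γ.m 0).toEuler f' p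
      - adv γ.generator.w ((γ.m 0).toEuler fun q => f (0, q)) p = fderiv ℝ G (0, p) (1, 0) by
    rw [h4]
    exact h3
  rw [adv_eq_fderiv, sub_eq_iff_eq_add]
  refine h2.trans ?_
  rw [← fderiv_slice hGd]
  rfl

end MotionFamily

/-! ### Variations of the Eulerian fields -/

theorem Motion.R_mul_transpose (m : Motion) (q : SpaceTime) : m.R q * (m.R q)ᵀ = 1 :=
  (Matrix.mem_orthogonalGroup_iff (Fin 3) ℝ).1 (Matrix.mem_specialOrthogonalGroup_iff.1 (m.R_rot q)).1

theorem Motion.transpose_mul_R (m : Motion) (q : SpaceTime) : (m.R q)ᵀ * m.R q = 1 :=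
  (Matrix.mem_orthogonalGroup_iff' (Fin 3) ℝ).1 (Matrix.mem_specialOrthogonalGroup_iff.1 (m.R_rot q)).1

theorem Motion.R_inv (m : Motion) (q : SpaceTime) : (m.R q)⁻¹ = (m.R q)ᵀ :=
  Matrix.inv_eq_right_inv (m.R_mul_transpose q)

/-- Differentiating `R Rᵀ = 1`. -/
theorem orthogonal_deriv {R : ℝ → Mat3} {R' : Mat3} {s : ℝ} (hR : HasDerivAt R R' s)
    (h : ∀ s, R s * (R s)ᵀ = 1) : R' * (R s)ᵀ + R s * R'ᵀ = 0 := by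
  have h1 : HasDerivAt (fun s => (R s)ᵀ) R'ᵀ s := transposeL.hasFDerivAt.comp_hasDerivAt s hR
  have h2 : HasDerivAt (fun s => R s * (R s)ᵀ) (R' * (R s)ᵀ + R s * R'ᵀ) s := hR.mul h1
  simp only [h] at h2
  exact h2.unique (hasDerivAt_const s 1)

/-- The variation of the angular velocity `R' Rᵀ` in terms of the angular variation `E Rᵀ`. -/
theorem rotation_algebra {R R' E E' : Mat3} (hR : Rᵀ * R = 1) (hE : E * Rᵀ + R * Eᵀ = 0)
    (hR' : R' * Rᵀ + R * R'ᵀ = 0) :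
    E' * Rᵀ + R' * Eᵀ = E' * Rᵀ + E * R'ᵀ + ⁅E * Rᵀ, R' * Rᵀ⁆ := by
  have h5 : R' * Rᵀ = -(R * R'ᵀ) := eq_neg_of_add_eq_zero_left hR'
  have h6 : E * Rᵀ = -(R * Eᵀ) := eq_neg_of_add_eq_zero_left hE
  have h7 : E * Rᵀ * (R' * Rᵀ) = -(E * R'ᵀ) := by
    rw [h5, mul_neg, mul_assoc, ← mul_assoc Rᵀ, hR, one_mul]
  have h8 : R' * Rᵀ * (E * Rᵀ) = -(R' * Eᵀ) := by
    rw [h6, mul_neg, mul_assoc, ← mul_assoc Rᵀ, hR, one_mul]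
  rw [Ring.lie_def, h7, h8]
  abel

namespace MotionFamily

variable (γ : MotionFamily) (d : RefData) (p : SpaceTime)

theorem hasDerivAt_u :
    HasDerivAt (fun ε => ((γ.m ε).fields d).u p)
      ((γ.generator.variation ((γ.m 0).fields d)).u p) 0 := by
  have hf : ContDiff ℝ ∞ fun z : ℝ × SpaceTime => dt (γ.m z.1).X z.2 :=
    contDiff_fderiv_slice γ.X_smooth (1, 0)
  have hc (q : SpaceTime) : deriv (fun ε => dt (γ.m ε).X q) 0 = dt γ.deltaX q :=
    deriv_fderiv_slice γ.X_smooth 0 q (1, 0)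
  have h := γ.hasDerivAt_toEuler hf hc p
  have hm : (γ.m 0).toEuler (fun q => dt γ.deltaX q) p
      = matD ((γ.m 0).toEuler (dt (γ.m 0).X)) γ.generator.w p :=
    ((γ.m 0).matD_toEuler γ.contDiff_deltaX p).symm
  rw [hm] at h
  exact h

/-- The material angular variation `δR R⁻¹`. -/
noncomputable def matEta (q : SpaceTime) : Mat3 :=
  deriv (fun ε => (γ.m ε).R q) 0 * ((γ.m 0).R q)ᵀ

theorem generator_eta : γ.generator.eta = (γ.m 0).toEuler γ.matEta := by
  funext q
  simp only [generator, Motion.toEuler, matEta, Motion.R_inv]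

theorem contDiff_matEta : ContDiff ℝ ∞ γ.matEta :=
  (contDiff_deriv_slice γ.R_smooth 0).mul (contDiff_transpose (γ.m 0).R_smooth)

theorem hasDerivAt_R (q : SpaceTime) :
    HasDerivAt (fun ε => (γ.m ε).R q) (deriv (fun ε => (γ.m ε).R q) 0) 0 := by
  have := hasDerivAt_slice (differentiable_of_smooth γ.R_smooth) 0 q
  rwa [← deriv_slice (differentiable_of_smooth γ.R_smooth)] at this

theorem deltaR_eq (q : SpaceTime) :
    deriv (fun ε => (γ.m ε).R q) 0 = γ.matEta q * (γ.m 0).R q := by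
  rw [matEta, mul_assoc, Motion.transpose_mul_R, mul_one]

theorem matEta_skew (q : SpaceTime) : (γ.matEta q)ᵀ = -γ.matEta q := by
  have h := orthogonal_deriv (γ.hasDerivAt_R q) (fun ε => (γ.m ε).R_mul_transpose q)
  rw [matEta, Matrix.transpose_mul, Matrix.transpose_transpose]
  exact eq_neg_of_add_eq_zero_right h

theorem hasDerivAt_nu :
    HasDerivAt (fun ε => ((γ.m ε).fields d).nu p)
      ((γ.generator.variation ((γ.m 0).fields d)).nu p) 0 := by
  set f : ℝ × SpaceTime → Mat3 := fun z => dt (γ.m z.1).R z.2 * ((γ.m z.1).R z.2)ᵀ with hfdef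
  have hdt : ContDiff ℝ ∞ fun z : ℝ × SpaceTime => dt (γ.m z.1).R z.2 :=
    contDiff_fderiv_slice γ.R_smooth (1, 0)
  have hf : ContDiff ℝ ∞ f := hdt.mul (contDiff_transpose γ.R_smooth)
  have hν (ε : ℝ) : ((γ.m ε).fields d).nu = (γ.m ε).toEuler fun q => f (ε, q) := by
    funext q
    simp only [Motion.fields, Motion.toEuler, hfdef, Motion.R_inv]
  have hc (q : SpaceTime) : deriv (fun ε => f (ε, q)) 0
      = dt γ.matEta q + ⁅γ.matEta q, f (0, q)⁆ := by
    set R := (γ.m 0).R q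
    set R' := dt (γ.m 0).R q
    set E := deriv (fun ε => (γ.m ε).R q) 0
    have hE : HasDerivAt (fun ε => (γ.m ε).R q) E 0 := γ.hasDerivAt_R q
    have hET : HasDerivAt (fun ε => ((γ.m ε).R q)ᵀ) Eᵀ 0 :=
      transposeL.hasFDerivAt.comp_hasDerivAt 0 hE
    set E' := dt (fun q => deriv (fun ε => (γ.m ε).R q) 0) q
    have hR' : HasDerivAt (fun ε => dt (γ.m ε).R q) E' 0 := by
      have h1 := hasDerivAt_slice (differentiable_of_smooth hdt) 0 q
      rw [← deriv_slice (differentiable_of_smooth hdt)] at h1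
      rw [show E' = _ from (deriv_fderiv_slice γ.R_smooth 0 q (1, 0)).symm]
      exact h1
    have h1 : deriv (fun ε => f (ε, q)) 0 = E' * Rᵀ + R' * Eᵀ := (hR'.mul hET).deriv
    have h2 : dt γ.matEta q = E' * Rᵀ + E * R'ᵀ := by
      have hRs := differentiable_of_smooth (γ.m 0).R_smooth q
      have hRT := differentiable_of_smooth (contDiff_transpose (γ.m 0).R_smooth) q
      have hs := differentiable_of_smooth (contDiff_deriv_slice γ.R_smooth 0) q
      have := fderiv_matMul_dir hs hRT ((1, 0) : SpaceTime)
      rw [fderiv_transpose_dir hRs] at this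
      exact this
    have h3 : E * Rᵀ + R * Eᵀ = 0 :=
      orthogonal_deriv hE (fun ε => (γ.m ε).R_mul_transpose q)
    have h4 : R' * Rᵀ + R * R'ᵀ = 0 := by
      have hl := hasDerivAt_line (differentiable_of_smooth (γ.m 0).R_smooth q) (1, 0)
      have := orthogonal_deriv hl (fun s => (γ.m 0).R_mul_transpose _)
      simp only [zero_smul, add_zero] at this
      exact this
    rw [h1, h2]
    exact rotation_algebra ((γ.m 0).transpose_mul_R q) h3 h4
  have hm : (γ.m 0).toEuler (fun q => dt γ.matEta q + ⁅γ.matEta q, f (0, q)⁆) p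
      = matD ((γ.m 0).toEuler (dt (γ.m 0).X)) γ.generator.eta p
        + ⁅γ.generator.eta p, ((γ.m 0).fields d).nu p⁆ := by
    rw [generator_eta, hν, Motion.matD_toEuler _ γ.contDiff_matEta]
    rfl
  have h := γ.hasDerivAt_toEuler hf hc p
  rw [hm, ← hν, matD] at h
  simp only [← hν] at h
  have e : (γ.generator.variation ((γ.m 0).fields d)).nu p
      = dt γ.generator.eta p + adv ((γ.m 0).toEuler (dt (γ.m 0).X)) γ.generator.eta p
        + ⁅γ.generator.eta p, ((γ.m 0).fields d).nu p⁆
        - adv γ.generator.w ((γ.m 0).fields d).nu p := by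
    change dt γ.generator.eta p - adv γ.generator.w ((γ.m 0).fields d).nu p
      + adv ((γ.m 0).toEuler (dt (γ.m 0).X)) γ.generator.eta p
      + ⁅γ.generator.eta p, ((γ.m 0).fields d).nu p⁆ = _
    abel
  rw [e]
  exact h

/-- The material dilation rate `λ⁻¹ δλ`. -/
noncomputable def matXi (q : SpaceTime) : ℝ :=
  ((γ.m 0).lam q)⁻¹ * deriv (fun ε => (γ.m ε).lam q) 0

theorem contDiff_matXi : ContDiff ℝ ∞ γ.matXi :=
  ((γ.m 0).lam_smooth.inv fun q => ((γ.m 0).lam_pos q).ne').mul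
    (contDiff_deriv_slice γ.lam_smooth 0)

theorem hasDerivAt_lam (q : SpaceTime) :
    HasDerivAt (fun ε => (γ.m ε).lam q) (deriv (fun ε => (γ.m ε).lam q) 0) 0 := by
  have := hasDerivAt_slice (differentiable_of_smooth γ.lam_smooth) 0 q
  rwa [← deriv_slice (differentiable_of_smooth γ.lam_smooth)] at this

theorem hasDerivAt_Lam :
    HasDerivAt (fun ε => ((γ.m ε).fields d).Lam p)
      ((γ.generator.variation ((γ.m 0).fields d)).Lam p) 0 := by
  set f : ℝ × SpaceTime → ℝ := fun z => ((γ.m z.1).lam z.2)⁻¹ * dt (γ.m z.1).lam z.2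
  have hdt : ContDiff ℝ ∞ fun z : ℝ × SpaceTime => dt (γ.m z.1).lam z.2 :=
    contDiff_fderiv_slice γ.lam_smooth (1, 0)
  have hinv : ContDiff ℝ ∞ fun z : ℝ × SpaceTime => ((γ.m z.1).lam z.2)⁻¹ :=
    γ.lam_smooth.inv fun z => ((γ.m z.1).lam_pos z.2).ne'
  have hf : ContDiff ℝ ∞ f := hinv.mul hdt
  have hc (q : SpaceTime) : deriv (fun ε => f (ε, q)) 0 = dt γ.matXi q := by
    have hl : (γ.m 0).lam q ≠ 0 := ((γ.m 0).lam_pos q).ne'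
    set E' := dt (fun q => deriv (fun ε => (γ.m ε).lam q) 0) q
    have hR' : HasDerivAt (fun ε => dt (γ.m ε).lam q) E' 0 := by
      have h1 := hasDerivAt_slice (differentiable_of_smooth hdt) 0 q
      rw [← deriv_slice (differentiable_of_smooth hdt)] at h1
      rw [show E' = _ from (deriv_fderiv_slice γ.lam_smooth 0 q (1, 0)).symm]
      exact h1
    have h1 := (((γ.hasDerivAt_lam q).inv hl).mul hR').deriv
    have hls := differentiable_of_smooth (γ.m 0).lam_smooth q
    have hs := differentiable_of_smooth (contDiff_deriv_slice γ.lam_smooth 0) q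
    have hline := (hasDerivAt_line hls (1, 0)).inv (by simpa using hl)
    have h3 := fderiv_eq_of_line (hls.inv hl) hline
    have h2 : dt γ.matXi q = _ := fderiv_realMul_dir (hls.inv hl) hs ((1, 0) : SpaceTime)
    simp only [zero_smul, add_zero] at h3
    refine h1.trans (Eq.trans ?_ (h2.trans (congrArg (fun a => a * _ + _) h3)).symm)
    change -deriv (fun ε => (γ.m ε).lam q) 0 / (γ.m 0).lam q ^ 2 * dt (γ.m 0).lam q
        + ((γ.m 0).lam q)⁻¹ * E'
      = -dt (γ.m 0).lam q / (γ.m 0).lam q ^ 2 * deriv (fun ε => (γ.m ε).lam q) 0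
        + ((γ.m 0).lam q)⁻¹ * E'
    ring
  have h := γ.hasDerivAt_toEuler hf hc p
  have hm : (γ.m 0).toEuler (fun q => dt γ.matXi q) p
      = matD ((γ.m 0).toEuler (dt (γ.m 0).X)) γ.generator.Xi p :=
    ((γ.m 0).matD_toEuler γ.contDiff_matXi p).symm
  rw [hm, matD] at h
  have e : (γ.generator.variation ((γ.m 0).fields d)).Lam p
      = dt γ.generator.Xi p + adv ((γ.m 0).toEuler (dt (γ.m 0).X)) γ.generator.Xi p
        - adv γ.generator.w ((γ.m 0).fields d).Lam p := by
    change dt γ.generator.Xi p - adv γ.generator.w ((γ.m 0).fields d).Lam p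
      + adv ((γ.m 0).toEuler (dt (γ.m 0).X)) γ.generator.Xi p = _
    ring
  rw [e]
  exact h

theorem hasDerivAt_Q :
    HasDerivAt (fun ε => ((γ.m ε).fields d).Q p)
      ((γ.generator.variation ((γ.m 0).fields d)).Q p) 0 := by
  set f : ℝ × SpaceTime → Mat3 := fun z =>
    (γ.m z.1).lam z.2 ^ 2 • ((γ.m z.1).R z.2 * d.Q0 z.2.2 * ((γ.m z.1).R z.2)ᵀ)
  have hQ : ContDiff ℝ ∞ fun z : ℝ × SpaceTime => d.Q0 z.2.2 :=
    d.Q0_smooth.comp (contDiff_snd.comp contDiff_snd)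
  have hf : ContDiff ℝ ∞ f :=
    (γ.lam_smooth.pow 2).smul ((γ.R_smooth.mul hQ).mul (contDiff_transpose γ.R_smooth))
  have hc (q : SpaceTime) : deriv (fun ε => f (ε, q)) 0
      = ⁅γ.matEta q, f (0, q)⁆ + (2 * γ.matXi q) • f (0, q) := by
    have hE := γ.hasDerivAt_R q
    have hET : HasDerivAt (fun ε => ((γ.m ε).R q)ᵀ) (deriv (fun ε => (γ.m ε).R q) 0)ᵀ 0 :=
      transposeL.hasFDerivAt.comp_hasDerivAt 0 hE
    have h1 : HasDerivAt (fun ε => f (ε, q)) _ 0 :=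
      ((γ.hasDerivAt_lam q).pow 2).smul ((hE.mul (hasDerivAt_const 0 (d.Q0 q.2))).mul hET)
    refine h1.deriv.trans ?_
    have hl : (γ.m 0).lam q ≠ 0 := ((γ.m 0).lam_pos q).ne'
    have hx : deriv (fun ε => (γ.m ε).lam q) 0 = (γ.m 0).lam q * γ.matXi q := by
      rw [matXi]
      field_simp
    simp only [γ.deltaR_eq q, hx, Pi.mul_apply, Pi.pow_apply, f, Matrix.transpose_mul, γ.matEta_skew,
      mul_zero, add_zero, Ring.lie_def, mul_neg, Matrix.mul_smul, Matrix.smul_mul, smul_smul,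
      mul_assoc]
    rw [← sub_eq_add_neg, smul_sub]
    congr 2
    simp
    ring
  have h := γ.hasDerivAt_toEuler hf hc p
  rw [show ((γ.m 0).toEuler (fun q => ⁅γ.matEta q, f (0, q)⁆ + (2 * γ.matXi q) • f (0, q)) p)
    = ⁅γ.generator.eta p, ((γ.m 0).fields d).Q p⁆
      + (2 * γ.generator.Xi p) • ((γ.m 0).fields d).Q p by rw [generator_eta]; rfl] at h
  exact h

end MotionFamily
/-! ### The density -/

theorem fderiv_smulSum_dir {V : Type*} [NormedAddCommGroup V] [NormedSpace ℝ V]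
    {w : SpaceTime → E3} (hw : ContDiff ℝ ∞ w) {g : Fin 3 → SpaceTime → V}
    (hg : ∀ k, ContDiff ℝ ∞ (g k)) (p e : SpaceTime) :
    fderiv ℝ (fun q => ∑ k, w q k • g k q) p e
      = ∑ k, (fderiv ℝ w p e k • g k p + w p k • fderiv ℝ (g k) p e) := by
  have hd (k : Fin 3) := differentiable_of_smooth (contDiff_space_apply hw k)
  have hgd (k : Fin 3) := differentiable_of_smooth (hg k)
  have hs : fderiv ℝ (fun q => ∑ k, w q k • g k q) p
      = ∑ k, fderiv ℝ (fun q => w q k • g k q) p :=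
    fderiv_fun_sum fun k _ => ((hd k).smul (hgd k)) p
  rw [hs, _root_.sum_apply]
  refine Finset.sum_congr rfl fun k _ => ?_
  rw [fderiv_smul_dir (hd k p) (hgd k p), fderiv_space_apply (differentiable_of_smooth hw p)]

/-- The derivative of `(w · ∇) f` in the direction `e`. -/
theorem fderiv_adv_dir {V : Type*} [NormedAddCommGroup V] [NormedSpace ℝ V] {w : SpaceTime → E3}
    (hw : ContDiff ℝ ∞ w) {f : SpaceTime → V} (hf : ContDiff ℝ ∞ f) (p e : SpaceTime) :
    fderiv ℝ (adv w f) p e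
      = ∑ k, fderiv ℝ w p e k • dx k f p + adv w (fun q => fderiv ℝ f q e) p := by
  have h := fderiv_smulSum_dir hw (fun k => contDiff_dx hf k) p e
  rw [Finset.sum_add_distrib] at h
  refine h.trans ?_
  congr 1
  refine Finset.sum_congr rfl fun k _ => ?_
  congr 1
  exact fderiv_comm_dir hf p (0, EuclideanSpace.single k 1) e

theorem divg_eq_sum {w : SpaceTime → E3} (hw : ContDiff ℝ ∞ w) (p : SpaceTime) :
    divg w p = ∑ i, dx i w p i :=
  Finset.sum_congr rfl fun i _ => fderiv_space_apply (differentiable_of_smooth hw p) i _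

theorem divg_smul {c : SpaceTime → ℝ} (hc : ContDiff ℝ ∞ c) {w : SpaceTime → E3}
    (hw : ContDiff ℝ ∞ w) (p : SpaceTime) :
    divg (fun q => c q • w q) p = adv w c p + c p * divg w p := by
  rw [divg, adv, divg, Finset.mul_sum, ← Finset.sum_add_distrib]
  refine Finset.sum_congr rfl fun i _ => ?_
  have h := fderiv_realMul_dir (differentiable_of_smooth hc p)
    (differentiable_of_smooth (contDiff_space_apply hw i) p) (0, EuclideanSpace.single i 1)
  refine h.trans ?_
  simp only [dx, smul_eq_mul]
  ring

/-- Jacobi's formula along a curve of matrices. -/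
theorem hasDerivAt_det {A : ℝ → Mat3} {A' : Mat3} {s : ℝ} (hA : HasDerivAt A A' s) :
    HasDerivAt (fun s => (A s).det) ((A s).adjugate * A').trace s := by
  have h (i j : Fin 3) : HasDerivAt (fun s => A s i j) (A' i j) s :=
    (entryL i j).hasFDerivAt.comp_hasDerivAt s hA
  have hd := ((((((h 0 0).mul (h 1 1)).mul (h 2 2)).sub (((h 0 0).mul (h 1 2)).mul (h 2 1))).sub
    (((h 0 1).mul (h 1 0)).mul (h 2 2))).add (((h 0 1).mul (h 1 2)).mul (h 2 0))).add
    (((h 0 2).mul (h 1 0)).mul (h 2 1)) |>.sub (((h 0 2).mul (h 1 1)).mul (h 2 0))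
  have hf : (fun s => (A s).det) = _ := funext fun s => Matrix.det_fin_three (A s)
  rw [hf]
  refine hd.congr_deriv ?_
  simp only [Matrix.adjugate_fin_three, Matrix.trace_fin_three, Matrix.mul_apply,
    Fin.sum_univ_three, Matrix.of_apply, Matrix.cons_val', Matrix.cons_val_zero,
    Matrix.cons_val_one, Matrix.cons_val, Pi.mul_apply]
  ring

theorem contDiff_det {P : Type*} [NormedAddCommGroup P] [NormedSpace ℝ P] {A : P → Mat3}
    (hA : ContDiff ℝ ∞ A) : ContDiff ℝ ∞ fun q => (A q).det := by
  have h := contDiff_entry hA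
  simp only [Matrix.det_fin_three]
  exact (((((((h 0 0).mul (h 1 1)).mul (h 2 2)).sub (((h 0 0).mul (h 1 2)).mul (h 2 1))).sub
    (((h 0 1).mul (h 1 0)).mul (h 2 2))).add (((h 0 1).mul (h 1 2)).mul (h 2 0))).add
    (((h 0 2).mul (h 1 0)).mul (h 2 1))).sub (((h 0 2).mul (h 1 1)).mul (h 2 0))

theorem det_eq_det_matrix (L : E3 →L[ℝ] E3) :
    L.det = (Matrix.of fun i j => L (EuclideanSpace.single j 1) i : Mat3).det := by
  rw [ContinuousLinearMap.det,
    ← LinearMap.det_toMatrix (EuclideanSpace.basisFun (Fin 3) ℝ).toBasis]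
  rfl

/-- The Jacobian matrix `∂ⱼ Yᵢ` of the back-to-labels map. -/
noncomputable def Motion.jac (m : Motion) (p : SpaceTime) : Mat3 :=
  Matrix.of fun i j => dx j m.Y p i

theorem Motion.det_eq (m : Motion) (p : SpaceTime) :
    (fderiv ℝ (fun x => m.Y (p.1, x)) p.2).det = (m.jac p).det := by
  rw [det_eq_det_matrix]
  congr 1
  ext i j
  exact congrArg (fun v : E3 => v i)
    (fderiv_slice (differentiable_of_smooth m.Y_smooth) p.1 p.2 (EuclideanSpace.single j 1))

theorem Motion.det_ne_zero (m : Motion) (p : SpaceTime) : (m.jac p).det ≠ 0 := by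
  rw [← m.det_eq]
  have hX := differentiable_of_smooth (contDiff_slice m.X_smooth p.1)
  have hY := differentiable_of_smooth (contDiff_slice m.Y_smooth p.1)
  have h := (hX (m.Y (p.1, p.2))).hasFDerivAt.comp p.2 (hY p.2).hasFDerivAt
  have hid : ((fun q => m.X (p.1, q)) ∘ fun q => m.Y (p.1, q)) = id :=
    funext fun x => m.X_Y p.1 x
  rw [hid] at h
  have h1 := h.unique (hasFDerivAt_id p.2)
  intro h0
  have h2 := congrArg ContinuousLinearMap.det h1
  have h3 (A B : E3 →L[ℝ] E3) : (A.comp B).det = A.det * B.det := LinearMap.det_comp _ _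
  rw [h3, h0, mul_zero] at h2
  exact zero_ne_one (h2.trans LinearMap.det_id)

theorem Motion.contDiff_jac (m : Motion) : ContDiff ℝ ∞ m.jac :=
  contDiff_of_entries fun i j => contDiff_space_apply (contDiff_dx m.Y_smooth j) i

theorem Motion.rho_eq (m : Motion) (d : RefData) :
    (m.fields d).rho = fun p => d.rho0 (m.Y p) * |(m.jac p).det| :=
  funext fun p => by rw [← m.det_eq]; rfl

theorem Motion.rho_pos (m : Motion) (d : RefData) (p : SpaceTime) : 0 < (m.fields d).rho p := by
  rw [m.rho_eq]
  exact mul_pos (d.rho0_pos _) (abs_pos.2 (m.det_ne_zero p))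

theorem Motion.contDiff_rho (m : Motion) (d : RefData) : ContDiff ℝ ∞ (m.fields d).rho := by
  rw [m.rho_eq]
  exact (d.rho0_smooth.comp m.Y_smooth).mul ((contDiff_det m.contDiff_jac).abs m.det_ne_zero)

namespace MotionFamily

variable (γ : MotionFamily) (d : RefData) (p : SpaceTime)

/-- Labels are carried along: `δY + (w · ∇) Y = 0`. -/
theorem deltaY_eq (p : SpaceTime) :
    deriv (fun ε => (γ.m ε).Y p) 0 = -adv γ.generator.w (γ.m 0).Y p := by
  have h := γ.hasDerivAt_toEuler (f := fun z => z.2.2) (contDiff_snd.comp contDiff_snd)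
    (f' := fun _ => 0) (fun q => by simp) p
  have h0 : (γ.m 0).toEuler (fun _ => (0 : E3)) p = 0 := rfl
  rw [h0, zero_sub] at h
  exact h.deriv

/-- The gradient of `δY = -(w · ∇) Y`: `δ(∇Y) = -∇Y ∇w - (w · ∇) ∇Y`. -/
theorem hasDerivAt_jac :
    HasDerivAt (fun ε => (γ.m ε).jac p)
      (-((γ.m 0).jac p * (Matrix.of fun k j => dx j γ.generator.w p k : Mat3))
        - adv γ.generator.w (γ.m 0).jac p) 0 := by
  have hent (i j : Fin 3) : HasDerivAt (fun ε => (γ.m ε).jac p i j)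
      ((-((γ.m 0).jac p * (Matrix.of fun k j => dx j γ.generator.w p k : Mat3))
        - adv γ.generator.w (γ.m 0).jac p) i j) 0 := by
    set e : SpaceTime := (0, EuclideanSpace.single j 1)
    have hs := contDiff_fderiv_slice γ.Y_smooth e
    have h1 := hasDerivAt_slice (differentiable_of_smooth hs) 0 p
    rw [← deriv_slice (differentiable_of_smooth hs), deriv_fderiv_slice γ.Y_smooth] at h1
    simp only [γ.deltaY_eq] at h1
    have hn : fderiv ℝ (fun q => -adv γ.generator.w (γ.m 0).Y q) p e
        = -fderiv ℝ (adv γ.generator.w (γ.m 0).Y) p e := by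
      rw [fderiv_fun_neg]; rfl
    rw [hn, fderiv_adv_dir γ.contDiff_w (γ.m 0).Y_smooth] at h1
    have h2 := ((EuclideanSpace.proj i : E3 →L[ℝ] ℝ).hasFDerivAt).comp_hasDerivAt 0 h1
    refine h2.congr_deriv ?_
    have hadv : adv γ.generator.w (γ.m 0).jac p i j
        = adv γ.generator.w (fun q => fderiv ℝ (γ.m 0).Y q e) p i := by
      have hj := (γ.m 0).contDiff_jac
      have hy := contDiff_fderiv_dir (γ.m 0).Y_smooth (e := fun _ => e) contDiff_const
      rw [adv_eq_fderiv, adv_eq_fderiv, ← fderiv_space_apply (differentiable_of_smooth hy p)]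
      exact (fderiv_entry_dir (differentiable_of_smooth hj p) i j _).symm
    rw [Matrix.sub_apply, hadv, Matrix.neg_apply, Matrix.mul_apply]
    simp [Motion.jac, Fin.sum_univ_three, dx, e]
    ring
  have hm : (fun ε => (γ.m ε).jac p) = fun ε => ∑ i, ∑ j,
      (γ.m ε).jac p i j • (Matrix.single i j (1 : ℝ) : Mat3) :=
    funext fun ε => matrix_eq_sum_single _
  rw [hm, matrix_eq_sum_single (-((γ.m 0).jac p * _) - _)]
  exact HasDerivAt.fun_sum fun i _ => HasDerivAt.fun_sum fun j _ => (hent i j).smul_const _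

/-- `δρ = -div (ρ w)`: the labels are advected by `w`, and the Jacobian `det ∇Y` picks up the factor
`-div w` besides its advection, by Jacobi's formula. -/
theorem hasDerivAt_rho :
    HasDerivAt (fun ε => ((γ.m ε).fields d).rho p)
      ((γ.generator.variation ((γ.m 0).fields d)).rho p) 0 := by
  set w := γ.generator.w
  set m := γ.m 0 with hm
  have hDne := m.det_ne_zero p
  have hjd := differentiable_of_smooth m.contDiff_jac p
  have hdetd := differentiable_of_smooth (contDiff_det m.contDiff_jac) p
  have hl := hasDerivAt_line hjd (0, w p)
  have hl2 := hasDerivAt_det hl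
  simp only [zero_smul, add_zero] at hl2
  have h1 : fderiv ℝ (fun q => (m.jac q).det) p (0, w p)
      = ((m.jac p).adjugate * adv w m.jac p).trace := by
    rw [adv_eq_fderiv]
    exact fderiv_eq_of_line hdetd hl2
  have hdiv : divg w p = (Matrix.of fun k j => dx j w p k : Mat3).trace := by
    rw [divg_eq_sum γ.contDiff_w]
    rfl
  have h2 : HasDerivAt (fun ε => ((γ.m ε).jac p).det)
      (-((m.jac p).det * divg w p) - fderiv ℝ (fun q => (m.jac q).det) p (0, w p)) 0 := by
    refine (hasDerivAt_det (γ.hasDerivAt_jac p)).congr_deriv ?_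
    rw [h1, mul_sub, Matrix.trace_sub, mul_neg, Matrix.trace_neg, ← mul_assoc,
      Matrix.adjugate_mul, Matrix.smul_mul, one_mul, Matrix.trace_smul, smul_eq_mul, hdiv]
  -- the absolute value in the density is differentiable since the Jacobian does not vanish
  have h3 := (hasDerivAt_abs (show ((γ.m 0).jac p).det ≠ 0 from hDne)).comp (0 : ℝ) h2
  have hr : ContDiff ℝ ∞ fun z : ℝ × SpaceTime => d.rho0 z.2.2 :=
    d.rho0_smooth.comp (contDiff_snd.comp contDiff_snd)
  have h4 := γ.hasDerivAt_toEuler hr (f' := fun _ => 0) (fun q => by simp) p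
  have h5 := h4.mul h3
  have hrd : DifferentiableAt ℝ (m.toEuler fun q => d.rho0 q.2) p :=
    differentiable_of_smooth (d.rho0_smooth.comp m.Y_smooth) p
  have habs : fderiv ℝ (fun q => |(m.jac q).det|) p (0, w p)
      = SignType.sign (m.jac p).det * fderiv ℝ (fun q => (m.jac q).det) p (0, w p) := by
    have := (hasDerivAt_abs hDne).comp_hasFDerivAt p hdetd.hasFDerivAt
    exact congrArg (fun L => L (0, w p)) this.fderiv
  have habsd : DifferentiableAt ℝ (fun q => |(m.jac q).det|) p :=
    differentiable_of_smooth ((contDiff_det m.contDiff_jac).abs m.det_ne_zero) p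
  have hadv : adv w (m.fields d).rho p = adv w (m.toEuler fun q => d.rho0 q.2) p * |(m.jac p).det|
      + d.rho0 (m.Y p) * (SignType.sign (m.jac p).det
        * fderiv ℝ (fun q => (m.jac q).det) p (0, w p)) := by
    rw [adv_eq_fderiv, adv_eq_fderiv, m.rho_eq, ← habs]
    exact fderiv_realMul_dir hrd habsd (0, w p)
  have hv : (γ.generator.variation (m.fields d)).rho p
      = -(adv w (m.fields d).rho p + (m.fields d).rho p * divg w p) := by
    rw [← divg_smul (m.contDiff_rho d) γ.contDiff_w]
    rfl
  rw [hv, hadv]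
  have hρ : (fun ε => ((γ.m ε).fields d).rho p)
      = fun ε => (γ.m ε).toEuler (fun q => d.rho0 q.2) p * |((γ.m ε).jac p).det| :=
    funext fun ε => congrFun ((γ.m ε).rho_eq d) p
  rw [hρ, congrFun (m.rho_eq d) p]
  refine h5.congr_deriv ?_
  have hsgn : |(m.jac p).det| = SignType.sign (m.jac p).det * (m.jac p).det :=
    (sign_mul_self _).symm
  simp only [Function.comp_apply, ← hm]
  change ((0 : ℝ) - adv w (m.toEuler fun q => d.rho0 q.2) p) * |(m.jac p).det|
    + d.rho0 (m.Y p) * (SignType.sign (m.jac p).det * (-((m.jac p).det * divg w p)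
      - fderiv ℝ (fun q => (m.jac q).det) p (0, w p))) = _
  rw [hsgn]
  ring

end MotionFamily

/-! ### Evolution along a motion -/

namespace Motion

variable (m : Motion) (d : RefData) (p : SpaceTime)

theorem contDiff_u : ContDiff ℝ ∞ (m.fields d).u := m.contDiff_toEuler (contDiff_dt m.X_smooth)

theorem contDiff_nu : ContDiff ℝ ∞ (m.fields d).nu := by
  have h : (m.fields d).nu = m.toEuler fun q => dt m.R q * (m.R q)ᵀ := by
    funext q
    simp only [Motion.fields, Motion.toEuler, Motion.R_inv]
  rw [h]
  exact m.contDiff_toEuler ((contDiff_dt m.R_smooth).mul (contDiff_transpose m.R_smooth))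

theorem contDiff_Lam : ContDiff ℝ ∞ (m.fields d).Lam :=
  m.contDiff_toEuler ((m.lam_smooth.inv fun q => (m.lam_pos q).ne').mul (contDiff_dt m.lam_smooth))

theorem contDiff_Q : ContDiff ℝ ∞ (m.fields d).Q :=
  m.contDiff_toEuler ((m.lam_smooth.pow 2).smul
    ((m.R_smooth.mul (d.Q0_smooth.comp contDiff_snd)).mul (contDiff_transpose m.R_smooth)))

theorem Q_symm : ((m.fields d).Q p)ᵀ = (m.fields d).Q p := by
  simp only [Motion.fields, Motion.toEuler, Matrix.transpose_smul, Matrix.transpose_mul,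
    Matrix.transpose_transpose, d.Q0_symm, mul_assoc]

/-- The translates of a motion in time. The generator of this family consists of the velocity
fields `u`, `ν̂`, `Λ` themselves, so that the evolution equations of `ρ` and `Q` are instances of
the variation formulas. -/
noncomputable def translates : MotionFamily where
  m ε :=
    { X := fun q => m.X (q.1 + ε, q.2)
      Y := fun q => m.Y (q.1 + ε, q.2)
      R := fun q => m.R (q.1 + ε, q.2)
      lam := fun q => m.lam (q.1 + ε, q.2)
      X_smooth := m.X_smooth.comp ((contDiff_fst.add contDiff_const).prodMk contDiff_snd)
      Y_smooth := m.Y_smooth.comp ((contDiff_fst.add contDiff_const).prodMk contDiff_snd)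
      R_smooth := m.R_smooth.comp ((contDiff_fst.add contDiff_const).prodMk contDiff_snd)
      lam_smooth := m.lam_smooth.comp ((contDiff_fst.add contDiff_const).prodMk contDiff_snd)
      Y_X := fun t x => m.Y_X (t + ε) x
      X_Y := fun t x => m.X_Y (t + ε) x
      R_rot := fun _ => m.R_rot _
      lam_pos := fun _ => m.lam_pos _ }
  X_smooth := m.X_smooth.comp (((contDiff_fst.comp contDiff_snd).add contDiff_fst).prodMk
    (contDiff_snd.comp contDiff_snd))
  Y_smooth := m.Y_smooth.comp (((contDiff_fst.comp contDiff_snd).add contDiff_fst).prodMk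
    (contDiff_snd.comp contDiff_snd))
  R_smooth := m.R_smooth.comp (((contDiff_fst.comp contDiff_snd).add contDiff_fst).prodMk
    (contDiff_snd.comp contDiff_snd))
  lam_smooth := m.lam_smooth.comp (((contDiff_fst.comp contDiff_snd).add contDiff_fst).prodMk
    (contDiff_snd.comp contDiff_snd))

theorem translates_zero : m.translates.m 0 = m := by
  simp only [translates, add_zero]

theorem hasDerivAt_time {V : Type*} [NormedAddCommGroup V] [NormedSpace ℝ V] {f : SpaceTime → V}
    (hf : ContDiff ℝ ∞ f) (q : SpaceTime) :
    HasDerivAt (fun ε : ℝ => f (q.1 + ε, q.2)) (dt f q) 0 := by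
  have h := hasDerivAt_line (differentiable_of_smooth hf q) (1, 0)
  have e (s : ℝ) : q + s • ((1, 0) : SpaceTime) = (q.1 + s, q.2) := by
    ext <;> simp
  simp only [e] at h
  exact h

theorem translates_generator_w : m.translates.generator.w = (m.fields d).u := by
  funext q
  have h : m.translates.generator.w q
      = (m.translates.m 0).toEuler (fun q => deriv (fun ε => m.X (q.1 + ε, q.2)) 0) q := rfl
  rw [h, translates_zero]
  exact (hasDerivAt_time m.X_smooth (q.1, m.Y q)).deriv

theorem translates_generator_eta : m.translates.generator.eta = (m.fields d).nu := by
  funext q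
  have h : m.translates.generator.eta q = (m.translates.m 0).toEuler
      (fun q => deriv (fun ε => m.R (q.1 + ε, q.2)) 0 * ((m.translates.m 0).R q)⁻¹) q := rfl
  rw [h, translates_zero]
  exact congrArg (fun A => A * (m.R (q.1, m.Y q))⁻¹)
    (hasDerivAt_time m.R_smooth (q.1, m.Y q)).deriv

theorem translates_generator_Xi : m.translates.generator.Xi = (m.fields d).Lam := by
  funext q
  have h : m.translates.generator.Xi q = (m.translates.m 0).toEuler
      (fun q => ((m.translates.m 0).lam q)⁻¹ * deriv (fun ε => m.lam (q.1 + ε, q.2)) 0) q := rfl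
  rw [h, translates_zero]
  exact congrArg (fun A => (m.lam (q.1, m.Y q))⁻¹ * A)
    (hasDerivAt_time m.lam_smooth (q.1, m.Y q)).deriv

theorem nu_skew : ((m.fields d).nu p)ᵀ = -(m.fields d).nu p := by
  rw [← m.translates_generator_eta, MotionFamily.generator_eta]
  exact m.translates.matEta_skew _

theorem continuityEq : ContinuityEq (m.fields d) p := by
  have h1 := m.translates.hasDerivAt_rho d p
  rw [translates_zero] at h1
  have h2 := (hasDerivAt_time (m.contDiff_rho d) p).unique h1
  have h3 : (m.translates.generator.variation (m.fields d)).rho p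
      = -divg (fun q => (m.fields d).rho q • (m.fields d).u q) p := by
    rw [← m.translates_generator_w d]
    rfl
  rw [h3, divg_smul (m.contDiff_rho d) (m.contDiff_u d)] at h2
  rw [ContinuityEq, matD, h2]
  ring

theorem qEvolutionEq : QEvolutionEq (m.fields d) p := by
  have h1 := m.translates.hasDerivAt_Q d p
  rw [translates_zero] at h1
  have h2 := (hasDerivAt_time (m.contDiff_Q d) p).unique h1
  have h3 : (m.translates.generator.variation (m.fields d)).Q p
      = ⁅(m.fields d).nu p, (m.fields d).Q p⁆ + (2 * (m.fields d).Lam p) • (m.fields d).Q p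
        - adv (m.fields d).u (m.fields d).Q p := by
    rw [← m.translates_generator_w d, ← m.translates_generator_eta d,
      ← m.translates_generator_Xi d]
    rfl
  rw [QEvolutionEq, matD, h2, h3, sub_add_cancel]

end Motion
/-! ### The free energy -/

section FreeEnergy

variable {F : Mat3 × (Fin 3 → Mat3) → ℝ} (hF : ContDiff ℝ ∞ F)
include hF

theorem dFdQ_apply (z : Mat3 × (Fin 3 → Mat3)) (i j : Fin 3) :
    dFdQ F z i j = fderiv ℝ F z (Matrix.single i j 1, 0) := by
  have h := hasDerivAt_line (differentiable_of_smooth hF z)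
    ((Matrix.single i j 1, 0) : Mat3 × (Fin 3 → Mat3))
  have e (s : ℝ) : z + s • ((Matrix.single i j 1, 0) : Mat3 × (Fin 3 → Mat3))
      = (z.1 + s • Matrix.single i j 1, z.2) := by
    refine Prod.ext rfl ?_
    rw [Prod.snd_add, Prod.smul_snd, smul_zero, add_zero]
  simp only [e] at h
  exact h.deriv

theorem dFdGrad_apply (l : Fin 3) (z : Mat3 × (Fin 3 → Mat3)) (i j : Fin 3) :
    dFdGrad F l z i j = fderiv ℝ F z (0, Pi.single l (Matrix.single i j 1)) := by
  have h := hasDerivAt_line (differentiable_of_smooth hF z)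
    ((0, Pi.single l (Matrix.single i j 1)) : Mat3 × (Fin 3 → Mat3))
  have e (s : ℝ) : z + s • ((0, Pi.single l (Matrix.single i j 1)) : Mat3 × (Fin 3 → Mat3))
      = (z.1, z.2 + s • (Pi.single l (Matrix.single i j 1) : Fin 3 → Mat3)) := by
    refine Prod.ext ?_ rfl
    rw [Prod.fst_add, Prod.smul_fst, smul_zero, add_zero]
  simp only [e] at h
  exact h.deriv

theorem fderiv_freeEnergy (z : Mat3 × (Fin 3 → Mat3)) (A : Mat3) (B : Fin 3 → Mat3) :
    fderiv ℝ F z (A, B) = ((dFdQ F z)ᵀ * A).trace + ∑ l, ((dFdGrad F l z)ᵀ * B l).trace := by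
  have hA : ((A, 0) : Mat3 × (Fin 3 → Mat3))
      = ∑ i, ∑ j, A i j • ((Matrix.single i j 1, 0) : Mat3 × (Fin 3 → Mat3)) := by
    refine Prod.ext ?_ ?_
    · simpa [Prod.fst_sum] using matrix_eq_sum_single A
    · simp [Prod.snd_sum]
  have hB : ((0, B) : Mat3 × (Fin 3 → Mat3)) = ∑ l, ∑ i, ∑ j,
      B l i j • ((0, Pi.single l (Matrix.single i j 1)) : Mat3 × (Fin 3 → Mat3)) := by
    refine Prod.ext ?_ ?_
    · simp [Prod.fst_sum]
    · simp only [Prod.snd_sum, Prod.smul_snd]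
      have h (l : Fin 3) : ∑ i, ∑ j,
          B l i j • (Pi.single l (Matrix.single i j 1) : Fin 3 → Mat3) = Pi.single l (B l) := by
        conv_rhs => rw [matrix_eq_sum_single (B l)]
        ext k : 1
        by_cases hk : k = l
        · subst hk
          simp [Finset.sum_apply]
        · simp [Finset.sum_apply, hk]
      simp only [h]
      exact (Finset.univ_sum_single B).symm
  have hAB : ((A, B) : Mat3 × (Fin 3 → Mat3)) = (A, 0) + (0, B) := by simp
  rw [hAB, map_add, hA, hB]
  simp only [map_sum, map_smul, smul_eq_mul, ← dFdQ_apply hF, ← dFdGrad_apply hF,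
    trace_transpose_mul_sum]
  simp only [mul_comm]

theorem contDiff_dFdQ : ContDiff ℝ ∞ (dFdQ F) := by
  refine contDiff_of_entries fun i j => ?_
  simp only [dFdQ_apply hF]
  exact contDiff_fderiv_dir hF contDiff_const

theorem contDiff_dFdGrad (l : Fin 3) : ContDiff ℝ ∞ (dFdGrad F l) := by
  refine contDiff_of_entries fun i j => ?_
  simp only [dFdGrad_apply hF]
  exact contDiff_fderiv_dir hF contDiff_const

end FreeEnergy

theorem contDiff_jet {Q : SpaceTime → Mat3} (hQ : ContDiff ℝ ∞ Q) : ContDiff ℝ ∞ (jet Q) :=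
  hQ.prodMk (contDiff_pi.2 fun l => contDiff_dx hQ l)

theorem contDiff_molField {F : Mat3 × (Fin 3 → Mat3) → ℝ} (hF : ContDiff ℝ ∞ F)
    {Q : SpaceTime → Mat3} (hQ : ContDiff ℝ ∞ Q) : ContDiff ℝ ∞ (molField F Q) := by
  have h1 : ContDiff ℝ ∞ fun p => dFdQ F (jet Q p) := (contDiff_dFdQ hF).comp (contDiff_jet hQ)
  have h2 (l : Fin 3) : ContDiff ℝ ∞ (dx l fun q => dFdGrad F l (jet Q q)) :=
    contDiff_dx ((contDiff_dFdGrad hF l).comp (contDiff_jet hQ)) l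
  have h3 : ContDiff ℝ ∞ fun p => -dFdQ F (jet Q p) + ∑ l, dx l (fun q => dFdGrad F l (jet Q q)) p :=
    h1.neg.add (ContDiff.sum fun l _ => h2 l)
  have h4 := h3.add (contDiff_transpose h3)
  exact h4.const_smul (1 / 2 : ℝ)

theorem molField_symm (F : Mat3 × (Fin 3 → Mat3) → ℝ) (Q : SpaceTime → Mat3) (p : SpaceTime) :
    (molField F Q p)ᵀ = molField F Q p := by
  simp only [molField, Matrix.transpose_smul, Matrix.transpose_add, Matrix.transpose_transpose]
  rw [add_comm]

theorem trace_symmPart_mul (H : Mat3) {D : Mat3} (hD : Dᵀ = D) :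
    (((1 / 2 : ℝ) • (H + Hᵀ)) * D).trace = (Hᵀ * D).trace := by
  have h : (H * D).trace = (Hᵀ * D).trace := by
    rw [← Matrix.trace_transpose, Matrix.transpose_mul, hD, Matrix.trace_mul_comm]
  rw [Matrix.smul_mul, Matrix.trace_smul, add_mul, Matrix.trace_add, h, smul_eq_mul]
  ring

theorem fderiv_transposeMul_dir {P : Type*} [NormedAddCommGroup P] [NormedSpace ℝ P]
    {f g : P → Mat3} {p : P} (hf : DifferentiableAt ℝ f p) (hg : DifferentiableAt ℝ g p) (e : P) :
    fderiv ℝ (fun q => ((f q)ᵀ * g q).trace) p e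
      = ((fderiv ℝ f p e)ᵀ * g p).trace + ((f p)ᵀ * fderiv ℝ g p e).trace := by
  have hfT : DifferentiableAt ℝ (fun q => (f q)ᵀ) p := transposeL.differentiableAt.comp p hf
  have hm : DifferentiableAt ℝ (fun q => (f q)ᵀ * g q) p := hfT.mul hg
  rw [fderiv_trace_dir hm, fderiv_matMul_dir hfT hg, fderiv_transpose_dir hf,
    Matrix.trace_add]

/-- Integration by parts for the free energy: `-∂F(Q, ∇Q) · (D, ∇D)` is `Tr (h D)` up to a
divergence. -/
theorem freeEnergy_by_parts {F : Mat3 × (Fin 3 → Mat3) → ℝ} (hF : ContDiff ℝ ∞ F)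
    {Q D : SpaceTime → Mat3} (hQ : ContDiff ℝ ∞ Q) (hD : ContDiff ℝ ∞ D)
    (hs : ∀ q, (D q)ᵀ = D q) (p : SpaceTime) :
    -fderiv ℝ F (jet Q p) (jet D p) = (molField F Q p * D p).trace
      - ∑ l, dx l (fun q => ((dFdGrad F l (jet Q q))ᵀ * D q).trace) p := by
  have hG (l : Fin 3) := differentiable_of_smooth ((contDiff_dFdGrad hF l).comp (contDiff_jet hQ)) p
  have hDd := differentiable_of_smooth hD p
  have h (l : Fin 3) : dx l (fun q => ((dFdGrad F l (jet Q q))ᵀ * D q).trace) p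
      = ((dx l (fun q => dFdGrad F l (jet Q q)) p)ᵀ * D p).trace
        + ((dFdGrad F l (jet Q p))ᵀ * dx l D p).trace :=
    fderiv_transposeMul_dir (hG l) hDd _
  rw [molField, trace_symmPart_mul _ (hs p), jet, jet, fderiv_freeEnergy hF]
  simp only [h, Matrix.transpose_add, Matrix.transpose_neg, add_mul, neg_mul, Matrix.trace_add,
    Matrix.trace_neg, Matrix.transpose_sum, Finset.sum_mul, Matrix.trace_sum,
    Finset.sum_add_distrib]
  ring_nf
  rfl

/-- The Ericksen stress: `∂ₖ (F (Q, ∇Q)) + Tr (h ∂ₖQ)` is a divergence. -/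
theorem fderiv_freeEnergy_jet {F : Mat3 × (Fin 3 → Mat3) → ℝ} (hF : ContDiff ℝ ∞ F)
    {Q : SpaceTime → Mat3} (hQ : ContDiff ℝ ∞ Q) (hs : ∀ q, (Q q)ᵀ = Q q) (p : SpaceTime)
    (k : Fin 3) :
    dx k (fun q => F (jet Q q)) p + (molField F Q p * dx k Q p).trace =
      ∑ l, dx l (fun q => ∑ i, ∑ j, dFdGrad F l (jet Q q) i j * dx k Q q i j) p := by
  have hk := contDiff_dx hQ k
  have hks (q : SpaceTime) : (dx k Q q)ᵀ = dx k Q q :=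
    fderiv_symm_dir hs (differentiable_of_smooth hQ q) _
  have h1 := freeEnergy_by_parts hF hQ hk hks p
  have h2 : dx k (fun q => F (jet Q q)) p = fderiv ℝ F (jet Q p) (jet (dx k Q) p) := by
    have hj := (differentiable_of_smooth (contDiff_jet hQ) p).hasFDerivAt
    have hc := (differentiable_of_smooth hF (jet Q p)).hasFDerivAt.comp p hj
    have h3 := congrArg (fun L => L ((0, EuclideanSpace.single k 1) : SpaceTime)) hc.fderiv
    refine h3.trans ?_
    have hpi : HasFDerivAt (fun q l => dx l Q q)
        (ContinuousLinearMap.pi fun l => fderiv ℝ (dx l Q) p) p :=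
      hasFDerivAt_pi.2 fun l => (differentiable_of_smooth (contDiff_dx hQ l) p).hasFDerivAt
    have hj2 := (differentiable_of_smooth hQ p).hasFDerivAt.prodMk hpi
    rw [ContinuousLinearMap.comp_apply, hj.unique hj2]
    congr 1
    refine Prod.ext rfl (funext fun l => ?_)
    exact fderiv_comm_dir hQ p (0, EuclideanSpace.single l 1) (0, EuclideanSpace.single k 1)
  simp only [trace_transpose_mul_sum] at h1
  rw [h2]
  linarith

/-! ### The first variation of the Lagrangian density -/

/-- Smooth Eulerian fields that satisfy the kinematic relations of the ansatz. -/
structure Fields.Kinematic (φ : Fields) : Prop where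
  rho_smooth : ContDiff ℝ ∞ φ.rho
  u_smooth : ContDiff ℝ ∞ φ.u
  nu_smooth : ContDiff ℝ ∞ φ.nu
  Lam_smooth : ContDiff ℝ ∞ φ.Lam
  Q_smooth : ContDiff ℝ ∞ φ.Q
  rho_pos : ∀ p, 0 < φ.rho p
  nu_skew : ∀ p, (φ.nu p)ᵀ = -φ.nu p
  Q_symm : ∀ p, (φ.Q p)ᵀ = φ.Q p
  continuity : ∀ p, ContinuityEq φ p
  evolution : ∀ p, QEvolutionEq φ p

theorem Motion.kinematic (m : Motion) (d : RefData) : (m.fields d).Kinematic where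
  rho_smooth := m.contDiff_rho d
  u_smooth := m.contDiff_u d
  nu_smooth := m.contDiff_nu d
  Lam_smooth := m.contDiff_Lam d
  Q_smooth := m.contDiff_Q d
  rho_pos := m.rho_pos d
  nu_skew := m.nu_skew d
  Q_symm := m.Q_symm d
  continuity := m.continuityEq d
  evolution := m.qEvolutionEq d

/-- The kinetic energy per unit mass, as a function of the values of `u, ν̂, Λ, Q`. -/
noncomputable def kin (J : ℝ) (u : E3) (nu : Mat3) (Lam : ℝ) (Q : Mat3) : ℝ :=
  1 / 2 * ‖u‖ ^ 2 + J / 2 * ‖⁅nu, Q⁆‖ ^ 2 + 2 * J * Lam ^ 2 * ‖Q‖ ^ 2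

/-- The differential of `kin` at `(u, ν̂, Λ, Q)` in the direction `(du, dν̂, dΛ, dQ)`. -/
noncomputable def dkin (J : ℝ) (u : E3) (nu : Mat3) (Lam : ℝ) (Q : Mat3)
    (du : E3) (dnu : Mat3) (dLam : ℝ) (dQ : Mat3) : ℝ :=
  inner ℝ u du + J * (⁅nu, Q⁆ᵀ * (⁅dnu, Q⁆ + ⁅nu, dQ⁆)).trace + 4 * J * Lam * dLam * ‖Q‖ ^ 2
    + 4 * J * Lam ^ 2 * (Qᵀ * dQ).trace

theorem hasDerivAt_frobenius_sq {A : ℝ → Mat3} {A' : Mat3} {s : ℝ} (hA : HasDerivAt A A' s) :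
    HasDerivAt (fun s => ‖A s‖ ^ 2) (2 * ((A s)ᵀ * A').trace) s := by
  have hT : HasDerivAt (fun s => (A s)ᵀ) A'ᵀ s := transposeL.hasFDerivAt.comp_hasDerivAt s hA
  have hm : HasDerivAt (fun s => (A s)ᵀ * A s) (A'ᵀ * A s + (A s)ᵀ * A') s := hT.mul hA
  have h : HasDerivAt (fun s => ((A s)ᵀ * A s).trace) (A'ᵀ * A s + (A s)ᵀ * A').trace s :=
    traceL.hasFDerivAt.comp_hasDerivAt s hm
  simp only [← frobenius_sq] at h
  refine h.congr_deriv ?_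
  have e : (A'ᵀ * A s).trace = ((A s)ᵀ * A').trace := by
    rw [← Matrix.trace_transpose, Matrix.transpose_mul, Matrix.transpose_transpose]
  rw [Matrix.trace_add, e]
  ring

theorem hasDerivAt_kin (J : ℝ) {u : ℝ → E3} {nu : ℝ → Mat3} {Lam : ℝ → ℝ} {Q : ℝ → Mat3}
    {du : E3} {dnu : Mat3} {dLam : ℝ} {dQ : Mat3} {s : ℝ} (hu : HasDerivAt u du s)
    (hnu : HasDerivAt nu dnu s) (hLam : HasDerivAt Lam dLam s) (hQ : HasDerivAt Q dQ s) :
    HasDerivAt (fun s => kin J (u s) (nu s) (Lam s) (Q s))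
      (dkin J (u s) (nu s) (Lam s) (Q s) du dnu dLam dQ) s := by
  have h1 := (hu.norm_sq).const_mul (1 / 2 : ℝ)
  have h2 := (hasDerivAt_frobenius_sq (hasDerivAt_lie hnu hQ)).const_mul (J / 2)
  have h3 := (((hLam.pow 2).const_mul (2 * J))).mul (hasDerivAt_frobenius_sq hQ)
  refine ((h1.add h2).add h3).congr_deriv ?_
  simp only [dkin, Pi.pow_apply, Nat.cast_ofNat]
  ring

section Kinetic

variable {J : ℝ} {φ : Fields} (hφ : φ.Kinematic)
include hφ

theorem Fields.Kinematic.S_symm (p : SpaceTime) : ⁅φ.nu p, φ.Q p⁆ᵀ = ⁅φ.nu p, φ.Q p⁆ :=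
  transpose_lie_of_skew_symm (hφ.nu_skew p) (hφ.Q_symm p)

theorem Fields.Kinematic.S_smooth : ContDiff ℝ ∞ fun q => ⁅φ.nu q, φ.Q q⁆ :=
  contDiff_lie hφ.nu_smooth hφ.Q_smooth

theorem Fields.Kinematic.N_smooth : ContDiff ℝ ∞ fun q => ⁅⁅φ.nu q, φ.Q q⁆, φ.Q q⁆ :=
  contDiff_lie hφ.S_smooth hφ.Q_smooth

theorem Fields.Kinematic.normQ_smooth : ContDiff ℝ ∞ fun q => ‖φ.Q q‖ ^ 2 :=
  contDiff_frobenius_sq hφ.Q_smooth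

omit hφ in
theorem contDiff_inner {u w : SpaceTime → E3} (hu : ContDiff ℝ ∞ u) (hw : ContDiff ℝ ∞ w) :
    ContDiff ℝ ∞ fun q => inner ℝ (u q) (w q) := hu.inner ℝ hw

theorem Fields.Kinematic.kin_smooth :
    ContDiff ℝ ∞ fun q => kin J (φ.u q) (φ.nu q) (φ.Lam q) (φ.Q q) :=
  ((contDiff_const.mul (hφ.u_smooth.norm_sq ℝ)).add
    (contDiff_const.mul (contDiff_frobenius_sq hφ.S_smooth))).add
    ((contDiff_const.mul (hφ.Lam_smooth.pow 2)).mul hφ.normQ_smooth)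

theorem Fields.Kinematic.fderiv_kin (p e : SpaceTime) :
    fderiv ℝ (fun q => kin J (φ.u q) (φ.nu q) (φ.Lam q) (φ.Q q)) p e
      = dkin J (φ.u p) (φ.nu p) (φ.Lam p) (φ.Q p) (fderiv ℝ φ.u p e) (fderiv ℝ φ.nu p e)
        (fderiv ℝ φ.Lam p e) (fderiv ℝ φ.Q p e) := by
  have h := hasDerivAt_kin J (hasDerivAt_line (differentiable_of_smooth hφ.u_smooth p) e)
    (hasDerivAt_line (differentiable_of_smooth hφ.nu_smooth p) e)
    (hasDerivAt_line (differentiable_of_smooth hφ.Lam_smooth p) e)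
    (hasDerivAt_line (differentiable_of_smooth hφ.Q_smooth p) e)
  simp only [zero_smul, add_zero] at h
  exact fderiv_eq_of_line (differentiable_of_smooth hφ.kin_smooth p) h

/-- `Dₜ ‖Q‖² = 4 Λ ‖Q‖²`: the order parameter changes its size by dilation only. -/
theorem Fields.Kinematic.matD_normQ (p : SpaceTime) :
    fderiv ℝ (fun q => ‖φ.Q q‖ ^ 2) p (1, φ.u p) = 4 * φ.Lam p * ‖φ.Q p‖ ^ 2 := by
  have h := hasDerivAt_frobenius_sq
    (hasDerivAt_line (differentiable_of_smooth hφ.Q_smooth p) (1, φ.u p))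
  simp only [zero_smul, add_zero] at h
  refine (fderiv_eq_of_line (differentiable_of_smooth hφ.normQ_smooth p) h).trans ?_
  have he := hφ.evolution p
  rw [QEvolutionEq, matD_eq_fderiv] at he
  rw [he, mul_add, Matrix.trace_add, hφ.Q_symm, trace_mul_lie_self, Matrix.mul_smul,
    Matrix.trace_smul, ← frobenius_sq_of_symm (hφ.Q_symm p), smul_eq_mul]
  ring

end Kinetic

/-- The boundary term in time of the first variation, per unit mass. -/
noncomputable def noetherCharge (J : ℝ) (φ : Fields) (v : Generator) (p : SpaceTime) : ℝ :=
  inner ℝ (φ.u p) (v.w p) - J * (⁅⁅φ.nu p, φ.Q p⁆, φ.Q p⁆ * v.eta p).trace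
    + 4 * J * (φ.Lam p * ‖φ.Q p‖ ^ 2 * v.Xi p)

theorem contDiff_noetherCharge {J : ℝ} {φ : Fields} (hφ : φ.Kinematic) {v : Generator}
    (hw : ContDiff ℝ ∞ v.w) (heta : ContDiff ℝ ∞ v.eta) (hXi : ContDiff ℝ ∞ v.Xi) :
    ContDiff ℝ ∞ (noetherCharge J φ v) :=
  ((contDiff_inner hφ.u_smooth hw).sub
    (contDiff_const.mul (contDiff_trace (hφ.N_smooth.mul heta)))).add
    (contDiff_const.mul ((hφ.Lam_smooth.mul hφ.normQ_smooth).mul hXi))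

theorem fderiv_noetherCharge {J : ℝ} {φ : Fields} (hφ : φ.Kinematic) {v : Generator}
    (hw : ContDiff ℝ ∞ v.w) (heta : ContDiff ℝ ∞ v.eta) (hXi : ContDiff ℝ ∞ v.Xi)
    (p e : SpaceTime) :
    fderiv ℝ (noetherCharge J φ v) p e
      = inner ℝ (fderiv ℝ φ.u p e) (v.w p) + inner ℝ (φ.u p) (fderiv ℝ v.w p e)
        - J * ((fderiv ℝ (fun q => ⁅⁅φ.nu q, φ.Q q⁆, φ.Q q⁆) p e * v.eta p).trace
          + (⁅⁅φ.nu p, φ.Q p⁆, φ.Q p⁆ * fderiv ℝ v.eta p e).trace)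
        + 4 * J * (fderiv ℝ φ.Lam p e * ‖φ.Q p‖ ^ 2 * v.Xi p
          + φ.Lam p * fderiv ℝ (fun q => ‖φ.Q q‖ ^ 2) p e * v.Xi p
          + φ.Lam p * ‖φ.Q p‖ ^ 2 * fderiv ℝ v.Xi p e) := by
  have h1 := (hasDerivAt_line (differentiable_of_smooth hφ.u_smooth p) e).inner ℝ
    (hasDerivAt_line (differentiable_of_smooth hw p) e)
  have h2 : HasDerivAt (fun s : ℝ => (⁅⁅φ.nu (p + s • e), φ.Q (p + s • e)⁆, φ.Q (p + s • e)⁆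
      * v.eta (p + s • e)).trace)
      (fderiv ℝ (fun q => ⁅⁅φ.nu q, φ.Q q⁆, φ.Q q⁆) p e * v.eta (p + (0 : ℝ) • e)
        + ⁅⁅φ.nu (p + (0 : ℝ) • e), φ.Q (p + (0 : ℝ) • e)⁆, φ.Q (p + (0 : ℝ) • e)⁆
          * fderiv ℝ v.eta p e).trace 0 :=
    traceL.hasFDerivAt.comp_hasDerivAt (0 : ℝ)
      ((hasDerivAt_line (differentiable_of_smooth hφ.N_smooth p) e).mul
        (hasDerivAt_line (differentiable_of_smooth heta p) e))
  have h3 := ((hasDerivAt_line (differentiable_of_smooth hφ.Lam_smooth p) e).mul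
    (hasDerivAt_line (differentiable_of_smooth hφ.normQ_smooth p) e)).mul
    (hasDerivAt_line (differentiable_of_smooth hXi p) e)
  have h := (h1.sub (h2.const_mul J)).add (h3.const_mul (4 * J))
  have hd := differentiable_of_smooth (contDiff_noetherCharge (J := J) hφ hw heta hXi) p
  refine (fderiv_eq_of_line hd h).trans ?_
  simp only [zero_smul, add_zero, Matrix.trace_add, Pi.mul_apply]
  ring

theorem dkin_add (J : ℝ) (u : E3) (nu : Mat3) (Lam : ℝ) (Q : Mat3) (a a' : E3) (b b' : Mat3)
    (c c' : ℝ) (e e' : Mat3) : dkin J u nu Lam Q a b c e + dkin J u nu Lam Q a' b' c' e'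
      = dkin J u nu Lam Q (a + a') (b + b') (c + c') (e + e') := by
  simp only [dkin, inner_add_right, Ring.lie_def, add_mul, mul_add, mul_sub,
    Matrix.trace_add, Matrix.trace_sub]
  ring

/-- The differential of the kinetic energy in the direction of a material variation. -/
theorem dkin_material (J : ℝ) (u : E3) {nu : Mat3} (Lam : ℝ) {Q : Mat3} (a : E3) (b eta : Mat3)
    (c Xi : ℝ) (hnu : nuᵀ = -nu) (hQ : Qᵀ = Q) :
    dkin J u nu Lam Q a (b + ⁅eta, nu⁆) c (⁅eta, Q⁆ + (2 * Xi) • Q)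
      = inner ℝ u a - J * (⁅⁅nu, Q⁆, Q⁆ * b).trace + 2 * J * Xi * ‖⁅nu, Q⁆‖ ^ 2
        + 4 * J * Lam * c * ‖Q‖ ^ 2 + 8 * J * Lam ^ 2 * Xi * ‖Q‖ ^ 2 := by
  have hS : ⁅nu, Q⁆ᵀ = ⁅nu, Q⁆ := transpose_lie_of_skew_symm hnu hQ
  -- by the Jacobi identity the rotation acts on `⁅nu, Q⁆` by a commutator
  have hJ : ⁅b + ⁅eta, nu⁆, Q⁆ + ⁅nu, ⁅eta, Q⁆ + (2 * Xi) • Q⁆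
      = -⁅Q, b⁆ + ⁅eta, ⁅nu, Q⁆⁆ + (2 * Xi) • ⁅nu, Q⁆ := by
    simp only [Ring.lie_def, add_mul, mul_add, mul_sub, sub_mul, Matrix.mul_smul, Matrix.smul_mul,
      smul_sub, mul_assoc]
    abel
  rw [dkin, hS, hQ, hJ, mul_add, mul_add, mul_add, Matrix.trace_add, Matrix.trace_add,
    Matrix.trace_add, trace_mul_lie_self, trace_mul_lie_self, mul_neg, Matrix.trace_neg,
    ← trace_lie_mul, Matrix.mul_smul, Matrix.mul_smul, Matrix.trace_smul, Matrix.trace_smul,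
    ← frobenius_sq_of_symm hS, ← frobenius_sq_of_symm hQ]
  simp only [smul_eq_mul]
  ring

/-- The kinetic part of the first variation. -/
theorem dkin_variation {J : ℝ} {φ : Fields} (hφ : φ.Kinematic) {v : Generator}
    (hw : ContDiff ℝ ∞ v.w) (heta : ContDiff ℝ ∞ v.eta) (hXi : ContDiff ℝ ∞ v.Xi)
    (p : SpaceTime) :
    dkin J (φ.u p) (φ.nu p) (φ.Lam p) (φ.Q p) ((v.variation φ).u p) ((v.variation φ).nu p)
        ((v.variation φ).Lam p) ((v.variation φ).Q p)
      + adv v.w (fun q => kin J (φ.u q) (φ.nu q) (φ.Lam q) (φ.Q q)) p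
      = matD φ.u (noetherCharge J φ v) p - inner ℝ (matD φ.u φ.u p) (v.w p)
        + J * (matD φ.u (fun q => ⁅⁅φ.nu q, φ.Q q⁆, φ.Q q⁆) p * v.eta p).trace
        + 2 * v.Xi p * (J * ‖⁅φ.nu p, φ.Q p⁆‖ ^ 2
          - 2 * J * ‖φ.Q p‖ ^ 2 * (matD φ.u φ.Lam p + 2 * φ.Lam p ^ 2)) := by
  rw [adv_eq_fderiv, hφ.fderiv_kin, dkin_add]
  -- the variations at fixed position plus the advection by `w` are the material variations
  have e1 : (v.variation φ).u p + fderiv ℝ φ.u p (0, v.w p) = fderiv ℝ v.w p (1, φ.u p) := by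
    rw [← matD_eq_fderiv, ← adv_eq_fderiv]
    simp only [Generator.variation, matD, sub_add_cancel]
  have e2 : (v.variation φ).nu p + fderiv ℝ φ.nu p (0, v.w p)
      = fderiv ℝ v.eta p (1, φ.u p) + ⁅v.eta p, φ.nu p⁆ := by
    rw [← matD_eq_fderiv_mat, ← adv_eq_fderiv_mat]
    simp only [Generator.variation, matD]
    abel
  have e3 : (v.variation φ).Lam p + fderiv ℝ φ.Lam p (0, v.w p) = fderiv ℝ v.Xi p (1, φ.u p) := by
    rw [← matD_eq_fderiv, ← adv_eq_fderiv]
    simp only [Generator.variation, matD]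
    ring
  have e4 : (v.variation φ).Q p + fderiv ℝ φ.Q p (0, v.w p)
      = ⁅v.eta p, φ.Q p⁆ + (2 * v.Xi p) • φ.Q p := by
    rw [← adv_eq_fderiv_mat]
    simp only [Generator.variation, sub_add_cancel]
  rw [e1, e2, e3, e4, dkin_material J _ _ _ _ _ _ _ (hφ.nu_skew p) (hφ.Q_symm p)]
  rw [matD_eq_fderiv_mat, matD_eq_fderiv, matD_eq_fderiv, matD_eq_fderiv]
  rw [fderiv_noetherCharge hφ hw heta hXi, hφ.matD_normQ]
  ring

/-- The derivative of the modified Lagrangian density in the direction `δφ`. -/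
noncomputable def dlagr (J : ℝ) (U : ℝ → ℝ) (F : Mat3 × (Fin 3 → Mat3) → ℝ) (φ δφ : Fields)
    (p : SpaceTime) : ℝ :=
  δφ.rho p * (kin J (φ.u p) (φ.nu p) (φ.Lam p) (φ.Q p) - U (φ.rho p) - φ.rho p * deriv U (φ.rho p))
    + φ.rho p * dkin J (φ.u p) (φ.nu p) (φ.Lam p) (φ.Q p) (δφ.u p) (δφ.nu p) (δφ.Lam p) (δφ.Q p)
    - fderiv ℝ F (jet φ.Q p) (jet δφ.Q p)

theorem lagr_eq (J : ℝ) (U : ℝ → ℝ) (F : Mat3 × (Fin 3 → Mat3) → ℝ) (φ : Fields) (p : SpaceTime) :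
    lagr J U F φ p = φ.rho p * kin J (φ.u p) (φ.nu p) (φ.Lam p) (φ.Q p)
      - φ.rho p * U (φ.rho p) - F (jet φ.Q p) := by
  simp only [lagr, kin]
  ring

theorem jet_add_smul {Q D : SpaceTime → Mat3} {p : SpaceTime} (hQ : DifferentiableAt ℝ Q p)
    (hD : DifferentiableAt ℝ D p) (ε : ℝ) : jet (Q + ε • D) p = jet Q p + ε • jet D p := by
  refine Prod.ext rfl (funext fun l => ?_)
  have h := (hQ.hasFDerivAt.add (hD.hasFDerivAt.const_smul ε)).fderiv
  exact congrArg (fun L => L (0, EuclideanSpace.single l 1)) h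

theorem hasDerivAt_lagr {J : ℝ} {U : ℝ → ℝ} {F : Mat3 × (Fin 3 → Mat3) → ℝ}
    (hU : ContDiffOn ℝ ∞ U (Set.Ioi 0)) (hF : ContDiff ℝ ∞ F) {φ δφ : Fields} {p : SpaceTime}
    (hρ : 0 < φ.rho p) (hQ : DifferentiableAt ℝ φ.Q p) (hD : DifferentiableAt ℝ δφ.Q p) :
    HasDerivAt (fun ε => lagr J U F (φ.perturb δφ ε) p) (dlagr J U F φ δφ p) 0 := by
  have hlin {V : Type} [NormedAddCommGroup V] [NormedSpace ℝ V] (a b : V) :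
      HasDerivAt (fun ε : ℝ => a + ε • b) b 0 := by
    simpa using ((hasDerivAt_id (0 : ℝ)).smul_const b).const_add a
  have hkin := hasDerivAt_kin J (hlin (φ.u p) (δφ.u p)) (hlin (φ.nu p) (δφ.nu p))
    (hlin (φ.Lam p) (δφ.Lam p)) (hlin (φ.Q p) (δφ.Q p))
  have hr := hlin (φ.rho p) (δφ.rho p)
  have hUd : HasDerivAt U (deriv U (φ.rho p)) (φ.rho p + (0 : ℝ) • δφ.rho p) := by
    rw [zero_smul, add_zero]
    exact ((hU.contDiffAt (Ioi_mem_nhds hρ)).differentiableAt (by simp)).hasDerivAt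
  have hUr := hUd.comp (0 : ℝ) hr
  have hFd : HasFDerivAt F (fderiv ℝ F (jet φ.Q p)) (jet φ.Q p + (0 : ℝ) • jet δφ.Q p) := by
    rw [zero_smul, add_zero]
    exact (differentiable_of_smooth hF _).hasFDerivAt
  have hFj : HasDerivAt (F ∘ fun ε : ℝ => jet φ.Q p + ε • jet δφ.Q p)
      (fderiv ℝ F (jet φ.Q p) (jet δφ.Q p)) 0 := hFd.comp_hasDerivAt (0 : ℝ) (hlin (jet φ.Q p) (jet δφ.Q p))
  have h := ((hr.mul hkin).sub (hr.mul hUr)).sub hFj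
  have e : (fun ε => lagr J U F (φ.perturb δφ ε) p) = _ :=
    funext fun ε => (lagr_eq J U F (φ.perturb δφ ε) p).trans
      (congrArg (fun z => _ - F z) (jet_add_smul hQ hD ε))
  rw [e]
  refine h.congr_deriv ?_
  simp only [dlagr, zero_smul, add_zero, Function.comp_apply]
  ring

section Residuals

variable (J : ℝ) (U : ℝ → ℝ) (F : Mat3 × (Fin 3 → Mat3) → ℝ) (φ : Fields)

/-- The residual of the (conservative) momentum equation. -/
noncomputable def momRes (k : Fin 3) (p : SpaceTime) : ℝ :=
  φ.rho p * matD φ.u φ.u p k + dx k (pressure U F φ) p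
    + ∑ l, dx l (fun q => ∑ i, ∑ j, dFdGrad F l (jet φ.Q q) i j * dx k φ.Q q i j) p

/-- The residual of the angular momentum equation, a field of skew matrices. -/
noncomputable def angRes (p : SpaceTime) : Mat3 :=
  (φ.rho p * J) • matD φ.u (fun q => ⁅⁅φ.nu q, φ.Q q⁆, φ.Q q⁆) p - ⁅molField F φ.Q p, φ.Q p⁆

/-- The residual of the scaling equation. -/
noncomputable def scalRes (p : SpaceTime) : ℝ :=
  φ.rho p * J * ‖⁅φ.nu p, φ.Q p⁆‖ ^ 2 + (molField F φ.Q p * φ.Q p).trace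
    - 2 * φ.rho p * J * ‖φ.Q p‖ ^ 2 * (matD φ.u φ.Lam p + 2 * φ.Lam p ^ 2)

/-- The spatial flux in the first variation formula. -/
noncomputable def noetherFlux (v : Generator) (l : Fin 3) (p : SpaceTime) : ℝ :=
  (pressure U F φ p - lagr J U F φ p) * v.w p l
    - ((dFdGrad F l (jet φ.Q p))ᵀ * (v.variation φ).Q p).trace

end Residuals

section Variation

variable {J : ℝ} {U : ℝ → ℝ} {F : Mat3 × (Fin 3 → Mat3) → ℝ} {φ : Fields} {v : Generator}

theorem contDiff_comp_rho (hφ : φ.Kinematic) {f : ℝ → ℝ} (hf : ContDiffOn ℝ ∞ f (Set.Ioi 0)) :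
    ContDiff ℝ ∞ fun q => f (φ.rho q) :=
  hf.comp_contDiff hφ.rho_smooth hφ.rho_pos

theorem contDiffOn_deriv_Ioi (hU : ContDiffOn ℝ ∞ U (Set.Ioi 0)) :
    ContDiffOn ℝ ∞ (deriv U) (Set.Ioi 0) :=
  ((contDiffOn_infty_iff_deriv_of_isOpen isOpen_Ioi).1 hU).2

theorem contDiff_freeEnergy_jet (hF : ContDiff ℝ ∞ F) (hφ : φ.Kinematic) :
    ContDiff ℝ ∞ fun q => F (jet φ.Q q) :=
  hF.comp (contDiff_jet hφ.Q_smooth)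

theorem contDiff_rhoSq_derivU (hU : ContDiffOn ℝ ∞ U (Set.Ioi 0)) (hφ : φ.Kinematic) :
    ContDiff ℝ ∞ fun q => φ.rho q ^ 2 * deriv U (φ.rho q) :=
  (hφ.rho_smooth.pow 2).mul (contDiff_comp_rho hφ (contDiffOn_deriv_Ioi hU))

theorem contDiff_pressure (hU : ContDiffOn ℝ ∞ U (Set.Ioi 0)) (hF : ContDiff ℝ ∞ F)
    (hφ : φ.Kinematic) : ContDiff ℝ ∞ (pressure U F φ) :=
  (contDiff_rhoSq_derivU hU hφ).sub (contDiff_freeEnergy_jet hF hφ)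

theorem contDiff_lagr (hU : ContDiffOn ℝ ∞ U (Set.Ioi 0)) (hF : ContDiff ℝ ∞ F)
    (hφ : φ.Kinematic) : ContDiff ℝ ∞ (lagr J U F φ) := by
  rw [funext (lagr_eq J U F φ)]
  exact ((hφ.rho_smooth.mul hφ.kin_smooth).sub (hφ.rho_smooth.mul (contDiff_comp_rho hφ hU))).sub
    (contDiff_freeEnergy_jet hF hφ)

theorem contDiff_variation_Q (hφ : φ.Kinematic) (hw : ContDiff ℝ ∞ v.w)
    (heta : ContDiff ℝ ∞ v.eta) (hXi : ContDiff ℝ ∞ v.Xi) :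
    ContDiff ℝ ∞ (v.variation φ).Q := by
  have h := contDiff_lie heta hφ.Q_smooth
  exact (h.add ((contDiff_const.mul hXi).smul hφ.Q_smooth)).sub (contDiff_adv hφ.Q_smooth hw)

theorem variation_Q_symm (hφ : φ.Kinematic) (hskew : ∀ p, (v.eta p)ᵀ = -v.eta p) (p : SpaceTime) :
    ((v.variation φ).Q p)ᵀ = (v.variation φ).Q p := by
  have h := fderiv_symm_dir hφ.Q_symm (differentiable_of_smooth hφ.Q_smooth p) (0, v.w p)
  simp only [Generator.variation, Matrix.transpose_add, Matrix.transpose_sub,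
    Matrix.transpose_smul, hφ.Q_symm, transpose_lie_of_skew_symm (hskew p) (hφ.Q_symm p),
    adv_eq_fderiv_mat, h]

/-- The volume part of the first variation: `δρ = -div (ρ w)` gives the pressure. -/
theorem density_variation (hU : ContDiffOn ℝ ∞ U (Set.Ioi 0)) (hF : ContDiff ℝ ∞ F)
    (hφ : φ.Kinematic) (hw : ContDiff ℝ ∞ v.w) (p : SpaceTime) :
    (v.variation φ).rho p * (kin J (φ.u p) (φ.nu p) (φ.Lam p) (φ.Q p) - U (φ.rho p)
        - φ.rho p * deriv U (φ.rho p))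
      = ∑ l, dx l (fun q => (pressure U F φ q - lagr J U F φ q) * v.w q l) p
        + φ.rho p * adv v.w (fun q => kin J (φ.u q) (φ.nu q) (φ.Lam q) (φ.Q q)) p
        - adv v.w (fun q => φ.rho q ^ 2 * deriv U (φ.rho q)) p := by
  set k := fun q => kin J (φ.u q) (φ.nu q) (φ.Lam q) (φ.Q q)
  have hk : ContDiff ℝ ∞ k := hφ.kin_smooth
  have hb := (contDiff_pressure hU hF hφ).sub (contDiff_lagr (J := J) hU hF hφ)
  have hdiv : ∑ l, dx l (fun q => (pressure U F φ q - lagr J U F φ q) * v.w q l) p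
      = adv v.w (fun q => pressure U F φ q - lagr J U F φ q) p
        + (pressure U F φ p - lagr J U F φ p) * divg v.w p := divg_smul hb hw p
  have hδ : (v.variation φ).rho p = -(adv v.w φ.rho p + φ.rho p * divg v.w p) := by
    rw [← divg_smul hφ.rho_smooth hw]
    rfl
  have hpl : (fun q => pressure U F φ q - lagr J U F φ q)
      = fun q => φ.rho q ^ 2 * deriv U (φ.rho q) - φ.rho q * k q + φ.rho q * U (φ.rho q) := by
    funext q
    rw [pressure, lagr_eq]
    ring
  rw [hdiv, hδ, hpl, adv_eq_fderiv, adv_eq_fderiv, adv_eq_fderiv, adv_eq_fderiv, pressure, lagr_eq]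
  have hrd := differentiable_of_smooth hφ.rho_smooth p
  have hl1 := hasDerivAt_line (differentiable_of_smooth (contDiff_rhoSq_derivU hU hφ) p) (0, v.w p)
  have hlr := hasDerivAt_line hrd (0, v.w p)
  have hlk := hasDerivAt_line (differentiable_of_smooth hk p) (0, v.w p)
  have hUd : HasDerivAt U (deriv U (φ.rho p)) (φ.rho (p + (0 : ℝ) • (0, v.w p))) := by
    rw [zero_smul, add_zero]
    exact ((hU.contDiffAt (Ioi_mem_nhds (hφ.rho_pos p))).differentiableAt (by simp)).hasDerivAt
  have hlU := hUd.comp (0 : ℝ) hlr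
  have hsm := ((contDiff_rhoSq_derivU hU hφ).sub (hφ.rho_smooth.mul hk)).add
    (hφ.rho_smooth.mul (contDiff_comp_rho hφ hU))
  have h := fderiv_eq_of_line (differentiable_of_smooth hsm p)
    ((hl1.sub (hlr.mul hlk)).add (hlr.mul hlU))
  simp only [zero_smul, add_zero] at h
  rw [h]
  ring

theorem adv_eq_sum_dx (w : SpaceTime → E3) (f : SpaceTime → ℝ) (p : SpaceTime) :
    adv w f p = ∑ k, w p k * dx k f p := rfl

/-- The pressure gradient and the Ericksen stress in terms of the molecular field. -/
theorem adv_rhoSq_derivU (hU : ContDiffOn ℝ ∞ U (Set.Ioi 0)) (hF : ContDiff ℝ ∞ F)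
    (hφ : φ.Kinematic) (w : SpaceTime → E3) (p : SpaceTime) :
    adv w (fun q => φ.rho q ^ 2 * deriv U (φ.rho q)) p
      = ∑ k, w p k * (dx k (pressure U F φ) p
          + ∑ l, dx l (fun q => ∑ i, ∑ j, dFdGrad F l (jet φ.Q q) i j * dx k φ.Q q i j) p)
        - (molField F φ.Q p * adv w φ.Q p).trace := by
  have h1 (k : Fin 3) : dx k (fun q => φ.rho q ^ 2 * deriv U (φ.rho q)) p
      = dx k (pressure U F φ) p + dx k (fun q => F (jet φ.Q q)) p := by
    have hp := differentiable_of_smooth (contDiff_pressure hU hF hφ) p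
    have hf := differentiable_of_smooth (contDiff_freeEnergy_jet hF hφ) p
    have h := fderiv_add_dir hp hf (0, EuclideanSpace.single k 1)
    refine Eq.trans ?_ h
    simp only [pressure, sub_add_cancel, dx]
  have h2 (k : Fin 3) := fderiv_freeEnergy_jet hF hφ.Q_smooth hφ.Q_symm p k
  have h3 : (molField F φ.Q p * adv w φ.Q p).trace
      = ∑ k, w p k * (molField F φ.Q p * dx k φ.Q p).trace := by
    simp only [adv, Finset.mul_sum, Matrix.trace_sum, Matrix.mul_smul, Matrix.trace_smul,
      smul_eq_mul]
  rw [adv_eq_sum_dx, h3, ← Finset.sum_sub_distrib]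
  refine Finset.sum_congr rfl fun k _ => ?_
  rw [h1, ← h2]
  ring

/-- The first variation formula: up to a total derivative along the flow and a spatial divergence,
the variation of the Lagrangian density pairs the generators with the residuals of the equations of
motion. -/
theorem dlagr_variation (hU : ContDiffOn ℝ ∞ U (Set.Ioi 0)) (hF : ContDiff ℝ ∞ F)
    (hφ : φ.Kinematic) (hw : ContDiff ℝ ∞ v.w) (heta : ContDiff ℝ ∞ v.eta)
    (hXi : ContDiff ℝ ∞ v.Xi) (hskew : ∀ p, (v.eta p)ᵀ = -v.eta p) (p : SpaceTime) :
    dlagr J U F φ (v.variation φ) p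
      = -∑ k, v.w p k * momRes U F φ k p + (angRes J F φ p * v.eta p).trace
        + 2 * v.Xi p * scalRes J F φ p
        + φ.rho p * matD φ.u (noetherCharge J φ v) p
        + ∑ l, dx l (noetherFlux J U F φ v l) p := by
  have hδQ := contDiff_variation_Q hφ hw heta hXi
  have h1 := density_variation (J := J) hU hF hφ hw p
  have h2 := dkin_variation (J := J) hφ hw heta hXi p
  have h3 := freeEnergy_by_parts hF hφ.Q_smooth hδQ (variation_Q_symm hφ hskew) p
  have h4 := adv_rhoSq_derivU hU hF hφ v.w p
  have hflux (l : Fin 3) : dx l (noetherFlux J U F φ v l) p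
      = dx l (fun q => (pressure U F φ q - lagr J U F φ q) * v.w q l) p
        - dx l (fun q => ((dFdGrad F l (jet φ.Q q))ᵀ * (v.variation φ).Q q).trace) p := by
    have ha := ((contDiff_pressure hU hF hφ).sub (contDiff_lagr (J := J) hU hF hφ)).mul
      (contDiff_space_apply hw l)
    have hb := contDiff_trace ((contDiff_transpose
      ((contDiff_dFdGrad hF l).comp (contDiff_jet hφ.Q_smooth))).mul hδQ)
    have h := ((differentiable_of_smooth ha p).hasFDerivAt.sub
      (differentiable_of_smooth hb p).hasFDerivAt).fderiv
    exact congrArg (fun L => L ((0, EuclideanSpace.single l 1) : SpaceTime)) h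
  have hM : (molField F φ.Q p * (v.variation φ).Q p).trace
      = -(⁅molField F φ.Q p, φ.Q p⁆ * v.eta p).trace
        + 2 * v.Xi p * (molField F φ.Q p * φ.Q p).trace
        - (molField F φ.Q p * adv v.w φ.Q p).trace := by
    have hl : ⁅v.eta p, φ.Q p⁆ = -⁅φ.Q p, v.eta p⁆ := by
      simp only [Ring.lie_def, neg_sub]
    simp only [Generator.variation]
    rw [hl, mul_sub, mul_add, Matrix.trace_sub, Matrix.trace_add, mul_neg, Matrix.trace_neg,
      ← trace_lie_mul, Matrix.mul_smul, Matrix.trace_smul, smul_eq_mul]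
  have hin : inner ℝ (matD φ.u φ.u p) (v.w p) = ∑ k, v.w p k * matD φ.u φ.u p k := by
    simp [PiLp.inner_apply]
  have hmom : ∑ k, v.w p k * momRes U F φ k p
      = φ.rho p * ∑ k, v.w p k * matD φ.u φ.u p k
        + ∑ k, v.w p k * (dx k (pressure U F φ) p
          + ∑ l, dx l (fun q => ∑ i, ∑ j, dFdGrad F l (jet φ.Q q) i j * dx k φ.Q q i j) p) := by
    rw [Finset.mul_sum, ← Finset.sum_add_distrib]
    refine Finset.sum_congr rfl fun k _ => ?_
    rw [momRes]
    ring
  have hang : (angRes J F φ p * v.eta p).trace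
      = φ.rho p * J * (matD φ.u (fun q => ⁅⁅φ.nu q, φ.Q q⁆, φ.Q q⁆) p * v.eta p).trace
        - (⁅molField F φ.Q p, φ.Q p⁆ * v.eta p).trace := by
    rw [angRes, sub_mul, Matrix.trace_sub, Matrix.smul_mul, Matrix.trace_smul, smul_eq_mul]
  simp only [hflux, Finset.sum_sub_distrib]
  rw [dlagr, hmom, hang, scalRes, sub_eq_add_neg _ (fderiv ℝ F _ _), h3, hM, h1]
  rw [hin] at h2
  linear_combination φ.rho p * h2 - h4

/-- By the continuity equation `ρ Dₜ f` is a space-time divergence. -/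
theorem rho_mul_matD (hφ : φ.Kinematic) {f : SpaceTime → ℝ} (hf : ContDiff ℝ ∞ f)
    (p : SpaceTime) : φ.rho p * matD φ.u f p
      = dt (fun q => φ.rho q * f q) p + ∑ l, dx l (fun q => φ.rho q * f q * φ.u q l) p := by
  have h1 : ∑ l, dx l (fun q => φ.rho q * f q * φ.u q l) p
      = adv φ.u (fun q => φ.rho q * f q) p + φ.rho p * f p * divg φ.u p :=
    divg_smul (hφ.rho_smooth.mul hf) hφ.u_smooth p
  have h2 : matD φ.u (fun q => φ.rho q * f q) p = _ := (matD_eq_fderiv _ _ _).trans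
    (fderiv_realMul_dir (differentiable_of_smooth hφ.rho_smooth p)
      (differentiable_of_smooth hf p) _)
  have h3 := hφ.continuity p
  rw [ContinuityEq, matD_eq_fderiv] at h3
  rw [h1, matD_eq_fderiv]
  rw [h3] at h2
  rw [matD] at h2
  linear_combination -h2

end Variation

/-! ### Integration over a slab of space-time -/

section Integration

variable {t₁ t₂ : ℝ} {K : Set E3}

theorem measurableSet_slab (t₁ t₂ : ℝ) : MeasurableSet (slab t₁ t₂) :=
  measurableSet_Icc.prod MeasurableSet.univ

theorem isCompact_block (t₁ t₂ : ℝ) (hK : IsCompact K) : IsCompact (Set.Icc t₁ t₂ ×ˢ K) :=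
  isCompact_Icc.prod hK

theorem integrableOn_slab (hK : IsCompact K) {g : SpaceTime → ℝ} (hg : Continuous g)
    (h0 : ∀ t, ∀ x ∉ K, g (t, x) = 0) : IntegrableOn g (slab t₁ t₂) := by
  have h := (hg.continuousOn (s := Set.Icc t₁ t₂ ×ˢ K)).integrableOn_compact (μ := volume)
    (isCompact_block t₁ t₂ hK)
  refine h.of_forall_sdiff_eq_zero (measurableSet_slab t₁ t₂) fun p hp => h0 p.1 p.2 fun hx => ?_
  exact hp.2 ⟨hp.1.1, hx⟩

theorem setIntegral_slab_eq {g : SpaceTime → ℝ}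
    (h0 : ∀ t, ∀ x ∉ K, g (t, x) = 0) :
    ∫ p in slab t₁ t₂, g p = ∫ p in Set.Icc t₁ t₂ ×ˢ K, g p :=
  setIntegral_eq_of_subset_of_forall_sdiff_eq_zero (measurableSet_slab t₁ t₂)
    (Set.prod_mono le_rfl (Set.subset_univ K))
    fun p hp => h0 p.1 p.2 fun hx => hp.2 ⟨hp.1.1, hx⟩

/-- A field that vanishes outside `ℝ × K` has vanishing derivatives there. -/
theorem fderiv_eq_zero_off {V : Type*} [NormedAddCommGroup V] [NormedSpace ℝ V]
    (hK : IsCompact K) {f : SpaceTime → V} (h0 : ∀ t, ∀ x ∉ K, f (t, x) = 0) (t : ℝ) {x : E3}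
    (hx : x ∉ K) : fderiv ℝ f (t, x) = 0 := by
  have hopen : IsOpen {p : SpaceTime | p.2 ∉ K} := hK.isClosed.isOpen_compl.preimage continuous_snd
  have h : f =ᶠ[nhds (t, x)] fun _ => 0 :=
    Filter.eventually_of_mem (hopen.mem_nhds hx) fun p hp => h0 p.1 p.2 hp
  rw [h.fderiv_eq, fderiv_const_apply]

theorem integral_slab_dt (ht : t₁ ≤ t₂) (hK : IsCompact K) {g : SpaceTime → ℝ}
    (hg : ContDiff ℝ ∞ g) (h0 : ∀ t, ∀ x ∉ K, g (t, x) = 0)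
    (hend : ∀ t x, t = t₁ ∨ t = t₂ → g (t, x) = 0) : ∫ p in slab t₁ t₂, dt g p = 0 := by
  have hc := (contDiff_dt hg).continuous
  have hi : IntegrableOn (dt g) (slab t₁ t₂) := integrableOn_slab hK hc fun t x hx => by
    rw [dt, fderiv_eq_zero_off hK h0 t hx]; rfl
  rw [slab, Measure.volume_eq_prod] at hi ⊢
  rw [IntegrableOn, ← Measure.prod_restrict] at hi
  rw [← Measure.prod_restrict, integral_prod_symm _ hi]
  refine integral_eq_zero_of_ae (Filter.Eventually.of_forall fun x => ?_)
  have hder (s : ℝ) : HasDerivAt (fun s => g (s, x)) (dt g (s, x)) s :=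
    hasDerivAt_slice (differentiable_of_smooth hg) s x
  have hcx : Continuous fun s => dt g (s, x) := hc.comp (by fun_prop)
  have h := intervalIntegral.integral_eq_sub_of_hasDerivAt (a := t₁) (b := t₂)
    (fun s _ => hder s) (hcx.intervalIntegrable _ _)
  rw [hend t₂ x (Or.inr rfl), hend t₁ x (Or.inl rfl), sub_zero,
    intervalIntegral.integral_of_le ht, ← integral_Icc_eq_integral_Ioc] at h
  exact h

theorem integral_slab_dx (hK : IsCompact K) {g : SpaceTime → ℝ} (hg : ContDiff ℝ ∞ g)
    (h0 : ∀ t, ∀ x ∉ K, g (t, x) = 0) (l : Fin 3) : ∫ p in slab t₁ t₂, dx l g p = 0 := by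
  have hc := (contDiff_dx hg l).continuous
  have h0' (t : ℝ) (x : E3) (hx : x ∉ K) : dx l g (t, x) = 0 := by
    rw [dx, fderiv_eq_zero_off hK h0 t hx]; rfl
  have hi : IntegrableOn (dx l g) (slab t₁ t₂) := integrableOn_slab hK hc h0'
  rw [slab, Measure.volume_eq_prod] at hi ⊢
  rw [setIntegral_prod _ hi]
  refine integral_eq_zero_of_ae (Filter.Eventually.of_forall fun t => ?_)
  rw [Measure.restrict_univ]
  have hs : ContDiff ℝ ∞ fun x => g (t, x) := contDiff_slice hg t
  have hcs : HasCompactSupport fun x => g (t, x) := HasCompactSupport.intro hK (h0 t)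
  have hcs' : HasCompactSupport fun x => dx l g (t, x) := HasCompactSupport.intro hK (h0' t)
  have hcx : Continuous fun x => dx l g (t, x) := hc.comp (by fun_prop)
  have hline (x : E3) : HasLineDerivAt ℝ (fun x => g (t, x)) (dx l g (t, x)) x
      (EuclideanSpace.single l 1) := by
    have h := (differentiable_of_smooth hs x).hasFDerivAt.hasLineDerivAt
      (EuclideanSpace.single l (1 : ℝ))
    rwa [fderiv_slice (differentiable_of_smooth hg)] at h
  -- integration by parts against the constant `1`
  have h := integral_bilinear_hasLineDerivAt_right_eq_neg_left_of_integrable (μ := volume)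
    (B := ContinuousLinearMap.mul ℝ ℝ) (f := fun _ : E3 => (1 : ℝ)) (f' := fun _ => 0)
    (g := fun x => g (t, x)) (g' := fun x => dx l g (t, x)) (v := EuclideanSpace.single l 1)
    (by simp) (by simpa using hcx.integrable_of_hasCompactSupport hcs')
    (by simpa using hs.continuous.integrable_of_hasCompactSupport hcs)
    (fun x _ => (hasFDerivAt_const (1 : ℝ) x).hasLineDerivAt _) (fun x _ => hline x)
  simpa using h

/-- Differentiation under an integral over a compact set. -/
theorem hasDerivAt_integral_compact {P : Type*} [NormedAddCommGroup P] [NormedSpace ℝ P]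
    [MeasurableSpace P] [BorelSpace P] {μ : Measure P}
    [IsFiniteMeasureOnCompacts μ] {G : ℝ × P → ℝ} {Ω : Set (ℝ × P)} (hΩ : IsOpen Ω)
    (hG : ContDiffOn ℝ 1 G Ω) {C : Set P} (hC : IsCompact C) (h0 : ∀ p ∈ C, (0, p) ∈ Ω) :
    HasDerivAt (fun ε => ∫ p in C, G (ε, p) ∂μ) (∫ p in C, fderiv ℝ G (0, p) (1, 0) ∂μ) 0 := by
  -- the tube lemma gives a uniform range of parameters, on which the derivative is bounded
  obtain ⟨u, v, hu, -, h0u, hCv, huv⟩ := generalized_tube_lemma (isCompact_singleton (x := (0 : ℝ)))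
    hC hΩ (by rintro ⟨ε, p⟩ ⟨rfl, hp⟩; exact h0 p hp)
  obtain ⟨δ, hδ, hδu⟩ := Metric.nhds_basis_closedBall.mem_iff.1
    (hu.mem_nhds (h0u (Set.mem_singleton 0)))
  have hsub : Metric.closedBall (0 : ℝ) δ ×ˢ C ⊆ Ω := (Set.prod_mono hδu hCv).trans huv
  have hD : ContinuousOn (fun z => fderiv ℝ G z (1, 0)) Ω :=
    (hG.continuousOn_fderiv_of_isOpen hΩ le_rfl).clm_apply continuousOn_const
  obtain ⟨M, hM⟩ := ((isCompact_closedBall (0 : ℝ) δ).prod hC).exists_bound_of_continuousOn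
    (hD.mono hsub)
  have hslice {f : ℝ × P → ℝ} (hf : ContinuousOn f Ω) {ε : ℝ}
      (hε : ε ∈ Metric.closedBall (0 : ℝ) δ) : ContinuousOn (fun p => f (ε, p)) C :=
    hf.comp (by fun_prop) fun p hp => hsub ⟨hε, hp⟩
  have hz : (0 : ℝ) ∈ Metric.closedBall (0 : ℝ) δ := Metric.mem_closedBall_self hδ.le
  refine (hasDerivAt_integral_of_dominated_loc_of_deriv_le (bound := fun _ => M)
    (F' := fun ε p => fderiv ℝ G (ε, p) (1, 0)) (Metric.ball_mem_nhds (0 : ℝ) hδ) ?_ ?_ ?_ ?_ ?_ ?_).2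
  · filter_upwards [Metric.ball_mem_nhds (0 : ℝ) hδ] with ε hε
    exact (hslice hG.continuousOn (Metric.ball_subset_closedBall hε)).aestronglyMeasurable_of_isCompact
      hC hC.measurableSet
  · exact (hslice hG.continuousOn hz).integrableOn_compact hC
  · exact (hslice hD hz).aestronglyMeasurable_of_isCompact hC hC.measurableSet
  · filter_upwards [ae_restrict_mem hC.measurableSet] with p hp ε hε
    exact hM (ε, p) ⟨Metric.ball_subset_closedBall hε, hp⟩
  · exact integrableOn_const hC.measure_lt_top.ne
  · filter_upwards [ae_restrict_mem hC.measurableSet] with p hp ε hε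
    have hd : DifferentiableAt ℝ G (ε, p) :=
      ((hG _ (hsub ⟨Metric.ball_subset_closedBall hε, hp⟩)).contDiffAt (hΩ.mem_nhds
        (hsub ⟨Metric.ball_subset_closedBall hε, hp⟩))).differentiableAt (by simp)
    exact hasDerivAt_slice_of_differentiableAt hd

/-- The fundamental lemma of the calculus of variations on a slab. -/
theorem eq_zero_of_integral_test (ht : t₁ < t₂) {f : SpaceTime → ℝ} (hf : Continuous f)
    (h : ∀ g : SpaceTime → ℝ, ContDiff ℝ ∞ g → HasCompactSupport g →
      tsupport g ⊆ Set.Ioo t₁ t₂ ×ˢ Set.univ → ∫ p in slab t₁ t₂, g p * f p = 0) :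
    ∀ p ∈ slab t₁ t₂, f p = 0 := by
  have hopen : IsOpen (Set.Ioo t₁ t₂ ×ˢ (Set.univ : Set E3)) := isOpen_Ioo.prod isOpen_univ
  have h1 := hopen.ae_eq_zero_of_integral_contDiff_smul_eq_zero (μ := volume)
    (hf.locallyIntegrable.locallyIntegrableOn _) fun g hg hgc hgs => by
      rw [← h g hg hgc hgs]
      refine (setIntegral_eq_integral_of_forall_compl_eq_zero fun p hp => ?_).symm
      have : g p = 0 := by
        by_contra hne
        have hp' := hgs (subset_tsupport g hne)
        exact hp ⟨Set.Ioo_subset_Icc_self hp'.1, trivial⟩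
      simp [this]
  have : (volume : Measure SpaceTime).IsOpenPosMeasure := by
    rw [Measure.volume_eq_prod]; infer_instance
  have h2 : f =ᵐ[volume.restrict (Set.Ioo t₁ t₂ ×ˢ (Set.univ : Set E3))] fun _ => 0 :=
    (ae_restrict_iff' hopen.measurableSet).2 h1
  have h3 := Measure.eqOn_open_of_ae_eq h2 hopen hf.continuousOn continuousOn_const
  -- test functions see the interior of the slab only; continuity extends to the end times
  have h4 : Set.EqOn f (fun _ => 0) (closure (Set.Ioo t₁ t₂ ×ˢ (Set.univ : Set E3))) :=
    h3.closure hf continuous_const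
  rw [closure_prod_eq, closure_Ioo ht.ne, closure_univ] at h4
  exact h4

end Integration

/-! ### The first variation of the action -/

section Action

variable {J : ℝ} {U : ℝ → ℝ} {F : Mat3 × (Fin 3 → Mat3) → ℝ} {φ : Fields} {v : Generator}
  {t₁ t₂ : ℝ} {K : Set E3}

theorem contDiff_variation_rho (hφ : φ.Kinematic) (hw : ContDiff ℝ ∞ v.w) :
    ContDiff ℝ ∞ (v.variation φ).rho :=
  (contDiff_divg (hφ.rho_smooth.smul hw)).neg

theorem contDiff_variation_u (hφ : φ.Kinematic) (hw : ContDiff ℝ ∞ v.w) :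
    ContDiff ℝ ∞ (v.variation φ).u :=
  ((contDiff_dt hw).add (contDiff_adv hw hφ.u_smooth)).sub (contDiff_adv hφ.u_smooth hw)

theorem contDiff_variation_nu (hφ : φ.Kinematic) (hw : ContDiff ℝ ∞ v.w)
    (heta : ContDiff ℝ ∞ v.eta) : ContDiff ℝ ∞ (v.variation φ).nu := by
  have h := contDiff_lie heta hφ.nu_smooth
  exact (((contDiff_dt heta).sub (contDiff_adv hφ.nu_smooth hw)).add
    (contDiff_adv heta hφ.u_smooth)).add h

theorem contDiff_variation_Lam (hφ : φ.Kinematic) (hw : ContDiff ℝ ∞ v.w)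
    (hXi : ContDiff ℝ ∞ v.Xi) : ContDiff ℝ ∞ (v.variation φ).Lam :=
  ((contDiff_dt hXi).sub (contDiff_adv hφ.Lam_smooth hw)).add (contDiff_adv hXi hφ.u_smooth)

/-- Joint smoothness of the perturbed Lagrangian, as long as the perturbed density is positive. -/
theorem contDiffOn_lagr_perturb (hU : ContDiffOn ℝ ∞ U (Set.Ioi 0)) (hF : ContDiff ℝ ∞ F)
    (hφ : φ.Kinematic) (hv : v.Admissible t₁ t₂) :
    ContDiffOn ℝ ∞ (fun z : ℝ × SpaceTime => lagr J U F (φ.perturb (v.variation φ) z.1) z.2)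
      {z | 0 < φ.rho z.2 + z.1 * (v.variation φ).rho z.2} := by
  have hlin {V : Type} [NormedAddCommGroup V] [NormedSpace ℝ V] {a b : SpaceTime → V}
      (ha : ContDiff ℝ ∞ a) (hb : ContDiff ℝ ∞ b) :
      ContDiff ℝ ∞ fun z : ℝ × SpaceTime => a z.2 + z.1 • b z.2 :=
    (ha.comp contDiff_snd).add (contDiff_fst.smul (hb.comp contDiff_snd))
  have hQ := contDiff_variation_Q hφ hv.w_smooth hv.eta_smooth hv.Xi_smooth
  have hr := hlin hφ.rho_smooth (contDiff_variation_rho hφ hv.w_smooth)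
  have hu := hlin hφ.u_smooth (contDiff_variation_u hφ hv.w_smooth)
  have hn := hlin hφ.nu_smooth (contDiff_variation_nu hφ hv.w_smooth hv.eta_smooth)
  have hL := hlin hφ.Lam_smooth (contDiff_variation_Lam hφ hv.w_smooth hv.Xi_smooth)
  have hQ' := hlin hφ.Q_smooth hQ
  -- the jet of a perturbed field is affine in the parameter
  have hj := hF.comp (hlin (contDiff_jet hφ.Q_smooth) (contDiff_jet hQ))
  have hkin := ((contDiff_const (c := (1 / 2 : ℝ)).mul (hu.norm_sq ℝ)).add
    (contDiff_const (c := J / 2).mul (contDiff_frobenius_sq (contDiff_lie hn hQ')))).add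
    ((contDiff_const (c := 2 * J).mul (hL.pow 2)).mul (contDiff_frobenius_sq hQ'))
  have hUr := hU.comp
    (s := {z : ℝ × SpaceTime | 0 < φ.rho z.2 + z.1 * (v.variation φ).rho z.2}) hr.contDiffOn
    fun z hz => hz
  refine (((hr.mul hkin).contDiffOn.sub (hr.contDiffOn.mul hUr)).sub hj.contDiffOn).congr ?_
  intro z _
  rw [lagr_eq]
  exact congrArg (fun a => _ - F a) (jet_add_smul (differentiable_of_smooth hφ.Q_smooth z.2)
    (differentiable_of_smooth hQ z.2) z.1)

/-- Outside of the support of the generators all fields are unperturbed. -/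
theorem lagr_perturb_off (hφ : φ.Kinematic) (hv : v.Admissible t₁ t₂) (hK : IsCompact K)
    (hs : ∀ t, ∀ x ∉ K, v.w (t, x) = 0 ∧ v.eta (t, x) = 0 ∧ v.Xi (t, x) = 0) (ε t : ℝ) {x : E3}
    (hx : x ∉ K) : lagr J U F (φ.perturb (v.variation φ) ε) (t, x) = lagr J U F φ (t, x) := by
  have hw := fderiv_eq_zero_off hK (fun t x hx => (hs t x hx).1) t hx
  have heta := fderiv_eq_zero_off hK (fun t x hx => (hs t x hx).2.1) t hx
  have hXi := fderiv_eq_zero_off hK (fun t x hx => (hs t x hx).2.2) t hx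
  obtain ⟨hw0, heta0, hXi0⟩ := hs t x hx
  have hρ : (v.variation φ).rho (t, x) = 0 := by
    have h : (v.variation φ).rho (t, x) = -(adv v.w φ.rho (t, x) + φ.rho (t, x) * divg v.w (t, x)) := by
      rw [← divg_smul hφ.rho_smooth hv.w_smooth]
      rfl
    rw [h, divg_eq_sum hv.w_smooth]
    simp [adv, dx, hw, hw0]
  have hu : (v.variation φ).u (t, x) = 0 := by
    simp [Generator.variation, dt, adv, dx, hw, hw0]
  have hn : (v.variation φ).nu (t, x) = 0 := by
    simp [Generator.variation, dt, adv, dx, heta, heta0, hw0, Ring.lie_def]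
  have hL : (v.variation φ).Lam (t, x) = 0 := by
    simp [Generator.variation, dt, adv, dx, hXi, hw0]
  have hQ (t : ℝ) (x : E3) (hx : x ∉ K) : (v.variation φ).Q (t, x) = 0 := by
    obtain ⟨hw0, heta0, hXi0⟩ := hs t x hx
    simp [Generator.variation, adv, heta0, hw0, hXi0, Ring.lie_def]
  have hj : jet (v.variation φ).Q (t, x) = 0 := by
    refine Prod.ext (hQ t x hx) (funext fun l => ?_)
    simp only [jet, dx, fderiv_eq_zero_off hK hQ t hx]
    rfl
  rw [lagr_eq, lagr_eq]
  simp only [Fields.perturb, Pi.add_apply, Pi.smul_apply, hρ, hu, hn, hL, hQ t x hx, smul_zero,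
    add_zero]
  rw [jet_add_smul (differentiable_of_smooth hφ.Q_smooth _) (differentiable_of_smooth
    (contDiff_variation_Q hφ hv.w_smooth hv.eta_smooth hv.Xi_smooth) _), hj, smul_zero, add_zero]

/-- The action is differentiable in the direction of an admissible variation, and the derivative
may be taken under the integral sign. -/
theorem hasFirstVariation_dlagr (hU : ContDiffOn ℝ ∞ U (Set.Ioi 0)) (hF : ContDiff ℝ ∞ F)
    (hφ : φ.Kinematic) (hv : v.Admissible t₁ t₂) :
    HasFirstVariation J U F t₁ t₂ φ (v.variation φ)
      (∫ p in slab t₁ t₂, dlagr J U F φ (v.variation φ) p) := by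
  obtain ⟨K, hK, hs⟩ := hv.support
  have hQ := contDiff_variation_Q hφ hv.w_smooth hv.eta_smooth hv.Xi_smooth
  set Ω : Set (ℝ × SpaceTime) := {z | 0 < φ.rho z.2 + z.1 * (v.variation φ).rho z.2}
  have hΩ : IsOpen Ω := by
    have h1 := (hφ.rho_smooth.comp (contDiff_snd (E := ℝ))).continuous
    have h2 := ((contDiff_variation_rho hφ hv.w_smooth).comp (contDiff_snd (E := ℝ))).continuous
    exact isOpen_lt continuous_const (h1.add (continuous_fst.mul h2))
  have hΩ0 (p : SpaceTime) : ((0 : ℝ), p) ∈ Ω := by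
    change 0 < φ.rho p + 0 * _
    rw [zero_mul, add_zero]
    exact hφ.rho_pos p
  set G : ℝ × SpaceTime → ℝ := fun z =>
    lagr J U F (φ.perturb (v.variation φ) z.1) z.2 - lagr J U F φ z.2
  have hG : ContDiffOn ℝ 1 G Ω :=
    ((contDiffOn_lagr_perturb hU hF hφ hv).sub
      ((contDiff_lagr hU hF hφ).comp contDiff_snd).contDiffOn).of_le (by simp)
  have h := hasDerivAt_integral_compact (μ := volume) hΩ hG (isCompact_block t₁ t₂ hK)
    fun p _ => hΩ0 p
  have hder (p : SpaceTime) : fderiv ℝ G (0, p) (1, 0) = dlagr J U F φ (v.variation φ) p := by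
    have hd : DifferentiableAt ℝ G (0, p) :=
      ((hG _ (hΩ0 p)).contDiffAt (hΩ.mem_nhds (hΩ0 p))).differentiableAt (by simp)
    have h1 : HasDerivAt (fun ε => G (ε, p)) (fderiv ℝ G (0, p) (1, 0)) 0 :=
      hasDerivAt_slice_of_differentiableAt hd
    have h2 : HasDerivAt (fun ε => G (ε, p)) (dlagr J U F φ (v.variation φ) p) 0 :=
      (hasDerivAt_lagr (J := J) hU hF (hφ.rho_pos p) (differentiable_of_smooth hφ.Q_smooth p)
        (differentiable_of_smooth hQ p)).sub_const (lagr J U F φ p)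
    exact h1.unique h2
  have hG0 (ε t : ℝ) (x : E3) (hx : x ∉ K) : G (ε, (t, x)) = 0 :=
    sub_eq_zero.2 (lagr_perturb_off hφ hv hK hs ε t hx)
  have hd0 (t : ℝ) (x : E3) (hx : x ∉ K) : dlagr J U F φ (v.variation φ) (t, x) = 0 := by
    have h2 := (hasDerivAt_lagr (J := J) hU hF (hφ.rho_pos (t, x))
      (differentiable_of_smooth hφ.Q_smooth _) (differentiable_of_smooth hQ _)).sub_const
      (lagr J U F φ (t, x))
    have h3 : (fun ε => lagr J U F (φ.perturb (v.variation φ) ε) (t, x) - lagr J U F φ (t, x))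
        = fun _ => 0 := funext fun ε => hG0 ε t x hx
    rw [h3] at h2
    exact h2.unique (hasDerivAt_const _ _)
  rw [HasFirstVariation, setIntegral_slab_eq hd0]
  simp only [hder] at h
  refine h.congr_of_eventuallyEq (Filter.Eventually.of_forall fun ε => ?_)
  exact setIntegral_slab_eq (hG0 ε)

/-- The integrand that pairs the generators with the residuals of the equations of motion. -/
noncomputable def residualPairing (J : ℝ) (U : ℝ → ℝ) (F : Mat3 × (Fin 3 → Mat3) → ℝ)
    (φ : Fields) (v : Generator) (p : SpaceTime) : ℝ :=
  -∑ k, v.w p k * momRes U F φ k p + (angRes J F φ p * v.eta p).trace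
    + 2 * v.Xi p * scalRes J F φ p

theorem contDiff_momRes (hU : ContDiffOn ℝ ∞ U (Set.Ioi 0)) (hF : ContDiff ℝ ∞ F)
    (hφ : φ.Kinematic) (k : Fin 3) : ContDiff ℝ ∞ (momRes U F φ k) := by
  have h1 := contDiff_space_apply (contDiff_matD hφ.u_smooth hφ.u_smooth) k
  have h2 (l : Fin 3) : ContDiff ℝ ∞ fun q =>
      ∑ i, ∑ j, dFdGrad F l (jet φ.Q q) i j * dx k φ.Q q i j :=
    ContDiff.sum fun i _ => ContDiff.sum fun j _ =>
      (contDiff_entry ((contDiff_dFdGrad hF l).comp (contDiff_jet hφ.Q_smooth)) i j).mul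
        (contDiff_entry (contDiff_dx hφ.Q_smooth k) i j)
  exact ((hφ.rho_smooth.mul h1).add (contDiff_dx (contDiff_pressure hU hF hφ) k)).add
    (ContDiff.sum fun l _ => contDiff_dx (h2 l) l)

theorem contDiff_angRes (hF : ContDiff ℝ ∞ F) (hφ : φ.Kinematic) :
    ContDiff ℝ ∞ (angRes J F φ) := by
  have h := contDiff_lie (contDiff_molField hF hφ.Q_smooth) hφ.Q_smooth
  exact ((hφ.rho_smooth.mul contDiff_const).smul (contDiff_matD hφ.N_smooth hφ.u_smooth)).sub h

theorem contDiff_scalRes (hF : ContDiff ℝ ∞ F) (hφ : φ.Kinematic) :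
    ContDiff ℝ ∞ (scalRes J F φ) :=
  (((hφ.rho_smooth.mul contDiff_const).mul (contDiff_frobenius_sq hφ.S_smooth)).add
    (contDiff_trace ((contDiff_molField hF hφ.Q_smooth).mul hφ.Q_smooth))).sub
    ((((contDiff_const.mul hφ.rho_smooth).mul contDiff_const).mul hφ.normQ_smooth).mul
      ((contDiff_matD hφ.Lam_smooth hφ.u_smooth).add
        (contDiff_const.mul (hφ.Lam_smooth.pow 2))))

theorem angRes_skew (hφ : φ.Kinematic) (p : SpaceTime) :
    (angRes J F φ p)ᵀ = -angRes J F φ p := by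
  have h := fderiv_skew_dir (fun q => transpose_lie_of_symm_symm (hφ.S_symm q) (hφ.Q_symm q))
    (differentiable_of_smooth hφ.N_smooth p) (1, φ.u p)
  rw [angRes, Matrix.transpose_sub, Matrix.transpose_smul, matD_eq_fderiv_mat, h,
    transpose_lie_of_symm_symm (molField_symm F φ.Q p) (hφ.Q_symm p), smul_neg]
  abel

theorem continuous_residualPairing (hU : ContDiffOn ℝ ∞ U (Set.Ioi 0)) (hF : ContDiff ℝ ∞ F)
    (hφ : φ.Kinematic) (hv : v.Admissible t₁ t₂) : Continuous (residualPairing J U F φ v) :=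
  (((ContDiff.sum fun k _ => (contDiff_space_apply hv.w_smooth k).mul
    (contDiff_momRes hU hF hφ k)).neg.add
    (contDiff_trace ((contDiff_angRes hF hφ).mul hv.eta_smooth))).add
    ((contDiff_const.mul hv.Xi_smooth).mul (contDiff_scalRes hF hφ))).continuous

/-- The first variation of the action, after integration by parts. -/
theorem integral_dlagr (ht : t₁ < t₂) (hU : ContDiffOn ℝ ∞ U (Set.Ioi 0)) (hF : ContDiff ℝ ∞ F)
    (hφ : φ.Kinematic) (hv : v.Admissible t₁ t₂) :
    ∫ p in slab t₁ t₂, dlagr J U F φ (v.variation φ) p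
      = ∫ p in slab t₁ t₂, residualPairing J U F φ v p := by
  obtain ⟨K, hK, hs⟩ := hv.support
  have hN : ContDiff ℝ ∞ (noetherCharge J φ v) :=
    contDiff_noetherCharge hφ hv.w_smooth hv.eta_smooth hv.Xi_smooth
  have hN0 (t : ℝ) (x : E3) (h : v.w (t, x) = 0 ∧ v.eta (t, x) = 0 ∧ v.Xi (t, x) = 0) :
      noetherCharge J φ v (t, x) = 0 := by
    simp [noetherCharge, h]
  set f : SpaceTime → ℝ := fun q => φ.rho q * noetherCharge J φ v q
  have hf : ContDiff ℝ ∞ f := hφ.rho_smooth.mul hN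
  set V : Fin 3 → SpaceTime → ℝ := fun l q =>
    φ.rho q * noetherCharge J φ v q * φ.u q l + noetherFlux J U F φ v l q
  have hflux (l : Fin 3) : ContDiff ℝ ∞ (noetherFlux J U F φ v l) := by
    have ha := ((contDiff_pressure hU hF hφ).sub (contDiff_lagr (J := J) hU hF hφ)).mul
      (contDiff_space_apply hv.w_smooth l)
    have hb := contDiff_trace ((contDiff_transpose
      ((contDiff_dFdGrad hF l).comp (contDiff_jet hφ.Q_smooth))).mul
      (contDiff_variation_Q hφ hv.w_smooth hv.eta_smooth hv.Xi_smooth))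
    exact ha.sub hb
  have hfu (l : Fin 3) : ContDiff ℝ ∞ fun q => φ.rho q * noetherCharge J φ v q * φ.u q l :=
    hf.mul (contDiff_space_apply hφ.u_smooth l)
  have hV (l : Fin 3) : ContDiff ℝ ∞ (V l) := (hfu l).add (hflux l)
  have hf0 (t : ℝ) (x : E3) (hx : x ∉ K) : f (t, x) = 0 := by
    simp [f, hN0 t x (hs t x hx)]
  have hV0 (l : Fin 3) (t : ℝ) (x : E3) (hx : x ∉ K) : V l (t, x) = 0 := by
    have hQ : (v.variation φ).Q (t, x) = 0 := by
      obtain ⟨hw0, heta0, hXi0⟩ := hs t x hx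
      simp [Generator.variation, adv, heta0, hw0, hXi0, Ring.lie_def]
    simp [V, noetherFlux, hN0 t x (hs t x hx), hQ, (hs t x hx).1]
  have hR0 (t : ℝ) (x : E3) (hx : x ∉ K) : residualPairing J U F φ v (t, x) = 0 := by
    simp [residualPairing, hs t x hx]
  have key (p : SpaceTime) : dlagr J U F φ (v.variation φ) p
      = residualPairing J U F φ v p + (dt f p + ∑ l, dx l (V l) p) := by
    have hsum (l : Fin 3) : dx l (V l) p = dx l (fun q => φ.rho q * noetherCharge J φ v q * φ.u q l) p
        + dx l (noetherFlux J U F φ v l) p :=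
      fderiv_add_dir (differentiable_of_smooth (hfu l) p) (differentiable_of_smooth (hflux l) p) _
    rw [dlagr_variation hU hF hφ hv.w_smooth hv.eta_smooth hv.Xi_smooth hv.eta_skew,
      rho_mul_matD hφ hN, residualPairing]
    simp only [hsum, Finset.sum_add_distrib]
    ring
  have i1 : IntegrableOn (residualPairing J U F φ v) (slab t₁ t₂) :=
    integrableOn_slab hK (continuous_residualPairing hU hF hφ hv) hR0
  have i2 : IntegrableOn (dt f) (slab t₁ t₂) :=
    integrableOn_slab hK (contDiff_dt hf).continuous fun t x hx => by
      rw [dt, fderiv_eq_zero_off hK hf0 t hx]; rfl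
  have i3 (l : Fin 3) : IntegrableOn (dx l (V l)) (slab t₁ t₂) :=
    integrableOn_slab hK (contDiff_dx (hV l) l).continuous fun t x hx => by
      rw [dx, fderiv_eq_zero_off hK (hV0 l) t hx]; rfl
  have i4 : IntegrableOn (fun p => ∑ l, dx l (V l) p) (slab t₁ t₂) :=
    integrable_finsetSum _ fun l _ => i3 l
  have i5 : IntegrableOn (fun p => dt f p + ∑ l, dx l (V l) p) (slab t₁ t₂) := i2.add i4
  simp only [key]
  rw [integral_add i1 i5, integral_add i2 i4, integral_finsetSum _ fun l _ => i3 l,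
    integral_slab_dt ht.le hK hf hf0 fun t x h => by simp [f, hN0 t x (hv.endpoints t x h)]]
  simp only [integral_slab_dx hK (hV _) (hV0 _), Finset.sum_const_zero, add_zero]

/-- The value of the first variation of the action is the pairing of the generators with the
residuals. -/
theorem hasFirstVariation_iff (ht : t₁ < t₂) (hU : ContDiffOn ℝ ∞ U (Set.Ioi 0))
    (hF : ContDiff ℝ ∞ F) (hφ : φ.Kinematic) (hv : v.Admissible t₁ t₂) (c : ℝ) :
    HasFirstVariation J U F t₁ t₂ φ (v.variation φ) c ↔
      ∫ p in slab t₁ t₂, residualPairing J U F φ v p = c := by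
  have h := hasFirstVariation_dlagr (J := J) hU hF hφ hv
  rw [integral_dlagr ht hU hF hφ hv] at h
  exact ⟨fun h' => h.unique h', fun e => e ▸ h⟩

end Action

/-! ### The Euler-Lagrange equations -/

section EulerLagrange

variable {J : ℝ} {U : ℝ → ℝ} {F : Mat3 × (Fin 3 → Mat3) → ℝ} {φ : Fields} {t₁ t₂ : ℝ}

/-- Continuous coefficients that pair to zero with all admissible generators vanish. -/
theorem coefficients_eq_zero (ht : t₁ < t₂) {a : Fin 3 → SpaceTime → ℝ} {b : SpaceTime → Mat3}
    {c : SpaceTime → ℝ} (ha : ∀ k, Continuous (a k)) (hb : Continuous b) (hc : Continuous c)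
    (hskew : ∀ p, (b p)ᵀ = -b p)
    (h : ∀ v : Generator, v.Admissible t₁ t₂ →
      ∫ p in slab t₁ t₂, (-∑ k, v.w p k * a k p + (b p * v.eta p).trace + 2 * v.Xi p * c p) = 0) :
    ∀ p ∈ slab t₁ t₂, (∀ k, a k p = 0) ∧ b p = 0 ∧ c p = 0 := by
  have hzero {g : SpaceTime → ℝ} (hs : tsupport g ⊆ Set.Ioo t₁ t₂ ×ˢ Set.univ) (t : ℝ) (x : E3)
      (hte : t = t₁ ∨ t = t₂) : g (t, x) = 0 := by
    by_contra hne
    have hp := (hs (subset_tsupport g hne)).1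
    rcases hte with rfl | rfl
    · exact lt_irrefl _ hp.1
    · exact lt_irrefl _ hp.2
  have hoff (g : SpaceTime → ℝ) (t : ℝ) (x : E3) (hx : x ∉ Prod.snd '' tsupport g) :
      g (t, x) = 0 := by
    by_contra hne
    exact hx ⟨(t, x), subset_tsupport g hne, rfl⟩
  -- a test function times constant directions is an admissible generator
  have hadm {g : SpaceTime → ℝ} (hg : ContDiff ℝ ∞ g) (hgc : HasCompactSupport g)
      (hs : tsupport g ⊆ Set.Ioo t₁ t₂ ×ˢ Set.univ) (w₀ : E3) {η₀ : Mat3} (hη : η₀ᵀ = -η₀) (ξ₀ : ℝ) :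
      Generator.Admissible t₁ t₂ ⟨fun p => g p • w₀, fun p => g p • η₀, fun p => g p * ξ₀⟩ :=
    { w_smooth := hg.smul contDiff_const
      eta_smooth := hg.smul contDiff_const
      Xi_smooth := hg.mul contDiff_const
      eta_skew := fun p => by simp [hη]
      endpoints := fun t x hte => by simp [hzero hs t x hte]
      support := ⟨Prod.snd '' tsupport g, hgc.isCompact.image continuous_snd,
        fun t x hx => by simp [hoff g t x hx]⟩ }
  -- `w = -g e_k` isolates `a k`
  have hA (k : Fin 3) : ∀ p ∈ slab t₁ t₂, a k p = 0 := by
    refine eq_zero_of_integral_test ht (ha k) fun g hg hgc hs => ?_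
    have := h _ (hadm hg hgc hs (-EuclideanSpace.single k 1) (η₀ := 0) (by simp) 0)
    rw [← this]
    refine integral_congr_ae (Filter.Eventually.of_forall fun p => ?_)
    simp
  -- `Ξ = g / 2` isolates `c`
  have hC : ∀ p ∈ slab t₁ t₂, c p = 0 := by
    refine eq_zero_of_integral_test ht hc fun g hg hgc hs => ?_
    have := h _ (hadm hg hgc hs 0 (η₀ := 0) (by simp) (1 / 2))
    rw [← this]
    refine integral_congr_ae (Filter.Eventually.of_forall fun p => ?_)
    simp only [smul_zero, PiLp.zero_apply, zero_mul, Finset.sum_const_zero, neg_zero, mul_zero,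
      Matrix.trace_zero, zero_add]
    ring
  -- `η̂ = (g / 2) (E_ij - E_ji)` isolates `(b_ji - b_ij) / 2`, which is `b_ji` as `b` is skew
  have hB (i j : Fin 3) : ∀ p ∈ slab t₁ t₂, b p j i = 0 := by
    refine eq_zero_of_integral_test ht ((entryL j i).continuous.comp hb) fun g hg hgc hs => ?_
    have := h _ (hadm hg hgc hs 0
      (η₀ := (1 / 2 : ℝ) • (Matrix.single i j 1 - Matrix.single j i 1)) (by
        rw [Matrix.transpose_smul, Matrix.transpose_sub, Matrix.transpose_single,
          Matrix.transpose_single, ← smul_neg, neg_sub]) 0)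
    rw [← this]
    refine integral_congr_ae (Filter.Eventually.of_forall fun p => ?_)
    have hbs : b p i j = -b p j i := congrFun (congrFun (hskew p) j) i
    simp only [smul_zero, PiLp.zero_apply, zero_mul, Finset.sum_const_zero, neg_zero, mul_zero,
      add_zero, zero_add, Matrix.mul_smul, Matrix.trace_smul, mul_sub, Matrix.trace_sub,
      Matrix.trace_mul_single, MulOpposite.op_one, one_smul, hbs, smul_eq_mul]
    ring
  intro p hp
  exact ⟨fun k => hA k p hp, Matrix.ext fun i j => hB j i p hp, hC p hp⟩

/-- The dissipative principle in terms of the residuals. -/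
theorem dissipativePrinciple_iff (ht : t₁ < t₂) (hU : ContDiffOn ℝ ∞ U (Set.Ioi 0))
    (hF : ContDiff ℝ ∞ F) (hφ : φ.Kinematic) {A : SpaceTime → E3} {B : SpaceTime → Mat3}
    (hA : Continuous A) (hB : Continuous B) (hBs : ∀ p, (B p)ᵀ = B p) :
    DissipativePrinciple J U F t₁ t₂ φ A B ↔ ∀ p ∈ slab t₁ t₂,
      (∀ k, momRes U F φ k p + A p k = 0) ∧ angRes J F φ p + ⁅B p, φ.Q p⁆ = 0 ∧
        scalRes J F φ p - (B p * φ.Q p).trace = 0 := by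
  have hBQ : Continuous fun p => ⁅B p, φ.Q p⁆ := by
    simp only [Ring.lie_def]
    exact (hB.mul hφ.Q_smooth.continuous).sub (hφ.Q_smooth.continuous.mul hB)
  have hAk (k : Fin 3) : Continuous fun p => A p k := by fun_prop
  have htr : Continuous fun p => (B p * φ.Q p).trace :=
    traceL.continuous.comp (hB.mul hφ.Q_smooth.continuous)
  have hforce (v : Generator) (p : SpaceTime) : inner ℝ (A p) (v.w p)
      + (B p * (⁅v.eta p, φ.Q p⁆ + (2 * v.Xi p) • φ.Q p)).trace
      = ∑ k, v.w p k * A p k - (⁅B p, φ.Q p⁆ * v.eta p).trace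
        + 2 * v.Xi p * (B p * φ.Q p).trace := by
    have hl : ⁅v.eta p, φ.Q p⁆ = -⁅φ.Q p, v.eta p⁆ := by simp only [Ring.lie_def, neg_sub]
    have hin : inner ℝ (A p) (v.w p) = ∑ k, v.w p k * A p k := by simp [PiLp.inner_apply]
    rw [hin, hl, mul_add, Matrix.trace_add, mul_neg, Matrix.trace_neg, ← trace_lie_mul,
      Matrix.mul_smul, Matrix.trace_smul, smul_eq_mul]
    ring
  have hpair (v : Generator) (hv : v.Admissible t₁ t₂) :
      HasFirstVariation J U F t₁ t₂ φ (v.variation φ) (∫ p in slab t₁ t₂, (inner ℝ (A p) (v.w p)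
        + (B p * (⁅v.eta p, φ.Q p⁆ + (2 * v.Xi p) • φ.Q p)).trace)) ↔
      ∫ p in slab t₁ t₂, (-∑ k, v.w p k * (momRes U F φ k p + A p k)
        + ((angRes J F φ p + ⁅B p, φ.Q p⁆) * v.eta p).trace
        + 2 * v.Xi p * (scalRes J F φ p - (B p * φ.Q p).trace)) = 0 := by
    obtain ⟨K, hK, hs⟩ := hv.support
    rw [hasFirstVariation_iff ht hU hF hφ hv, ← sub_eq_zero]
    simp only [hforce]
    have hw := hv.w_smooth.continuous
    have hwk (k : Fin 3) : Continuous fun p => v.w p k := by fun_prop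
    have i1 : IntegrableOn (residualPairing J U F φ v) (slab t₁ t₂) :=
      integrableOn_slab hK (continuous_residualPairing hU hF hφ hv) fun t x hx => by
        simp [residualPairing, hs t x hx]
    have i2 : IntegrableOn (fun p => ∑ k, v.w p k * A p k - (⁅B p, φ.Q p⁆ * v.eta p).trace
        + 2 * v.Xi p * (B p * φ.Q p).trace) (slab t₁ t₂) := by
      refine integrableOn_slab hK ?_ fun t x hx => by simp [hs t x hx]
      exact ((continuous_finsetSum _ fun k _ => (hwk k).mul (hAk k)).sub
        (traceL.continuous.comp (hBQ.mul hv.eta_smooth.continuous))).add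
        ((continuous_const.mul hv.Xi_smooth.continuous).mul htr)
    rw [← integral_sub i1 i2]
    have e (p : SpaceTime) : residualPairing J U F φ v p
        - (∑ k, v.w p k * A p k - (⁅B p, φ.Q p⁆ * v.eta p).trace
          + 2 * v.Xi p * (B p * φ.Q p).trace)
        = -∑ k, v.w p k * (momRes U F φ k p + A p k)
        + ((angRes J F φ p + ⁅B p, φ.Q p⁆) * v.eta p).trace
        + 2 * v.Xi p * (scalRes J F φ p - (B p * φ.Q p).trace) := by
      simp only [residualPairing, mul_add, add_mul, Finset.sum_add_distrib, Matrix.trace_add]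
      ring
    simp only [e]
  constructor
  · intro h
    refine coefficients_eq_zero ht (fun k => (contDiff_momRes hU hF hφ k).continuous.add (hAk k))
      ((contDiff_angRes hF hφ).continuous.add hBQ)
      ((contDiff_scalRes hF hφ).continuous.sub htr) (fun p => ?_)
      fun v hv => (hpair v hv).1 (h v hv)
    rw [Matrix.transpose_add, angRes_skew hφ, transpose_lie_of_symm_symm (hBs p) (hφ.Q_symm p),
      neg_add]
  · intro h v hv
    refine (hpair v hv).2 ?_
    rw [setIntegral_congr_fun (g := fun _ => (0 : ℝ)) (measurableSet_slab t₁ t₂), integral_zero]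
    intro p hp
    obtain ⟨h1, h2, h3⟩ := h p hp
    simp [h1, h2, h3]

theorem hamiltonPrinciple_iff (ht : t₁ < t₂) (hU : ContDiffOn ℝ ∞ U (Set.Ioi 0))
    (hF : ContDiff ℝ ∞ F) (hφ : φ.Kinematic) :
    HamiltonPrinciple J U F t₁ t₂ φ ↔ ∀ p ∈ slab t₁ t₂,
      (∀ k, momRes U F φ k p = 0) ∧ angRes J F φ p = 0 ∧ scalRes J F φ p = 0 := by
  have h := dissipativePrinciple_iff (J := J) ht hU hF hφ (A := fun _ => 0) (B := fun _ => 0)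
    continuous_const continuous_const fun _ => Matrix.transpose_zero
  have e : DissipativePrinciple J U F t₁ t₂ φ (fun _ => 0) (fun _ => 0)
      ↔ HamiltonPrinciple J U F t₁ t₂ φ := by
    simp [DissipativePrinciple, HamiltonPrinciple]
  rw [← e, h]
  simp [Ring.lie_def]

theorem momentumEq_iff (A : SpaceTime → E3) (p : SpaceTime) :
    MomentumEq U F φ A p ↔ ∀ k, momRes U F φ k p + A p k = 0 := by
  refine forall_congr' fun k => ?_
  rw [momRes]
  constructor <;> intro h <;> linarith

theorem vkEq_iff (p : SpaceTime) : VKEq J F φ p ↔ angRes J F φ p = 0 := by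
  rw [VKEq, angRes, sub_eq_zero]

theorem scalingEq_iff (p : SpaceTime) : ScalingEq J F φ p ↔ scalRes J F φ p = 0 := by
  rw [ScalingEq, scalRes, sub_eq_zero, eq_comm]

/-- `Dₜ [[ν̂, Q], Q] = [Dₜ² Q, Q]`. -/
theorem Fields.Kinematic.lie_matD2Q (hφ : φ.Kinematic) (p : SpaceTime) :
    matD φ.u (fun q => ⁅⁅φ.nu q, φ.Q q⁆, φ.Q q⁆) p = ⁅matD2Q φ p, φ.Q p⁆ := by
  have hQ := differentiable_of_smooth hφ.Q_smooth p
  have hD := contDiff_matD hφ.Q_smooth hφ.u_smooth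
  have e : (fun q => ⁅⁅φ.nu q, φ.Q q⁆, φ.Q q⁆) = fun q => ⁅matD φ.u φ.Q q, φ.Q q⁆ := by
    funext q
    rw [hφ.evolution q]
    simp only [Ring.lie_def, add_mul, mul_add, Matrix.smul_mul, Matrix.mul_smul]
    abel
  have h := fderiv_lie_dir (differentiable_of_smooth hD p) hQ (1, φ.u p)
  rw [← matD_eq_fderiv_mat, ← matD_eq_fderiv_mat, ← matD_eq_fderiv_mat] at h
  have hz : ⁅matD φ.u φ.Q p, matD φ.u φ.Q p⁆ = 0 := by simp only [Ring.lie_def, sub_self]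
  rw [e, h, hz, add_zero]
  rfl

/-- `‖Dₜ Q‖² = ‖[ν̂, Q]‖² + 4 Λ² ‖Q‖²`: rotation and dilation are orthogonal. -/
theorem Fields.Kinematic.norm_matD_Q (hφ : φ.Kinematic) (p : SpaceTime) :
    ‖matD φ.u φ.Q p‖ ^ 2 = ‖⁅φ.nu p, φ.Q p⁆‖ ^ 2 + 4 * φ.Lam p ^ 2 * ‖φ.Q p‖ ^ 2 := by
  have h1 : (φ.Q p * ⁅φ.nu p, φ.Q p⁆).trace = 0 := trace_mul_lie_self _ _
  have h2 : (⁅φ.nu p, φ.Q p⁆ * φ.Q p).trace = 0 := by rw [Matrix.trace_mul_comm, h1]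
  rw [hφ.evolution p, frobenius_sq, frobenius_sq_of_symm (hφ.S_symm p),
    frobenius_sq_of_symm (hφ.Q_symm p), Matrix.transpose_add, Matrix.transpose_smul, hφ.S_symm,
    hφ.Q_symm]
  simp only [add_mul, mul_add, Matrix.trace_add, Matrix.smul_mul, Matrix.mul_smul,
    Matrix.trace_smul, smul_eq_mul, h1, h2]
  ring

/-- `Tr (Q Dₜ² Q)`, from differentiating `Tr (Q Dₜ Q) = 2 Λ ‖Q‖²`. -/
theorem Fields.Kinematic.trace_matD2Q (hφ : φ.Kinematic) (p : SpaceTime) :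
    (φ.Q p * matD2Q φ p).trace = 2 * ‖φ.Q p‖ ^ 2 * (matD φ.u φ.Lam p + 2 * φ.Lam p ^ 2)
      - ‖⁅φ.nu p, φ.Q p⁆‖ ^ 2 := by
  have hQ := differentiable_of_smooth hφ.Q_smooth p
  have hD := contDiff_matD hφ.Q_smooth hφ.u_smooth
  have hDd := differentiable_of_smooth hD p
  have hm : DifferentiableAt ℝ (fun q => φ.Q q * matD φ.u φ.Q q) p := hQ.mul hDd
  have h1 := (fderiv_trace_dir hm (1, φ.u p)).trans
    (congrArg Matrix.trace (fderiv_matMul_dir hQ hDd (1, φ.u p)))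
  rw [← matD_eq_fderiv_mat, ← matD_eq_fderiv_mat] at h1
  have e : (fun q => (φ.Q q * matD φ.u φ.Q q).trace) = fun q => 2 * φ.Lam q * ‖φ.Q q‖ ^ 2 := by
    funext q
    rw [hφ.evolution q, mul_add, Matrix.trace_add, trace_mul_lie_self, Matrix.mul_smul,
      Matrix.trace_smul, ← frobenius_sq_of_symm (hφ.Q_symm q), smul_eq_mul, zero_add]
  have hL := differentiable_of_smooth (contDiff_const (c := (2 : ℝ)).mul hφ.Lam_smooth) p
  have hn := differentiable_of_smooth hφ.normQ_smooth p
  have h2 := fderiv_realMul_dir hL hn (1, φ.u p)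
  have h3 : fderiv ℝ (fun q => 2 * φ.Lam q) p (1, φ.u p) = 2 * matD φ.u φ.Lam p := by
    rw [matD_eq_fderiv]
    have h := (differentiable_of_smooth hφ.Lam_smooth p).hasFDerivAt.const_mul (2 : ℝ)
    exact congrArg (fun L => L (1, φ.u p)) h.fderiv
  rw [e, h2, h3, hφ.matD_normQ, Matrix.trace_add] at h1
  have hsym : (matD φ.u φ.Q p)ᵀ = matD φ.u φ.Q p := by
    rw [matD_eq_fderiv_mat]
    exact fderiv_symm_dir hφ.Q_symm hQ _
  rw [← frobenius_sq_of_symm hsym, hφ.norm_matD_Q] at h1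
  have h4 : matD φ.u (matD φ.u φ.Q) p = matD2Q φ p := rfl
  rw [h4] at h1
  linear_combination -h1

theorem angRes_eq (hφ : φ.Kinematic) (p : SpaceTime) :
    angRes J F φ p = ⁅(φ.rho p * J) • matD2Q φ p - molField F φ.Q p, φ.Q p⁆ := by
  rw [angRes, hφ.lie_matD2Q]
  simp only [Ring.lie_def, sub_mul, mul_sub, Matrix.smul_mul, Matrix.mul_smul, smul_sub]
  abel

theorem scalRes_eq (hφ : φ.Kinematic) (p : SpaceTime) :
    scalRes J F φ p = (molField F φ.Q p * φ.Q p).trace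
      - φ.rho p * J * (φ.Q p * matD2Q φ p).trace := by
  rw [scalRes, hφ.trace_matD2Q]
  ring

theorem lagrQS_eq_lagr (hφ : φ.Kinematic) (p : SpaceTime) :
    lagrQS J U F φ.rho φ.u φ.Q p = lagr J U F φ p := by
  rw [lagrQS, lagr, hφ.norm_matD_Q]
  ring

end EulerLagrange

end QTensorFlow

theorem mainTheorem3 (J : ℝ) (U : ℝ → ℝ) (hU : ContDiffOn ℝ ∞ U (Set.Ioi 0))
    (F : Mat3 × (Fin 3 → Mat3) → ℝ) (hF : ContDiff ℝ ∞ F)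
    (d : RefData) (m : Motion) (t₁ t₂ : ℝ) (ht : t₁ < t₂) :
    -- consequences of the ansatz
    (∀ p, ContinuityEq (m.fields d) p ∧ QEvolutionEq (m.fields d) p) ∧
    -- on the ansatz the Qian-Sheng Lagrangian is the modified one
    (∀ p, lagrQS J U F (m.fields d).rho (m.fields d).u (m.fields d).Q p
      = lagr J U F (m.fields d) p) ∧
    -- variations of the motion induce the Euler-Poincaré variations
    (∀ γ : MotionFamily, γ.m 0 = m → ∀ p,
      HasDerivAt (fun ε => ((γ.m ε).fields d).rho p)
        ((γ.generator.variation (m.fields d)).rho p) 0 ∧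
      HasDerivAt (fun ε => ((γ.m ε).fields d).u p)
        ((γ.generator.variation (m.fields d)).u p) 0 ∧
      HasDerivAt (fun ε => ((γ.m ε).fields d).nu p)
        ((γ.generator.variation (m.fields d)).nu p) 0 ∧
      HasDerivAt (fun ε => ((γ.m ε).fields d).Lam p)
        ((γ.generator.variation (m.fields d)).Lam p) 0 ∧
      HasDerivAt (fun ε => ((γ.m ε).fields d).Q p)
        ((γ.generator.variation (m.fields d)).Q p) 0) ∧
    -- the modified action principle is equivalent to the VK equations with scaling
    (HamiltonPrinciple J U F t₁ t₂ (m.fields d) ↔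
      ∀ p ∈ slab t₁ t₂,
        MomentumEq U F (m.fields d) 0 p ∧ ContinuityEq (m.fields d) p ∧
        VKEq J F (m.fields d) p ∧ QEvolutionEq (m.fields d) p ∧
        ScalingEq J F (m.fields d) p) ∧
    -- equivalent form of the equations for the order parameter
    (∀ p,
      (VKEq J F (m.fields d) p ↔
        ⁅((m.fields d).rho p * J) • matD2Q (m.fields d) p - molField F (m.fields d).Q p,
          (m.fields d).Q p⁆ = 0) ∧
      (ScalingEq J F (m.fields d) p ↔
        ((((m.fields d).rho p * J) • matD2Q (m.fields d) p - molField F (m.fields d).Q p)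
          * (m.fields d).Q p).trace = 0)) ∧
    -- Rayleigh dissipation
    (∀ (r : (E3 → E3) → (E3 → ℝ) → (E3 → Mat3) → (E3 → Mat3) → E3 → ℝ)
      (A : SpaceTime → E3) (B : SpaceTime → Mat3),
      RayleighForces r t₁ t₂ (m.fields d) A B →
      (DissipativePrinciple J U F t₁ t₂ (m.fields d) A B ↔
        ∀ p ∈ slab t₁ t₂,
          MomentumEq U F (m.fields d) A p ∧
          ⁅((m.fields d).rho p * J) • matD2Q (m.fields d) p - molField F (m.fields d).Q p + B p,
            (m.fields d).Q p⁆ = 0 ∧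
          J * (m.fields d).rho p * ((m.fields d).Q p * matD2Q (m.fields d) p).trace
            = ((molField F (m.fields d).Q p - B p) * (m.fields d).Q p).trace ∧
          ContinuityEq (m.fields d) p)) := by
  have hφ := m.kinematic d
  refine ⟨fun p => ⟨hφ.continuity p, hφ.evolution p⟩, lagrQS_eq_lagr hφ, ?_, ?_, ?_, ?_⟩
  · rintro γ rfl p
    exact ⟨γ.hasDerivAt_rho d p, γ.hasDerivAt_u d p, γ.hasDerivAt_nu d p, γ.hasDerivAt_Lam d p,
      γ.hasDerivAt_Q d p⟩
  · rw [hamiltonPrinciple_iff ht hU hF hφ]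
    refine forall₂_congr fun p _ => ?_
    rw [momentumEq_iff, vkEq_iff, scalingEq_iff]
    simp [hφ.continuity p, hφ.evolution p]
  · intro p
    rw [vkEq_iff, scalingEq_iff, angRes_eq hφ, scalRes_eq hφ]
    refine ⟨Iff.rfl, ?_⟩
    rw [sub_mul, Matrix.trace_sub, Matrix.smul_mul, Matrix.trace_smul, smul_eq_mul,
      Matrix.trace_mul_comm (matD2Q _ p)]
    constructor <;> intro h <;> linarith
  · intro r A B hr
    rw [dissipativePrinciple_iff ht hU hF hφ hr.A_cont hr.B_cont hr.B_symm]
    refine forall₂_congr fun p _ => ?_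
    have h1 : angRes J F (m.fields d) p + ⁅B p, (m.fields d).Q p⁆
        = ⁅((m.fields d).rho p * J) • matD2Q (m.fields d) p - molField F (m.fields d).Q p + B p,
          (m.fields d).Q p⁆ := by
      rw [angRes_eq hφ]
      simp only [Ring.lie_def, add_mul, mul_add]
      abel
    have h2 : scalRes J F (m.fields d) p - (B p * (m.fields d).Q p).trace = 0 ↔
        J * (m.fields d).rho p * ((m.fields d).Q p * matD2Q (m.fields d) p).trace
          = ((molField F (m.fields d).Q p - B p) * (m.fields d).Q p).trace := by
      rw [scalRes_eq hφ, sub_mul, Matrix.trace_sub]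
      constructor <;> intro h <;> linarith
    rw [momentumEq_iff, h1, h2]
    simp [hφ.continuity p]
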